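/- For $n\ge 1$ let $H_{2n+1}$ denote the real Heisenberg group of dimension $2n+1$, i.e. $\mathbb R^n\times\mathbb R^n\times\mathbb R$ with the product $(x,y,z)(x',y',z')=(x+x',\,y+y',\,z+z'+x\cdot y')$. Let $G=H_3\times H_5$, let $\Gamma\subset G$ be a lattice of maximal rank (a discrete subgroup such that $\Gamma\backslash G$ is compact), and let $M=\Gamma\backslash G$, a compact smooth manifold of real dimension $8$. A tensor field on $M$ is called invariant if its pullback to $G$ is invariant under all left translations. For a complex structure $J$ on $M$ (so that the complex dimension is $n=4$) and a smooth $J$-Hermitian metric $g$ with fundamental $2$-form $\Omega(\cdot,\cdot)=g(J\cdot,\cdot)$, the metric $g$ is called SKT if $\partial\overline\partial\Omega=0$, balanced if $d\Omega^{n-1}=d\Omega^{3}=0$, and $k$-th Gauduchon ($1\le k\le n-1$) if $\partial\overline\partial\,\Omega^k\wedge\Omega^{n-k-1}=0$. Then there exists an invariant complex structure $J$ on $M$ such that 1. no smooth $J$-Hermitian metric on $M$, invariant or not, is SKT; 2. no smooth $J$-Hermitian metric on $M$, invariant or not, is balanced; 3. there is an invariant $J$-Hermitian metric on $M$ which is both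 $1$-st Gauduchon and $2$-nd Gauduchon. -/

import Mathlib

open scoped Manifold ContDiff Topology

-- The instance on the type synonym `TopCat.of M` also fires on `M` itself, which only clutters terms.
attribute [-instance] TopCat.of.chartedSpace

noncomputable section

/-! ## Pointwise algebra: wedge products and the type decomposition -/

section Algebra

variable {V : Type*} [AddCommGroup V] [Module ℝ V] [TopologicalSpace V]

/-- The wedge product `α ∧ β` of complex-valued alternating forms on a real vector space,
`(α ∧ β)(v₁, …, v_{k+l}) = ∑_σ sign σ · α(v_{σ 1}, …, v_{σ k}) β(v_{σ (k+1)}, …, v_{σ (k+l)})`,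
where `σ` runs over the `(k, l)`-shuffles. -/
def wedge {k l : ℕ} (α : V [⋀^Fin k]→L[ℝ] ℂ) (β : V [⋀^Fin l]→L[ℝ] ℂ) :
    V [⋀^Fin (k + l)]→L[ℝ] ℂ :=
  { (((LinearMap.mul' ℝ ℂ).compAlternatingMap
      (α.toAlternatingMap.domCoprod β.toAlternatingMap)).domDomCongr finSumFinEquiv :
        V [⋀^Fin (k + l)]→ₗ[ℝ] ℂ) with
    cont := by
      change Continuous fun v : Fin (k + l) → V => LinearMap.mul' ℝ ℂ
        ((α.toAlternatingMap.domCoprod β.toAlternatingMap) fun i => v (finSumFinEquiv i))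
      simp only [AlternatingMap.domCoprod_apply, sum_apply, map_sum]
      refine continuous_finsetSum _ fun σ _ => ?_
      induction σ using Quotient.inductionOn' with
      | _ σ =>
        simp only [AlternatingMap.domCoprod.summand_mk'']
        have hc : Continuous fun v : Fin (k + l) → V =>
            α (fun i => v (finSumFinEquiv (σ (Sum.inl i)))) *
              β (fun i => v (finSumFinEquiv (σ (Sum.inr i)))) :=
          (α.cont.comp (continuous_pi fun i => continuous_apply _)).mul
            (β.cont.comp (continuous_pi fun i => continuous_apply _))
        rcases Int.units_eq_one_or (Equiv.Perm.sign σ) with h | h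
        · rw [h]
          simpa using hc
        · rw [h]
          have hn : Continuous fun v : Fin (k + l) → V =>
              -(α (fun i => v (finSumFinEquiv (σ (Sum.inl i)))) *
                β (fun i => v (finSumFinEquiv (σ (Sum.inr i))))) := hc.neg
          simpa using hn }

/-- The `k`-th wedge power `α ∧ ⋯ ∧ α` of a `2`-form. -/
def wedgePow (α : V [⋀^Fin 2]→L[ℝ] ℂ) : (k : ℕ) → V [⋀^Fin (2 * k)]→L[ℝ] ℂ
  | 0 => ContinuousAlternatingMap.constOfIsEmpty ℝ V (Fin 0) 1
  | k + 1 => wedge (wedgePow α k) α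

/-- The coefficient of the term `α(w₁, …, w_k)`, with `w_j = J v_j` for `j ∈ T` and `w_j = v_j`
for `j ∉ T`, in the expansion of the complex-multilinear extension of `α` at the vectors
`½(v_j - i J v_j)` (the `(1,0)`-part of `v_j`) for `j ∈ S` and `½(v_j + i J v_j)`
(the `(0,1)`-part of `v_j`) for `j ∉ S`. -/
def typeCoeff {k : ℕ} (S T : Finset (Fin k)) : ℂ :=
  (1 / 2) ^ k * ∏ j ∈ T, if j ∈ S then -Complex.I else Complex.I

theorem typeCoeff_map {k : ℕ} (σ : Equiv.Perm (Fin k)) (S T : Finset (Fin k)) :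
    typeCoeff (S.map σ.toEmbedding) (T.map σ.toEmbedding) = typeCoeff S T := by
  simp [typeCoeff, Finset.prod_map]

/-- The component of type `(p, k - p)` of a complex-valued real `k`-form `α`, with respect to the
complex structure `J`: the vectors `v_j` are split into their `(1,0)`- and `(0,1)`-parts
`½(v_j ∓ i J v_j)`, and of the resulting expansion of the complex-multilinear extension of `α`
only the terms with exactly `p` parts of type `(1,0)` are kept. -/
def typeProj (J : V →L[ℝ] V) {k : ℕ} (p : ℕ) (α : V [⋀^Fin k]→L[ℝ] ℂ) :
    V [⋀^Fin k]→L[ℝ] ℂ :=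
  { (∑ S ∈ Finset.powersetCard p Finset.univ, ∑ T : Finset (Fin k), typeCoeff S T •
      α.toContinuousMultilinearMap.compContinuousLinearMap
        (fun j => if j ∈ T then J else ContinuousLinearMap.id ℝ V) :
          ContinuousMultilinearMap ℝ (fun _ : Fin k => V) ℂ) with
    map_eq_zero_of_eq' := by
      intro v i j hv hij
      change (∑ S ∈ Finset.powersetCard p Finset.univ, ∑ T : Finset (Fin k), typeCoeff S T •
        α.toContinuousMultilinearMap.compContinuousLinearMap
          (fun j => if j ∈ T then J else ContinuousLinearMap.id ℝ V) :
            ContinuousMultilinearMap ℝ (fun _ : Fin k => V) ℂ) v = 0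
      simp only [sum_apply, smul_apply,
        ContinuousMultilinearMap.compContinuousLinearMap_apply]
      have key : ∀ T : Finset (Fin k),
          α (fun l => (if l ∈ T.map (Equiv.swap i j).toEmbedding then J
              else ContinuousLinearMap.id ℝ V) (v l)) =
            -α (fun l => (if l ∈ T then J else ContinuousLinearMap.id ℝ V) (v l)) := by
        intro T
        rw [← ContinuousAlternatingMap.coe_toAlternatingMap, ← AlternatingMap.map_swap _ _ hij]
        congr 1
        funext l
        have h1 : v (Equiv.swap i j l) = v l := by
          rcases eq_or_ne l i with rfl | h
          · simp [hv]
          rcases eq_or_ne l j with rfl | h'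
          · simp [hv]
          rw [Equiv.swap_apply_of_ne_of_ne h h']
        have h2 : (l ∈ T.map (Equiv.swap i j).toEmbedding) ↔ Equiv.swap i j l ∈ T := by
          simp [Finset.mem_map_equiv]
        simp only [Function.comp, h1, h2]
      set F : ℂ := ∑ S ∈ Finset.powersetCard p Finset.univ, ∑ T : Finset (Fin k), typeCoeff S T •
        α (fun l => (if l ∈ T then J else ContinuousLinearMap.id ℝ V) (v l)) with hF
      change F = 0
      have hneg : F = -F := by
        conv_lhs => rw [hF]
        rw [hF, ← Finset.sum_neg_distrib]
        refine (Finset.sum_nbij' (fun S => S.map (Equiv.swap i j).toEmbedding)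
          (fun S => S.map (Equiv.swap i j).toEmbedding) ?_ ?_ ?_ ?_ ?_).symm
        · intro S hS
          simpa [Finset.mem_powersetCard] using hS
        · intro S hS
          simpa [Finset.mem_powersetCard] using hS
        · intro S _
          ext x
          simp [Finset.mem_map_equiv]
        · intro S _
          ext x
          simp [Finset.mem_map_equiv]
        · intro S _
          rw [← Finset.sum_neg_distrib]
          refine Finset.sum_nbij' (fun S => S.map (Equiv.swap i j).toEmbedding)
            (fun S => S.map (Equiv.swap i j).toEmbedding) ?_ ?_ ?_ ?_ ?_
          · intro T _
            simp
          · intro T _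
            simp
          · intro T _
            ext x
            simp [Finset.mem_map_equiv]
          · intro T _
            ext x
            simp [Finset.mem_map_equiv]
          · intro T _
            rw [typeCoeff_map, key T, smul_neg]
      exact self_eq_neg.mp hneg }

end Algebra

/-! ## Differential forms, complex structures and Hermitian metrics on a manifold -/

section Manifold

variable {E : Type*} [NormedAddCommGroup E] [NormedSpace ℝ E]
  {M : Type*} [TopologicalSpace M] [ChartedSpace E M]

variable (E M) in
/-- Complex-valued differential `k`-forms on a manifold `M` modelled on the vector space `E`. -/
abbrev DiffForm (k : ℕ) : Type _ :=
  (x : M) → TangentSpace 𝓘(ℝ, E) x [⋀^Fin k]→L[ℝ] ℂ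

/-- The expression of a differential form in the preferred chart at `x₀`, that is, its pullback
under the inverse of this chart. -/
def formInChart {k : ℕ} (η : DiffForm E M k) (x₀ : M) : E → E [⋀^Fin k]→L[ℝ] ℂ :=
  fun y => (η ((chartAt E x₀).symm y)).compContinuousLinearMap
    (mfderiv 𝓘(ℝ, E) 𝓘(ℝ, E) (chartAt E x₀).symm y)

/-- The exterior derivative `dη` of a differential form, computed at each point in the preferred
chart at this point. -/
def extD {k : ℕ} (η : DiffForm E M k) : DiffForm E M (k + 1) :=
  fun x => (extDeriv (formInChart η x) (chartAt E x x)).compContinuousLinearMap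
    (mfderiv 𝓘(ℝ, E) 𝓘(ℝ, E) (chartAt E x) x)

variable [IsManifold 𝓘(ℝ, E) ∞ M]

variable (E M) in
/-- A complex structure on a smooth manifold `M`, of complex dimension `n`: a field `J` of
endomorphisms of the tangent spaces with `J² = -1`, such that around each point there are smooth
coordinates with values in `ℂⁿ` in which `J` is the multiplication by `i` (so that these
coordinates form a holomorphic atlas of `M`, with `J` as induced almost complex structure).
In particular `J` is smooth. -/
structure ComplexStructure (n : ℕ) where
  J : (x : M) → TangentSpace 𝓘(ℝ, E) x →L[ℝ] TangentSpace 𝓘(ℝ, E) x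
  J_sq : ∀ (x : M) (v : TangentSpace 𝓘(ℝ, E) x), J x (J x v) = -v
  exists_holomorphic_chart : ∀ x : M, ∃ φ : OpenPartialHomeomorph M (Fin n → ℂ),
    x ∈ φ.source ∧
    ContMDiffOn 𝓘(ℝ, E) 𝓘(ℝ, Fin n → ℂ) ∞ φ φ.source ∧
    ContMDiffOn 𝓘(ℝ, Fin n → ℂ) 𝓘(ℝ, E) ∞ φ.symm φ.target ∧
    ∀ y ∈ φ.source, ∀ v : TangentSpace 𝓘(ℝ, E) y,
      ∀ j : Fin n, (mfderiv 𝓘(ℝ, E) 𝓘(ℝ, Fin n → ℂ) φ y (J y v) : Fin n → ℂ) j =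
        Complex.I * (mfderiv 𝓘(ℝ, E) 𝓘(ℝ, Fin n → ℂ) φ y v : Fin n → ℂ) j

namespace ComplexStructure

variable {n : ℕ} (𝒥 : ComplexStructure E M n)

/-- The component of type `(p, k - p)` of a `k`-form. -/
def proj {k : ℕ} (p : ℕ) (η : DiffForm E M k) : DiffForm E M k :=
  fun x => typeProj (𝒥.J x) p (η x)

/-- The operator `∂` on forms of type `(p, q)`: the component of type `(p + 1, q)` of `dη`. -/
def del (p : ℕ) {k : ℕ} (η : DiffForm E M k) : DiffForm E M (k + 1) :=
  𝒥.proj (p + 1) (extD η)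

/-- The operator `∂̄` on forms of type `(p, q)`: the component of type `(p, q + 1)` of `dη`. -/
def delbar (p : ℕ) {k : ℕ} (η : DiffForm E M k) : DiffForm E M (k + 1) :=
  𝒥.proj p (extD η)

/-- A (smooth) `J`-Hermitian metric: a smooth Riemannian metric `g` with `g(Jv, Jw) = g(v, w)`. -/
structure HermitianMetric where
  g : Bundle.ContMDiffRiemannianMetric 𝓘(ℝ, E) ∞ E (fun x : M => TangentSpace 𝓘(ℝ, E) x)
  compat : ∀ (x : M) (v w : TangentSpace 𝓘(ℝ, E) x),
    g.inner x (𝒥.J x v) (𝒥.J x w) = g.inner x v w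

end ComplexStructure

namespace ComplexStructure.HermitianMetric

variable {n : ℕ} {𝒥 : ComplexStructure E M n} (h : 𝒥.HermitianMetric)

theorem inner_J_self (x : M) (v : TangentSpace 𝓘(ℝ, E) x) :
    h.g.inner x (𝒥.J x v) v = 0 := by
  have h1 := h.compat x (𝒥.J x v) v
  rw [𝒥.J_sq, h.g.symm x (𝒥.J x v) v] at h1
  rw [h.g.symm x (𝒥.J x v) v]
  have h2 : h.g.inner x (-v) (𝒥.J x v) = -h.g.inner x v (𝒥.J x v) := by
    rw [map_neg]
    rfl
  linarith

/-- The fundamental `2`-form `Ω(v, w) = g(Jv, w)` of a Hermitian metric. -/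
def fundamentalForm : DiffForm E M 2 := fun x =>
  { toFun := fun v => ((h.g.inner x (𝒥.J x (v 0)) (v 1) : ℝ) : ℂ)
    map_update_add' := by
      intro _ v i a b
      fin_cases i <;> simp [Function.update]
    map_update_smul' := by
      intro _ v i c a
      fin_cases i <;> simp [Function.update]
    map_eq_zero_of_eq' := by
      intro v i j hv hij
      have h01 : v 0 = v 1 := by
        fin_cases i <;> fin_cases j <;> simp_all
      simp [← h01, h.inner_J_self x (v 0)]
    cont := by
      have h1 : Continuous fun v : Fin 2 → TangentSpace 𝓘(ℝ, E) x =>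
          h.g.inner x (𝒥.J x (v 0)) (v 1) := by
        let B : E →L[ℝ] E →L[ℝ] ℝ := h.g.inner x
        let A : E →L[ℝ] E := 𝒥.J x
        have h2 : Continuous fun v : Fin 2 → E => B (A (v 0)) (v 1) := by fun_prop
        exact h2
      exact Complex.continuous_ofReal.comp h1 }

/-- The power `Ω^k = Ω ∧ ⋯ ∧ Ω` of the fundamental form, a form of type `(k, k)`. -/
def fundamentalPow (k : ℕ) : DiffForm E M (2 * k) := fun x => wedgePow (h.fundamentalForm x) k

/-- The form `∂∂̄(Ω^k)`, of type `(k + 1, k + 1)`. -/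
def delDelbarPow (k : ℕ) : DiffForm E M (2 * k + 1 + 1) :=
  𝒥.del k (𝒥.delbar k (h.fundamentalPow k))

/-- A Hermitian metric is SKT (strong Kähler with torsion, or pluriclosed) if `∂∂̄Ω = 0`. -/
def IsSKT : Prop := 𝒥.del 1 (𝒥.delbar 1 h.fundamentalForm) = 0

/-- On a manifold of complex dimension `n`, a Hermitian metric is balanced if `dΩ^{n-1} = 0`. -/
def IsBalanced : Prop := extD (h.fundamentalPow (n - 1)) = 0

/-- On a manifold of complex dimension `n`, a Hermitian metric is `k`-th Gauduchon,
where `1 ≤ k ≤ n - 1`, if `∂∂̄(Ω^k) ∧ Ω^{n-k-1} = 0`. -/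
def IsKthGauduchon (k : ℕ) : Prop :=
  1 ≤ k ∧ k ≤ n - 1 ∧ ∀ x, wedge (h.delDelbarPow k x) (h.fundamentalPow (n - k - 1) x) = 0

end ComplexStructure.HermitianMetric

end Manifold

/-! ## Heisenberg groups -/

/-- The real Heisenberg group `H_{2n+1}`, of dimension `2n + 1`, with elements `(x, y, z)`,
`x, y ∈ ℝⁿ`, `z ∈ ℝ`, and the smooth structure of `ℝⁿ × ℝⁿ × ℝ`. -/
def Heisenberg (n : ℕ) : Type := (Fin n → ℝ) × (Fin n → ℝ) × ℝ

namespace Heisenberg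

variable {n : ℕ}

instance : NormedAddCommGroup (Heisenberg n) :=
  inferInstanceAs (NormedAddCommGroup ((Fin n → ℝ) × (Fin n → ℝ) × ℝ))

instance : NormedSpace ℝ (Heisenberg n) :=
  inferInstanceAs (NormedSpace ℝ ((Fin n → ℝ) × (Fin n → ℝ) × ℝ))

instance : FiniteDimensional ℝ (Heisenberg n) :=
  inferInstanceAs (FiniteDimensional ℝ ((Fin n → ℝ) × (Fin n → ℝ) × ℝ))

instance : ProperSpace (Heisenberg n) :=
  inferInstanceAs (ProperSpace ((Fin n → ℝ) × (Fin n → ℝ) × ℝ))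

/-- The element `(x, y, z)`. -/
def mk (x y : Fin n → ℝ) (z : ℝ) : Heisenberg n := (x, y, z)

/-- The coordinate `x` of `(x, y, z)`. -/
def x (a : Heisenberg n) : Fin n → ℝ := Prod.fst a

/-- The coordinate `y` of `(x, y, z)`. -/
def y (a : Heisenberg n) : Fin n → ℝ := Prod.fst (Prod.snd a)

/-- The coordinate `z` of `(x, y, z)`. -/
def z (a : Heisenberg n) : ℝ := Prod.snd (Prod.snd a)

@[simp] theorem x_mk (x y : Fin n → ℝ) (z : ℝ) : (mk x y z).x = x := rfl
@[simp] theorem y_mk (x y : Fin n → ℝ) (z : ℝ) : (mk x y z).y = y := rfl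
@[simp] theorem z_mk (x y : Fin n → ℝ) (z : ℝ) : (mk x y z).z = z := rfl

@[ext] theorem ext {a b : Heisenberg n} (hx : a.x = b.x) (hy : a.y = b.y) (hz : a.z = b.z) :
    a = b :=
  Prod.ext hx (Prod.ext hy hz)

/-- The product `(x, y, z) (x', y', z') = (x + x', y + y', z + z' + x ⬝ y')`, that is, the product
of the unitriangular matrices with first row `(1, x, z)`, last column `(z, y, 1)` and the
identity matrix in the middle. -/
instance : Mul (Heisenberg n) :=
  ⟨fun a b => mk (a.x + b.x) (a.y + b.y) (a.z + b.z + a.x ⬝ᵥ b.y)⟩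

instance : One (Heisenberg n) := ⟨mk 0 0 0⟩

instance : Inv (Heisenberg n) := ⟨fun a => mk (-a.x) (-a.y) (-a.z + a.x ⬝ᵥ a.y)⟩

theorem mul_def (a b : Heisenberg n) :
    a * b = mk (a.x + b.x) (a.y + b.y) (a.z + b.z + a.x ⬝ᵥ b.y) := rfl

theorem one_def : (1 : Heisenberg n) = mk 0 0 0 := rfl

theorem inv_def (a : Heisenberg n) : a⁻¹ = mk (-a.x) (-a.y) (-a.z + a.x ⬝ᵥ a.y) := rfl

instance : Group (Heisenberg n) :=
  Group.ofLeftAxioms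
    (fun a b c => by
      ext1 <;> simp only [mul_def, x_mk, y_mk, z_mk, add_dotProduct, dotProduct_add, add_assoc]
      ring)
    (fun a => by ext1 <;> simp [mul_def, one_def])
    (fun a => by ext1 <;> simp [mul_def, one_def, inv_def])

theorem contDiff_mul :
    ContDiff ℝ ∞ (fun p : Heisenberg n × Heisenberg n => p.1 * p.2) := by
  change ContDiff ℝ ∞ (fun p : ((Fin n → ℝ) × (Fin n → ℝ) × ℝ) × ((Fin n → ℝ) × (Fin n → ℝ) × ℝ) =>
    (p.1.1 + p.2.1, p.1.2.1 + p.2.2.1, p.1.2.2 + p.2.2.2 + ∑ i, p.1.1 i * p.2.2.1 i))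
  fun_prop

theorem contDiff_inv : ContDiff ℝ ∞ (fun a : Heisenberg n => a⁻¹) := by
  change ContDiff ℝ ∞ (fun a : (Fin n → ℝ) × (Fin n → ℝ) × ℝ =>
    (-a.1, -a.2.1, -a.2.2 + ∑ i, a.1 i * a.2.1 i))
  fun_prop

instance : IsTopologicalGroup (Heisenberg n) where
  continuous_mul := contDiff_mul.continuous
  continuous_inv := contDiff_inv.continuous

end Heisenberg

/-- The Lie group `H₃ × H₅`. -/
abbrev H3xH5 : Type := Heisenberg 1 × Heisenberg 2

/-! ## Quotients of `H₃ × H₅` by discrete subgroups -/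

section Quotient

variable (Γ : Subgroup H3xH5)

/-- The quotient `Γ \ (H₃ × H₅)` of `H₃ × H₅` by the left translations by elements of `Γ`. It
carries the quotient topology and, if `Γ` is discrete, the charts given by the local inverses
of the projection from `H₃ × H₅`. -/
abbrev Nilmanifold : Type := MulAction.orbitRel.Quotient Γ H3xH5

/-- The projection `H₃ × H₅ → Γ \ (H₃ × H₅)`. -/
def nilProj (a : H3xH5) : Nilmanifold Γ := Quotient.mk (MulAction.orbitRel Γ H3xH5) a

instance [DiscreteTopology Γ] : ProperlyDiscontinuousSMul Γ H3xH5 :=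
  Γ.properlyDiscontinuousSMul_of_tendsto_cofinite
    (Γ.tendsto_coe_cofinite_of_discrete (SetLike.isDiscrete_iff_discreteTopology.mpr inferInstance))

theorem contDiff_H3xH5_mul_left (a : H3xH5) : ContDiff ℝ ∞ (fun x : H3xH5 => a * x) := by
  have h1 : ContDiff ℝ ∞ (fun x : H3xH5 => a.1 * x.1) :=
    Heisenberg.contDiff_mul.comp (contDiff_const.prodMk contDiff_fst)
  have h2 : ContDiff ℝ ∞ (fun x : H3xH5 => a.2 * x.2) :=
    Heisenberg.contDiff_mul.comp (contDiff_const.prodMk contDiff_snd)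
  exact h1.prodMk h2

theorem isLocalHomeomorph_nilProj [DiscreteTopology Γ] : IsLocalHomeomorph (nilProj Γ) :=
  (isQuotientCoveringMap_quotientMk_of_properlyDiscontinuousSMul
    (E := H3xH5) (G := Γ)).isCoveringMap.isLocalHomeomorph

theorem exists_eq_localInverseAt [DiscreteTopology Γ]
    {e : OpenPartialHomeomorph (Nilmanifold Γ) H3xH5} (he : e ∈ atlas H3xH5 (Nilmanifold Γ)) :
    ∃ a, e = (isLocalHomeomorph_nilProj Γ).localInverseAt a := by
  obtain ⟨q, rfl⟩ := he
  exact ⟨_, OpenPartialHomeomorph.trans_refl _⟩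

instance [DiscreteTopology Γ] : IsManifold 𝓘(ℝ, H3xH5) ∞ (Nilmanifold Γ) := by
  have hπ := isLocalHomeomorph_nilProj Γ
  apply isManifold_of_contDiffOn
  intro e e' he he'
  obtain ⟨a, rfl⟩ := exists_eq_localInverseAt Γ he
  obtain ⟨b, rfl⟩ := exists_eq_localInverseAt Γ he'
  change ContDiffOn ℝ ∞ (fun x : H3xH5 => hπ.localInverseAt b ((hπ.localInverseAt a).symm x)) _
  intro x hx
  have hxb : (hπ.localInverseAt a).symm x ∈ (hπ.localInverseAt b).source := hx.1.2
  rw [hπ.localInverseAt_symm] at hxb ⊢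
  have hp := hπ.apply_localInverseAt_of_mem hxb
  obtain ⟨γ, hγ⟩ : ∃ γ : Γ, γ • x = hπ.localInverseAt b (nilProj Γ x) := by
    have := Quotient.exact hp
    exact this
  apply ContDiffWithinAt.congr_of_eventuallyEq (f := fun x : H3xH5 => (γ : H3xH5) * x)
    (contDiff_H3xH5_mul_left _).contDiffAt.contDiffWithinAt _ hγ.symm
  apply Filter.Eventually.filter_mono nhdsWithin_le_nhds
  have h1 : ∀ᶠ y in 𝓝 x, (γ : H3xH5) * y ∈ (hπ.localInverseAt b).target := by
    refine (contDiff_H3xH5_mul_left (γ : H3xH5)).continuous.continuousAt.eventually_mem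
      ((hπ.localInverseAt b).open_target.mem_nhds ?_)
    change γ • x ∈ _
    rw [hγ]
    exact (hπ.localInverseAt b).map_source hxb
  have h2 : ∀ᶠ y in 𝓝 x, nilProj Γ y ∈ (hπ.localInverseAt b).source :=
    hπ.continuous.continuousAt.eventually_mem ((hπ.localInverseAt b).open_source.mem_nhds hxb)
  filter_upwards [h1, h2] with y hy1 hy2
  apply hπ.injOn_localInverseAt_target ((hπ.localInverseAt b).map_source hy2) hy1
  rw [hπ.apply_localInverseAt_of_mem hy2]
  exact (Quotient.sound (s := MulAction.orbitRel Γ H3xH5) ⟨γ, rfl⟩).symm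

/-! ## Invariant structures -/

variable {Γ} [DiscreteTopology Γ]

/-- A complex structure `J` on `Γ \ (H₃ × H₅)` is invariant if its pullback to `H₃ × H₅` is
invariant under all left translations. -/
def ComplexStructure.IsInvariant {n : ℕ} (𝒥 : ComplexStructure H3xH5 (Nilmanifold Γ) n) : Prop :=
  ∀ (a x : H3xH5) (v w : TangentSpace 𝓘(ℝ, H3xH5) x),
    𝒥.J (nilProj Γ x) (mfderiv 𝓘(ℝ, H3xH5) 𝓘(ℝ, H3xH5) (nilProj Γ) x v) =
        mfderiv 𝓘(ℝ, H3xH5) 𝓘(ℝ, H3xH5) (nilProj Γ) x w →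
      𝒥.J (nilProj Γ (a * x))
          (mfderiv 𝓘(ℝ, H3xH5) 𝓘(ℝ, H3xH5) (fun y => nilProj Γ (a * y)) x v) =
        mfderiv 𝓘(ℝ, H3xH5) 𝓘(ℝ, H3xH5) (fun y => nilProj Γ (a * y)) x w

/-- A Hermitian metric on `Γ \ (H₃ × H₅)` is invariant if its pullback to `H₃ × H₅` is
invariant under all left translations. -/
def ComplexStructure.HermitianMetric.IsInvariant {n : ℕ}
    {𝒥 : ComplexStructure H3xH5 (Nilmanifold Γ) n} (h : 𝒥.HermitianMetric) : Prop :=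
  ∀ (a x : H3xH5) (v w : TangentSpace 𝓘(ℝ, H3xH5) x),
    h.g.inner (nilProj Γ (a * x))
        (mfderiv 𝓘(ℝ, H3xH5) 𝓘(ℝ, H3xH5) (fun y => nilProj Γ (a * y)) x v)
        (mfderiv 𝓘(ℝ, H3xH5) 𝓘(ℝ, H3xH5) (fun y => nilProj Γ (a * y)) x w) =
      h.g.inner (nilProj Γ x)
        (mfderiv 𝓘(ℝ, H3xH5) 𝓘(ℝ, H3xH5) (nilProj Γ) x v)
        (mfderiv 𝓘(ℝ, H3xH5) 𝓘(ℝ, H3xH5) (nilProj Γ) x w)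

end Quotient

end

/-!
Left invariant vector fields, forms and metrics are handled on the Lie algebra of `H₃ × H₅`, with
basis `X_j, Y_j` (`j = 1, 2, 3`), `Z₁, Z₂` and brackets `[X₁, Y₁] = Z₁`,
`[X₂, Y₂] = [X₃, Y₃] = Z₂`. The complex structure is given by `J X_j = Y_j` and
`J Z₂ = Z₁ + Z₂`. All brackets of different complex lines `⟨v, J v⟩`, with `v` one of
`X₁, X₂, X₃, Z₂`, vanish, so that only the central elements `c_a = [v_a, J v_a]`, which are
`Z₁, Z₂, Z₂, 0`, matter. Integrability is shown by global holomorphic coordinates on the group: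
`x_j + i y_j` and a quadratic modification of `(-1 + i) z₁ + z₂` (`holCoord`). In the charts of the
quotient, the projection from the group is a left translation, which is an affine map.

A differential form on the quotient is lifted to the group and expressed in the left invariant
frame (`frameForm`); its exterior derivative is then the sum of the Chevalley–Eilenberg differential
of its values and of derivatives of its coefficients along left invariant vector fields
(`frameForm_extD_apply`). On a compact quotient the latter have integral zero. Instead of an
integral over the quotient, the proof uses a linear functional `m` on functions on the group which
kills all derivatives `W f` of bounded smooth functions `f` along left invariant fields `W`, but
not a given function with real part bounded below by a positive constant
(`exists_linearMap_fderiv_frame_eq_zero`). It exists because `∫ φ(q) (W f)(δ_r q) dq → 0` as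
`r → ∞`, for a bump function `φ` and the automorphic dilations `δ_r`, by integration by parts.

* If `Ω` is SKT, apply `m` to `∂∂̄Ω(X₂, Y₂, X₃, Y₃) = 0`. Since `c₂ = c₃ = Z₂`, what remains is a
  nonzero multiple of `m(‖Z₂‖²)`, and `m` can be chosen not to kill this (`not_isSKT`).
* If `Ω` is balanced, apply `m` to `dΩ³(Z₂, X₁, Y₁, X₂, Y₂, X₃, Y₃) = 0`. The terms with
  `[X₂, Y₂] = [X₃, Y₃] = Z₂` repeat an argument, and since `[X₁, Y₁] = Z₁ = J Z₂ - Z₂`, what remains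
  is `m(Ω³(Z₂, J Z₂, X₂, Y₂, X₃, Y₃))`, the mean of a function which is positive by Gram–Schmidt
  (`wedgePow_three_pos`, `not_isBalanced`).
* For an invariant metric in which the complex lines of the `v_a` are orthogonal, the value of
  `∂∂̄Ω` on the lines of `v_a` and `v_b` is `i ⟨c_a, c_b⟩` (`delDelbar_apply_pairs`), and
  `∂∂̄Ω ∧ Ω²` and `∂∂̄Ω² ∧ Ω` both vanish as soon as
  `⟨c₁, c₂⟩ g₃ + ⟨c₁, c₃⟩ g₂ + ⟨c₂, c₃⟩ g₁ = 0` with `g_j = ‖X_j‖²`. For the metric `lieMetric`,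
  `⟨Z₁, Z₂⟩ = -1`, `‖Z₂‖² = 1`, `g₁ = 2` and `g₂ = g₃ = 1`, so the sum is `-1 - 1 + 2 = 0`
  (`balance_lieCenter`, `isKthGauduchon_one`, `isKthGauduchon_two`).
-/

noncomputable section

/-! ### The wedge product of alternating forms -/

section WedgeAlgebra

variable {V : Type*} [AddCommGroup V] [Module ℝ V] [TopologicalSpace V]

theorem wedge_apply {k l : ℕ} (α : V [⋀^Fin k]→L[ℝ] ℂ) (β : V [⋀^Fin l]→L[ℝ] ℂ)
    (v : Fin (k + l) → V) :
    wedge α β v = ((k.factorial : ℂ) * l.factorial)⁻¹ * ∑ σ : Equiv.Perm (Fin (k + l)),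
      ((Equiv.Perm.sign σ : ℤ) : ℂ) *
        (α (fun i => v (σ (Fin.castAdd l i))) * β (fun j => v (σ (Fin.natAdd k j)))) := by
  have h := congrArg (fun f => LinearMap.mul' ℝ ℂ (f fun i => v (finSumFinEquiv i)))
    (MultilinearMap.domCoprod_alternization_eq α.toAlternatingMap β.toAlternatingMap)
  simp only [Fintype.card_fin, AlternatingMap.smul_apply] at h
  have h1 : wedge α β v = LinearMap.mul' ℝ ℂ
      ((α.toAlternatingMap.domCoprod β.toAlternatingMap) fun i => v (finSumFinEquiv i)) := rfl
  rw [map_nsmul, ← h1, nsmul_eq_mul] at h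
  have hne : ((k.factorial : ℂ) * l.factorial) ≠ 0 := by
    simp [Nat.factorial_ne_zero]
  rw [eq_inv_mul_iff_mul_eq₀ hne, ← Nat.cast_mul, ← h, MultilinearMap.alternatization_apply,
    map_sum]
  refine Fintype.sum_equiv finSumFinEquiv.permCongr _ _ fun σ => ?_
  rw [Equiv.Perm.sign_permCongr]
  rcases Int.units_eq_one_or (Equiv.Perm.sign σ) with h | h <;> rw [h] <;> simp

/-- The permutations of `Fin (n + 1)`, sorted by the image `p` of `0`: the remaining values are
those of a permutation of `Fin n`, relabelled by `p.succAbove`. -/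
theorem sum_perm_fin_succ {n : ℕ} (F : (Fin (n + 1) → Fin (n + 1)) → ℂ) :
    ∑ σ : Equiv.Perm (Fin (n + 1)), ((Equiv.Perm.sign σ : ℤ) : ℂ) * F σ =
      ∑ p : Fin (n + 1), (-1) ^ (p : ℕ) * ∑ e : Equiv.Perm (Fin n),
        ((Equiv.Perm.sign e : ℤ) : ℂ) * F (Fin.cons p fun i => p.succAbove (e i)) := by
  simp only [Finset.mul_sum]
  rw [← Fintype.sum_prod_type']
  let f : Fin (n + 1) × Equiv.Perm (Fin n) → Equiv.Perm (Fin (n + 1)) := fun x =>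
    (Fin.cycleRange x.1).symm * Equiv.Perm.decomposeFin.symm (0, x.2)
  have hf0 : ∀ x, f x 0 = x.1 := fun x => by simp [f]
  have hfs : ∀ x i, f x (Fin.succ i) = x.1.succAbove (x.2 i) := fun x i => by simp [f]
  have hinj : Function.Injective f := by
    rintro ⟨p, e⟩ ⟨q, e'⟩ h
    have hp : p = q := by simpa [hf0] using congrArg (fun s => s 0) h
    subst hp
    have he : e = e' := by
      ext1 i
      simpa [hfs] using congrArg (fun s => s (Fin.succ i)) h
    rw [he]
  have hbij : Function.Bijective f := by
    rw [Fintype.bijective_iff_injective_and_card]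
    exact ⟨hinj, by simp [Fintype.card_perm, Nat.factorial_succ]⟩
  refine (Fintype.sum_equiv (Equiv.ofBijective f hbij) _ _ fun x => ?_).symm
  have hs : Equiv.Perm.sign (f x) = (-1) ^ (x.1 : ℕ) * Equiv.Perm.sign x.2 := by
    simp [f, Fin.sign_cycleRange]
  have hF : (f x : Fin (n + 1) → Fin (n + 1)) = Fin.cons x.1 fun i => x.1.succAbove (x.2 i) := by
    funext i
    refine Fin.cases ?_ (fun i => ?_) i
    · simp [hf0]
    · simp [hfs]
  rw [Equiv.ofBijective_apply, hs, hF]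
  push_cast
  ring

theorem sum_perm_alternating {k : ℕ} (α : V [⋀^Fin k]→L[ℝ] ℂ) (v : Fin k → V) :
    ∑ e : Equiv.Perm (Fin k), ((Equiv.Perm.sign e : ℤ) : ℂ) * α (fun i => v (e i)) =
      k.factorial * α v := by
  have h : ∀ e : Equiv.Perm (Fin k),
      ((Equiv.Perm.sign e : ℤ) : ℂ) * α (fun i => v (e i)) = α v := by
    intro e
    have := α.toAlternatingMap.map_perm v e
    change α (fun i => v (e i)) = _ at this
    rw [this]
    change _ * (Equiv.Perm.sign e • α v) = α v
    rcases Int.units_eq_one_or (Equiv.Perm.sign e) with h | h <;> rw [h] <;> simp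
  simp [h, Fintype.card_perm]

/-- The wedge product with a `2`-form, written as a sum over the ordered pairs of arguments that
go into the `2`-form. -/
theorem wedge_two_apply {k : ℕ} (α : V [⋀^Fin k]→L[ℝ] ℂ) (β : V [⋀^Fin 2]→L[ℝ] ℂ)
    (v : Fin (k + 2) → V) :
    wedge α β v = (1 / 2) * ∑ p : Fin (k + 2), ∑ q : Fin (k + 1), (-1) ^ (p + q : ℕ) *
      (α (fun i => v (p.succAbove (q.succAbove i))) * β ![v p, v (p.succAbove q)]) := by
  -- Moving the two arguments of `β` to the front is an even permutation.
  let ρ : Equiv.Perm (Fin (k + 2)) := finRotate (k + 2) * finRotate (k + 2)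
  have hρ : Equiv.Perm.sign ρ = 1 := by
    rcases Int.units_eq_one_or (Equiv.Perm.sign (finRotate (k + 2))) with h | h <;> simp [ρ, h]
  have hρ1 : ∀ i : Fin k, ρ (Fin.castAdd 2 i) = i.succ.succ := by
    intro i
    have h1 : finRotate (k + 2) (Fin.castAdd 2 i) = ⟨i + 1, by omega⟩ :=
      finRotate_of_lt (n := k + 1) (k := i) (by omega)
    have h2 : finRotate (k + 2) ⟨i + 1, by omega⟩ = ⟨i + 1 + 1, by omega⟩ :=
      finRotate_of_lt (n := k + 1) (k := i + 1) (by omega)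
    simp only [ρ, Equiv.Perm.mul_apply, h1, h2]
    rfl
  have hρ2 : ρ (Fin.natAdd k 0) = 0 := by
    have h1 : finRotate (k + 2) (Fin.natAdd k 0) = ⟨k + 1, by omega⟩ :=
      finRotate_of_lt (n := k + 1) (k := k) (by omega)
    simp only [ρ, Equiv.Perm.mul_apply, h1]
    exact finRotate_last' (n := k + 1)
  have hρ3 : ρ (Fin.natAdd k 1) = 1 := by
    have h1 : finRotate (k + 2) (Fin.natAdd k 1) = ⟨0, by omega⟩ := finRotate_last' (n := k + 1)
    simp only [ρ, Equiv.Perm.mul_apply, h1]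
    exact finRotate_of_lt (n := k + 1) (k := 0) (by omega)
  have hβ : ∀ w : Fin 2 → V, w = ![w 0, w 1] := fun w => by
    funext i; fin_cases i <;> rfl
  have key : ∑ σ : Equiv.Perm (Fin (k + 2)), ((Equiv.Perm.sign σ : ℤ) : ℂ) *
        (α (fun i => v (σ (Fin.castAdd 2 i))) * β (fun j => v (σ (Fin.natAdd k j)))) =
      ∑ σ : Equiv.Perm (Fin (k + 2)), ((Equiv.Perm.sign σ : ℤ) : ℂ) *
        (fun s : Fin (k + 2) → Fin (k + 2) =>
          α (fun i => v (s i.succ.succ)) * β ![v (s 0), v (s 1)]) σ := by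
    refine (Fintype.sum_equiv (Equiv.mulRight ρ) _ _ fun σ => ?_).symm
    simp only [Equiv.coe_mulRight, map_mul, hρ, mul_one, Equiv.Perm.mul_apply, hρ1]
    rw [hβ fun j => v (σ (ρ (Fin.natAdd k j)))]
    simp only [hρ2, hρ3]
  rw [wedge_apply, key]
  have hk := sum_perm_fin_succ (n := k + 1) (fun s : Fin (k + 2) → Fin (k + 2) =>
          α (fun i => v (s i.succ.succ)) * β ![v (s 0), v (s 1)])
  refine (congrArg (fun z => ((k.factorial : ℂ) * (Nat.factorial 2 : ℕ))⁻¹ * z) hk).trans ?_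
  have h2 : ∀ p : Fin (k + 2), ∑ e : Equiv.Perm (Fin (k + 1)), ((Equiv.Perm.sign e : ℤ) : ℂ) *
      (fun s : Fin (k + 2) → Fin (k + 2) =>
          α (fun i => v (s i.succ.succ)) * β ![v (s 0), v (s 1)])
        (Fin.cons p fun i => p.succAbove (e i)) = k.factorial * ∑ q : Fin (k + 1), (-1) ^ (q : ℕ) *
        (α (fun i => v (p.succAbove (q.succAbove i))) * β ![v p, v (p.succAbove q)]) := by
    intro p
    have := sum_perm_fin_succ (n := k) (fun s => α (fun i => v (p.succAbove (s i.succ))) *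
      β ![v p, v (p.succAbove (s 0))])
    have h01 : (1 : Fin (k + 2)) = Fin.succ 0 := rfl
    simp only [h01, Fin.cons_zero, Fin.cons_succ] at this ⊢
    rw [this, Finset.mul_sum]
    refine Finset.sum_congr rfl fun q _ => ?_
    have h3 := sum_perm_alternating α (fun i => v (p.succAbove (q.succAbove i)))
    simp only [← mul_assoc, ← Finset.sum_mul]
    rw [h3]
    ring
  simp only [h2, Finset.mul_sum]
  refine Finset.sum_congr rfl fun p _ => Finset.sum_congr rfl fun q _ => ?_
  have : (k.factorial : ℂ) ≠ 0 := by simp [Nat.factorial_ne_zero]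
  rw [pow_add]
  field_simp
  simp
  ring

theorem wedge_compContinuousLinearMap {k l : ℕ} {W : Type*} [AddCommGroup W] [Module ℝ W]
    [TopologicalSpace W] (f : W →L[ℝ] V) (α : V [⋀^Fin k]→L[ℝ] ℂ) (β : V [⋀^Fin l]→L[ℝ] ℂ) :
    (wedge α β).compContinuousLinearMap f =
      wedge (α.compContinuousLinearMap f) (β.compContinuousLinearMap f) := by
  ext v
  rw [ContinuousAlternatingMap.compContinuousLinearMap_apply, wedge_apply, wedge_apply]
  rfl

theorem wedgePow_compContinuousLinearMap {W : Type*} [AddCommGroup W] [Module ℝ W]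
    [TopologicalSpace W] (f : W →L[ℝ] V) (α : V [⋀^Fin 2]→L[ℝ] ℂ) (k : ℕ) :
    (wedgePow α k).compContinuousLinearMap f = wedgePow (α.compContinuousLinearMap f) k := by
  induction k with
  | zero => rfl
  | succ k ih =>
    change (wedge (wedgePow α k) α).compContinuousLinearMap f = wedge (wedgePow _ k) _
    rw [wedge_compContinuousLinearMap, ih]

/-- The antisymmetrisation over all permutations of the arguments of a product of values of three
forms. The maps `a`, `b`, `c` say which arguments go into which form. -/
def tripleSum {k l m n : ℕ} (α : V [⋀^Fin k]→L[ℝ] ℂ) (β : V [⋀^Fin l]→L[ℝ] ℂ)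
    (γ : V [⋀^Fin m]→L[ℝ] ℂ) (a : Fin k → Fin n) (b : Fin l → Fin n) (c : Fin m → Fin n)
    (v : Fin n → V) : ℂ :=
  ∑ σ : Equiv.Perm (Fin n), ((Equiv.Perm.sign σ : ℤ) : ℂ) *
    (α (fun i => v (σ (a i))) * β (fun i => v (σ (b i))) * γ (fun i => v (σ (c i))))

theorem wedge_wedge_right {k l m : ℕ} (α : V [⋀^Fin k]→L[ℝ] ℂ) (β : V [⋀^Fin l]→L[ℝ] ℂ)
    (γ : V [⋀^Fin m]→L[ℝ] ℂ) (v : Fin (k + (l + m)) → V) :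
    wedge α (wedge β γ) v = ((k.factorial : ℂ) * l.factorial * m.factorial)⁻¹ *
      tripleSum α β γ (Fin.castAdd (l + m)) (fun i => Fin.natAdd k (Fin.castAdd m i))
        (fun i => Fin.natAdd k (Fin.natAdd l i)) v := by
  have key : ∀ τ : Equiv.Perm (Fin (l + m)),
      ∑ σ : Equiv.Perm (Fin (k + (l + m))), ((Equiv.Perm.sign σ : ℤ) : ℂ) *
        (α (fun i => v (σ (Fin.castAdd (l + m) i))) * (((Equiv.Perm.sign τ : ℤ) : ℂ) *
          (β (fun i => v (σ (Fin.natAdd k (τ (Fin.castAdd m i))))) *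
            γ (fun i => v (σ (Fin.natAdd k (τ (Fin.natAdd l i)))))))) =
      tripleSum α β γ (Fin.castAdd (l + m)) (fun i => Fin.natAdd k (Fin.castAdd m i))
        (fun i => Fin.natAdd k (Fin.natAdd l i)) v := by
    intro τ
    let ρ : Equiv.Perm (Fin (k + (l + m))) := finSumFinEquiv.permCongr (Equiv.Perm.sumCongr 1 τ)
    have hρ : Equiv.Perm.sign ρ = Equiv.Perm.sign τ := by simp [ρ]
    have h1 : ∀ i, ρ (Fin.castAdd (l + m) i) = Fin.castAdd (l + m) i := fun i => by
      simp [ρ, Equiv.permCongr_apply]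
    have h2 : ∀ i, ρ (Fin.natAdd k i) = Fin.natAdd k (τ i) := fun i => by
      simp [ρ, Equiv.permCongr_apply]
    refine Fintype.sum_equiv (Equiv.mulRight ρ) _ _ fun σ => ?_
    simp only [Equiv.coe_mulRight, map_mul, hρ, Equiv.Perm.mul_apply, h1, h2, Units.val_mul,
      Int.cast_mul]
    ring
  rw [wedge_apply]
  simp only [wedge_apply β γ, Finset.mul_sum]
  rw [Finset.sum_comm]
  trans ∑ _τ : Equiv.Perm (Fin (l + m)), ((k.factorial : ℂ) * (l + m).factorial)⁻¹ *
      (((l.factorial : ℂ) * m.factorial)⁻¹ * tripleSum α β γ (Fin.castAdd (l + m))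
        (fun i => Fin.natAdd k (Fin.castAdd m i)) (fun i => Fin.natAdd k (Fin.natAdd l i)) v)
  · refine Finset.sum_congr rfl fun τ _ => ?_
    rw [← key τ]
    simp only [Finset.mul_sum]
    exact Finset.sum_congr rfl fun σ _ => by ring
  simp only [Finset.sum_const, Finset.card_univ, Fintype.card_perm, Fintype.card_fin, nsmul_eq_mul]
  have e1 : ((l + m).factorial : ℂ) ≠ 0 := by simp [Nat.factorial_ne_zero]
  simp only [mul_inv]
  field_simp

theorem wedge_wedge_left {k l m : ℕ} (α : V [⋀^Fin k]→L[ℝ] ℂ) (β : V [⋀^Fin l]→L[ℝ] ℂ)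
    (γ : V [⋀^Fin m]→L[ℝ] ℂ) (v : Fin (k + l + m) → V) :
    wedge (wedge α β) γ v = ((k.factorial : ℂ) * l.factorial * m.factorial)⁻¹ *
      tripleSum α β γ (fun i => Fin.castAdd m (Fin.castAdd l i))
        (fun i => Fin.castAdd m (Fin.natAdd k i)) (Fin.natAdd (k + l)) v := by
  have key : ∀ τ : Equiv.Perm (Fin (k + l)),
      ∑ σ : Equiv.Perm (Fin (k + l + m)), ((Equiv.Perm.sign σ : ℤ) : ℂ) *
        ((((Equiv.Perm.sign τ : ℤ) : ℂ) *
          (α (fun i => v (σ (Fin.castAdd m (τ (Fin.castAdd l i))))) *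
            β (fun i => v (σ (Fin.castAdd m (τ (Fin.natAdd k i))))))) *
          γ (fun i => v (σ (Fin.natAdd (k + l) i)))) =
      tripleSum α β γ (fun i => Fin.castAdd m (Fin.castAdd l i))
        (fun i => Fin.castAdd m (Fin.natAdd k i)) (Fin.natAdd (k + l)) v := by
    intro τ
    let ρ : Equiv.Perm (Fin (k + l + m)) := finSumFinEquiv.permCongr (Equiv.Perm.sumCongr τ 1)
    have hρ : Equiv.Perm.sign ρ = Equiv.Perm.sign τ := by simp [ρ]
    have h1 : ∀ i, ρ (Fin.castAdd m i) = Fin.castAdd m (τ i) := fun i => by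
      simp [ρ, Equiv.permCongr_apply]
    have h2 : ∀ i, ρ (Fin.natAdd (k + l) i) = Fin.natAdd (k + l) i := fun i => by
      simp [ρ, Equiv.permCongr_apply]
    refine Fintype.sum_equiv (Equiv.mulRight ρ) _ _ fun σ => ?_
    simp only [Equiv.coe_mulRight, map_mul, hρ, Equiv.Perm.mul_apply, h1, h2, Units.val_mul,
      Int.cast_mul]
    ring
  rw [wedge_apply]
  simp only [wedge_apply α β, Finset.mul_sum, Finset.sum_mul]
  rw [Finset.sum_comm]
  trans ∑ _τ : Equiv.Perm (Fin (k + l)), (((k + l).factorial : ℂ) * m.factorial)⁻¹ *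
      (((k.factorial : ℂ) * l.factorial)⁻¹ * tripleSum α β γ
        (fun i => Fin.castAdd m (Fin.castAdd l i)) (fun i => Fin.castAdd m (Fin.natAdd k i))
        (Fin.natAdd (k + l)) v)
  · refine Finset.sum_congr rfl fun τ _ => ?_
    rw [← key τ]
    simp only [Finset.mul_sum]
    exact Finset.sum_congr rfl fun σ _ => by ring
  simp only [Finset.sum_const, Finset.card_univ, Fintype.card_perm, Fintype.card_fin, nsmul_eq_mul]
  have e1 : ((k + l).factorial : ℂ) ≠ 0 := by simp [Nat.factorial_ne_zero]
  simp only [mul_inv]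
  field_simp

/-- The wedge product is associative, up to the identification of the index types. -/
theorem wedge_assoc_apply {k l m : ℕ} (α : V [⋀^Fin k]→L[ℝ] ℂ) (β : V [⋀^Fin l]→L[ℝ] ℂ)
    (γ : V [⋀^Fin m]→L[ℝ] ℂ) (v : Fin (k + l + m) → V) :
    wedge (wedge α β) γ v =
      wedge α (wedge β γ) fun i => v (Fin.cast (Nat.add_assoc k l m).symm i) := by
  rw [wedge_wedge_left, wedge_wedge_right]
  congr 1
  refine Fintype.sum_equiv (finCongr (Nat.add_assoc k l m)).permCongr _ _ fun σ => ?_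
  have h1 : ∀ i, Fin.cast (Nat.add_assoc k l m).symm (Fin.castAdd (l + m) i) =
      Fin.castAdd m (Fin.castAdd l i) := fun i => rfl
  have h2 : ∀ i, Fin.cast (Nat.add_assoc k l m).symm (Fin.natAdd k (Fin.castAdd m i)) =
      Fin.castAdd m (Fin.natAdd k i) := fun i => rfl
  have h3 : ∀ i, Fin.cast (Nat.add_assoc k l m).symm (Fin.natAdd k (Fin.natAdd l i)) =
      Fin.natAdd (k + l) i := fun i => Fin.ext (by simp [Nat.add_assoc])
  simp only [Equiv.permCongr_apply, finCongr_symm, finCongr_apply, Fin.cast_cast, Fin.cast_eq_self,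
    h1, h2, h3]
  rw [Equiv.Perm.sign_permCongr]

end WedgeAlgebra

/-! ### Components of type `(p, q)` -/

section TypeDecomposition

variable {V : Type*} [AddCommGroup V] [Module ℝ V]

/-- The value at `v₁, …, v_k` of the complex-multilinear extension of `f`, after the
`(1,0)`-parts of the vectors have been multiplied by `s`: since
`s · ½(v - iJv) + ½(v + iJv) = ½(1 + s) v + ½ i (1 - s) J v`, it is the sum over all choices of
`v_j` or `J v_j` in each slot, with these coefficients. -/
def scaledEval (J : V →ₗ[ℝ] V) (s : ℂ) {k : ℕ} (f : (Fin k → V) → ℂ) (v : Fin k → V) : ℂ :=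
  ∑ ε : Fin k → Bool, (∏ j, if ε j then Complex.I * (1 - s) / 2 else (1 + s) / 2) *
    f fun j => if ε j then J (v j) else v j

theorem scaledEval_cons (J : V →ₗ[ℝ] V) (s : ℂ) {k : ℕ} (A : V [⋀^Fin (k + 1)]→ₗ[ℝ] ℂ) (z : V)
    (v : Fin k → V) :
    scaledEval J s A (Matrix.vecCons z v) =
      (1 + s) / 2 * scaledEval J s (A.curryLeft z) v +
        Complex.I * (1 - s) / 2 * scaledEval J s (A.curryLeft (J z)) v := by
  unfold scaledEval
  rw [← (Fin.consEquiv fun _ => Bool).sum_comp, Fintype.sum_prod_type, Fintype.sum_bool, add_comm,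
    Finset.mul_sum, Finset.mul_sum]
  congr 1 <;> refine Finset.sum_congr rfl fun ε _ => ?_
  · rw [Fin.prod_univ_succ]
    simp only [Fin.consEquiv_apply, Fin.cons_zero, Fin.cons_succ,
      AlternatingMap.curryLeft_apply_apply, mul_assoc]
    congr 3
    funext j
    refine Fin.cases ?_ (fun j => ?_) j <;> simp
  · rw [Fin.prod_univ_succ]
    simp only [Fin.consEquiv_apply, Fin.cons_zero, Fin.cons_succ,
      AlternatingMap.curryLeft_apply_apply, mul_assoc]
    congr 3
    funext j
    refine Fin.cases ?_ (fun j => ?_) j <;> simp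

theorem scaledEval_zero (J : V →ₗ[ℝ] V) (s : ℂ) {k : ℕ} (v : Fin k → V) :
    scaledEval J s (0 : V [⋀^Fin k]→ₗ[ℝ] ℂ) v = 0 := by
  simp [scaledEval]

theorem scaledEval_empty (J : V →ₗ[ℝ] V) (s : ℂ) (A : V [⋀^Fin 0]→ₗ[ℝ] ℂ) (v : Fin 0 → V) :
    scaledEval J s A v = A v := by
  simp only [scaledEval, Finset.univ_unique, Finset.univ_eq_empty, Finset.prod_empty, one_mul,
    Finset.sum_singleton]
  congr 1
  exact Subsingleton.elim _ _

/-- The bivector `v ∧ Jv` is of type `(1,1)`, so it is multiplied by `s`. -/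
theorem scaledEval_pair (J : V →ₗ[ℝ] V) (hJ : ∀ v, J (J v) = -v) (s : ℂ) {k : ℕ}
    (A : V [⋀^Fin (k + 2)]→ₗ[ℝ] ℂ) (z : V) (v : Fin k → V) :
    scaledEval J s A (Matrix.vecCons z (Matrix.vecCons (J z) v)) =
      s * scaledEval J s ((A.curryLeft z).curryLeft (J z)) v := by
  have h1 : (A.curryLeft (J z)).curryLeft z = -(A.curryLeft z).curryLeft (J z) := by
    have h := A.curryLeft_same (z + J z)
    simp only [map_add, AlternatingMap.curryLeft_add, LinearMap.add_apply, A.curryLeft_same,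
      zero_add, add_zero] at h
    exact eq_neg_of_add_eq_zero_left h
  rw [scaledEval_cons, scaledEval_cons, scaledEval_cons, hJ, map_neg, map_neg, A.curryLeft_same,
    A.curryLeft_same, h1, neg_neg, neg_zero, scaledEval_zero]
  linear_combination ((1 - s) ^ 2 / 4 * scaledEval J s ((A.curryLeft z).curryLeft (J z)) v) *
    Complex.I_sq

variable [TopologicalSpace V]

theorem typeProj_apply (J : V →L[ℝ] V) {k : ℕ} (p : ℕ) (α : V [⋀^Fin k]→L[ℝ] ℂ) (v : Fin k → V) :
    typeProj J p α v = ∑ S ∈ Finset.powersetCard p Finset.univ, ∑ T : Finset (Fin k),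
      typeCoeff S T * α (fun j => if j ∈ T then J (v j) else v j) := by
  change (∑ S ∈ Finset.powersetCard p Finset.univ, ∑ T : Finset (Fin k), typeCoeff S T •
      α.toContinuousMultilinearMap.compContinuousLinearMap
        (fun j => if j ∈ T then J else ContinuousLinearMap.id ℝ V) :
          ContinuousMultilinearMap ℝ (fun _ : Fin k => V) ℂ) v = _
  simp only [sum_apply, smul_apply, ContinuousMultilinearMap.compContinuousLinearMap_apply,
    smul_eq_mul]
  refine Finset.sum_congr rfl fun S _ => Finset.sum_congr rfl fun T _ => ?_
  congr 1
  change α _ = α _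
  congr 1
  funext j
  split_ifs <;> rfl

theorem typeProj_compContinuousLinearMap {W : Type*} [AddCommGroup W] [Module ℝ W]
    [TopologicalSpace W] (J : V →L[ℝ] V) (J' : W →L[ℝ] W) (f : W →L[ℝ] V)
    (hf : ∀ w, J (f w) = f (J' w)) {k : ℕ} (p : ℕ) (α : V [⋀^Fin k]→L[ℝ] ℂ) :
    (typeProj J p α).compContinuousLinearMap f = typeProj J' p (α.compContinuousLinearMap f) := by
  ext v
  rw [ContinuousAlternatingMap.compContinuousLinearMap_apply, typeProj_apply, typeProj_apply]
  refine Finset.sum_congr rfl fun S _ => Finset.sum_congr rfl fun T _ => ?_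
  rw [ContinuousAlternatingMap.compContinuousLinearMap_apply]
  congr 2
  funext j
  simp only [Function.comp_apply, apply_ite f, hf]

/-- The generating function of the components of the various types. -/
theorem sum_pow_mul_typeProj (J : V →L[ℝ] V) {k : ℕ} (α : V [⋀^Fin k]→L[ℝ] ℂ) (v : Fin k → V)
    (s : ℂ) :
    ∑ p ∈ Finset.range (k + 1), s ^ p * typeProj J p α v =
      scaledEval (J : V →ₗ[ℝ] V) s α.toAlternatingMap v := by
  have h1 : ∑ p ∈ Finset.range (k + 1), s ^ p * typeProj J p α v =
      ∑ S : Finset (Fin k), ∑ T : Finset (Fin k),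
        s ^ S.card * typeCoeff S T * α (fun j => if j ∈ T then J (v j) else v j) := by
    rw [← Finset.powerset_univ, Finset.sum_powerset, Finset.card_univ, Fintype.card_fin]
    refine Finset.sum_congr rfl fun p _ => ?_
    rw [typeProj_apply, Finset.mul_sum]
    refine Finset.sum_congr rfl fun S hS => ?_
    rw [Finset.mul_sum, (Finset.mem_powersetCard.mp hS).2, Finset.powerset_univ]
    exact Finset.sum_congr rfl fun T _ => by ring
  rw [h1, Finset.sum_comm]
  have h2 : ∀ T : Finset (Fin k), ∑ S : Finset (Fin k), s ^ S.card * typeCoeff S T =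
      ∏ j, if j ∈ T then Complex.I * (1 - s) / 2 else (1 + s) / 2 := by
    intro T
    have h3 : ∀ j : Fin k, (if j ∈ T then Complex.I * (1 - s) / 2 else (1 + s) / 2 : ℂ) =
        (s / 2 * if j ∈ T then -Complex.I else 1) + (1 / 2 * if j ∈ T then Complex.I else 1) := by
      intro j
      split_ifs <;> ring
    rw [Finset.prod_congr rfl fun j _ => h3 j, Finset.prod_add, Finset.powerset_univ]
    refine Finset.sum_congr rfl fun S _ => ?_
    rw [Finset.prod_mul_distrib, Finset.prod_mul_distrib, Finset.prod_const, Finset.prod_const,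
      typeCoeff]
    have h4 : (∏ j ∈ T, if j ∈ S then -Complex.I else Complex.I) =
        (∏ j ∈ S, if j ∈ T then -Complex.I else 1) *
          ∏ j ∈ Finset.univ \ S, if j ∈ T then Complex.I else 1 := by
      have h : (∏ j ∈ T, if j ∈ S then -Complex.I else Complex.I) =
          ∏ j, if j ∈ T then (if j ∈ S then -Complex.I else Complex.I) else 1 := by
        rw [Finset.prod_ite_mem, Finset.univ_inter]
      rw [h, ← Finset.prod_sdiff (Finset.subset_univ S), mul_comm]
      congr 1
      · exact Finset.prod_congr rfl fun j hj => by simp [hj]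
      · exact Finset.prod_congr rfl fun j hj => by simp [(Finset.mem_sdiff.mp hj).2]
    have h5 : S.card + (Finset.univ \ S).card = k := by
      have := Finset.card_sdiff_add_card_eq_card (Finset.subset_univ S)
      simp only [Finset.card_univ, Fintype.card_fin] at this
      omega
    rw [h4]
    have h6 : (1 / 2 : ℂ) ^ k = (1 / 2) ^ S.card * (1 / 2) ^ (Finset.univ \ S).card := by
      rw [← pow_add, h5]
    rw [h6, div_eq_mul_one_div s 2, mul_pow]
    ring
  simp only [← Finset.sum_mul, h2]
  refine Finset.sum_nbij' (fun T j => decide (j ∈ T)) (fun ε => Finset.univ.filter fun j => ε j)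
    (by simp) (by simp) (fun T _ => by ext; simp) (fun ε _ => by ext; simp) fun T _ => ?_
  simp only [decide_eq_true_eq]
  rfl

theorem coeff_of_forall_sum_pow_mul_eq {n : ℕ} {a : ℕ → ℂ} (Q : Polynomial ℂ)
    (h : ∀ s : ℂ, ∑ p ∈ Finset.range n, s ^ p * a p = Q.eval s) {m : ℕ} (hm : m < n) :
    a m = Q.coeff m := by
  have hQ : Q = ∑ p ∈ Finset.range n, Polynomial.C (a p) * Polynomial.X ^ p := by
    refine Polynomial.funext fun s => ?_
    rw [← h s, Polynomial.eval_finsetSum]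
    exact Finset.sum_congr rfl fun p _ => by simp; ring
  rw [hQ, Polynomial.finsetSum_coeff]
  simp [Polynomial.coeff_C_mul, Polynomial.coeff_X_pow, hm]

variable (J : V →L[ℝ] V)

theorem typeProj_two_apply_pairs (hJ : ∀ v, J (J v) = -v) (γ : V [⋀^Fin 4]→L[ℝ] ℂ) (v w : V) :
    typeProj J 2 γ ![v, J v, w, J w] = γ ![v, J v, w, J w] := by
  have h := coeff_of_forall_sum_pow_mul_eq (n := 5) (m := 2)
    (Polynomial.C (γ ![v, J v, w, J w]) * Polynomial.X ^ 2)
    (fun s => (sum_pow_mul_typeProj J γ ![v, J v, w, J w] s).trans ?_) (by norm_num)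
  · rw [h]; simp
  · have := scaledEval_pair (J : V →ₗ[ℝ] V) hJ s γ.toAlternatingMap v ![w, J w]
    refine this.trans ?_
    have := scaledEval_pair (J : V →ₗ[ℝ] V) hJ s
      ((γ.toAlternatingMap.curryLeft v).curryLeft (J v)) w ![]
    refine (congrArg (s * ·) this).trans ?_
    simp only [scaledEval_empty, AlternatingMap.curryLeft_apply_apply]
    simp
    ring

theorem typeProj_three_apply_pairs (hJ : ∀ v, J (J v) = -v) (γ : V [⋀^Fin 6]→L[ℝ] ℂ) (v w u : V) :
    typeProj J 3 γ ![v, J v, w, J w, u, J u] = γ ![v, J v, w, J w, u, J u] := by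
  have h := coeff_of_forall_sum_pow_mul_eq (n := 7) (m := 3)
    (Polynomial.C (γ ![v, J v, w, J w, u, J u]) * Polynomial.X ^ 3)
    (fun s => (sum_pow_mul_typeProj J γ ![v, J v, w, J w, u, J u] s).trans ?_) (by norm_num)
  · rw [h]; simp
  · have := scaledEval_pair (J : V →ₗ[ℝ] V) hJ s γ.toAlternatingMap v ![w, J w, u, J u]
    refine this.trans ?_
    have := scaledEval_pair (J : V →ₗ[ℝ] V) hJ s
      ((γ.toAlternatingMap.curryLeft v).curryLeft (J v)) w ![u, J u]
    refine (congrArg (s * ·) this).trans ?_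
    have := scaledEval_pair (J : V →ₗ[ℝ] V) hJ s
      ((((γ.toAlternatingMap.curryLeft v).curryLeft (J v)).curryLeft w).curryLeft (J w)) u ![]
    refine (congrArg (fun z => s * (s * z)) this).trans ?_
    simp only [scaledEval_empty, AlternatingMap.curryLeft_apply_apply]
    simp
    ring

/-- On `z ∧ w ∧ Jw` the component of type `(1,2)` sees the `(0,1)`-part of `z` only. -/
theorem typeProj_one_apply_cons_pair (hJ : ∀ v, J (J v) = -v) (γ : V [⋀^Fin 3]→L[ℝ] ℂ) (z w : V) :
    typeProj J 1 γ ![z, w, J w] =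
      (γ ![z, w, J w] + Complex.I * γ ![J z, w, J w]) / 2 := by
  have h := coeff_of_forall_sum_pow_mul_eq (n := 4) (m := 1)
    (Polynomial.C ((γ ![z, w, J w] + Complex.I * γ ![J z, w, J w]) / 2) * Polynomial.X +
      Polynomial.C ((γ ![z, w, J w] - Complex.I * γ ![J z, w, J w]) / 2) * Polynomial.X ^ 2)
    (fun s => (sum_pow_mul_typeProj J γ ![z, w, J w] s).trans ?_) (by norm_num)
  · rw [h]; simp
  · refine (scaledEval_cons (J : V →ₗ[ℝ] V) s γ.toAlternatingMap z ![w, J w]).trans ?_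
    have := fun z => scaledEval_pair (J : V →ₗ[ℝ] V) hJ s (γ.toAlternatingMap.curryLeft z) w ![]
    refine (congrArg₂ (fun a b => (1 + s) / 2 * a + Complex.I * (1 - s) / 2 * b)
      (this z) (this (J z))).trans ?_
    simp only [scaledEval_empty, AlternatingMap.curryLeft_apply_apply]
    simp
    ring

/-- On `z ∧ w ∧ Jw ∧ u ∧ Ju` the component of type `(2,3)` sees the `(0,1)`-part of `z` only. -/
theorem typeProj_two_apply_cons_pairs (hJ : ∀ v, J (J v) = -v) (γ : V [⋀^Fin 5]→L[ℝ] ℂ)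
    (z w u : V) :
    typeProj J 2 γ ![z, w, J w, u, J u] =
      (γ ![z, w, J w, u, J u] + Complex.I * γ ![J z, w, J w, u, J u]) / 2 := by
  have h := coeff_of_forall_sum_pow_mul_eq (n := 6) (m := 2)
    (Polynomial.C ((γ ![z, w, J w, u, J u] + Complex.I * γ ![J z, w, J w, u, J u]) / 2) *
        Polynomial.X ^ 2 +
      Polynomial.C ((γ ![z, w, J w, u, J u] - Complex.I * γ ![J z, w, J w, u, J u]) / 2) *
        Polynomial.X ^ 3)
    (fun s => (sum_pow_mul_typeProj J γ ![z, w, J w, u, J u] s).trans ?_) (by norm_num)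
  · rw [h]; simp [Polynomial.coeff_X_pow]
  · refine (scaledEval_cons (J : V →ₗ[ℝ] V) s γ.toAlternatingMap z ![w, J w, u, J u]).trans ?_
    have h1 := fun z => scaledEval_pair (J : V →ₗ[ℝ] V) hJ s (γ.toAlternatingMap.curryLeft z) w
      ![u, J u]
    refine (congrArg₂ (fun a b => (1 + s) / 2 * a + Complex.I * (1 - s) / 2 * b)
      (h1 z) (h1 (J z))).trans ?_
    have h2 := fun z => scaledEval_pair (J : V →ₗ[ℝ] V) hJ s
      (((γ.toAlternatingMap.curryLeft z).curryLeft w).curryLeft (J w)) u ![]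
    refine (congrArg₂ (fun a b => (1 + s) / 2 * (s * a) + Complex.I * (1 - s) / 2 * (s * b))
      (h2 z) (h2 (J z))).trans ?_
    simp only [scaledEval_empty, AlternatingMap.curryLeft_apply_apply]
    simp
    ring

end TypeDecomposition

/-! ### Wedge products with `2`-forms on pairs of arguments -/

section WedgePairs

variable {V : Type*} [AddCommGroup V] [Module ℝ V] [TopologicalSpace V]

theorem twoForm_swap (β : V [⋀^Fin 2]→L[ℝ] ℂ) (a b : V) : β ![b, a] = -β ![a, b] := by
  have h := β.toAlternatingMap.map_swap (v := ![a, b]) (i := 0) (j := 1) (by decide)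
  have h2 : (![a, b] ∘ Equiv.swap (0 : Fin 2) 1) = ![b, a] := by
    funext i; fin_cases i <;> simp
  rw [h2] at h
  exact h

/-- In `α ∧ β`, with a `2`-form `β` that pairs the arguments `v₀, v₁`, the arguments `v₂, v₃`, and
so on, but no others, only one partner remains for each argument `v_p` in the first slot
of `β`. -/
theorem wedge_two_apply_of_pairs {k : ℕ} (hk : k % 2 = 0) (α : V [⋀^Fin k]→L[ℝ] ℂ)
    (β : V [⋀^Fin 2]→L[ℝ] ℂ) (v : Fin (k + 2) → V)
    (hv : ∀ i j : Fin (k + 2), (i : ℕ) / 2 ≠ (j : ℕ) / 2 → β ![v i, v j] = 0) :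
    wedge α β v = (1 / 2) * ∑ p : Fin (k + 2), (-1) ^ (p : ℕ) *
      (α (fun i => v (p.succAbove ((⟨p / 2 * 2, by omega⟩ : Fin (k + 1)).succAbove i))) *
        β ![v p, v (p.succAbove (⟨p / 2 * 2, by omega⟩ : Fin (k + 1)))]) := by
  rw [wedge_two_apply]
  congr 1
  refine Finset.sum_congr rfl fun p _ => ?_
  rw [Finset.sum_eq_single (⟨p / 2 * 2, by omega⟩ : Fin (k + 1))]
  · congr 1
    rw [pow_add, pow_mul']
    simp
  · intro q _ hq
    rw [hv p (p.succAbove q), mul_zero, mul_zero]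
    have hq' : (q : ℕ) ≠ p / 2 * 2 := fun h => hq (Fin.ext h)
    rcases Fin.castSucc_lt_or_lt_succ p q with h | h
    · rw [Fin.succAbove_of_castSucc_lt _ _ h]
      simp only [Fin.lt_def, Fin.val_castSucc] at h ⊢
      omega
    · rw [Fin.succAbove_of_lt_succ _ _ h]
      simp only [Fin.lt_def, Fin.val_succ] at h ⊢
      omega
  · simp

theorem wedge_two_apply_two_pairs (α : V [⋀^Fin 2]→L[ℝ] ℂ) (β : V [⋀^Fin 2]→L[ℝ] ℂ)
    (a a' b b' : V) (hv : ∀ i j : Fin 4, (i : ℕ) / 2 ≠ (j : ℕ) / 2 →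
      β ![![a, a', b, b'] i, ![a, a', b, b'] j] = 0) :
    wedge α β ![a, a', b, b'] =
      β ![a, a'] * α ![b, b'] +
      β ![b, b'] * α ![a, a'] := by
  refine (wedge_two_apply_of_pairs (k := 2) (by decide) α β ![a, a', b, b'] hv).trans ?_
  have e : ∀ (p : Fin 4) (q : Fin 3) (w : Fin 2 → V),
      (∀ i, ![a, a', b, b'] (p.succAbove (q.succAbove i)) = w i) →
      (fun i => ![a, a', b, b'] (p.succAbove (q.succAbove i))) = w := fun p q w h => funext h
  refine (congrArg _ (Fin.sum_univ_four _)).trans ?_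
  rw [e _ _ ![b, b'] (by intro i; fin_cases i <;> rfl),
    e _ _ ![b, b'] (by intro i; fin_cases i <;> rfl),
    e _ _ ![a, a'] (by intro i; fin_cases i <;> rfl),
    e _ _ ![a, a'] (by intro i; fin_cases i <;> rfl)]
  change (1 / 2) * ((-1) ^ 0 * (α ![b, b'] * β ![a, a']) +
    (-1) ^ 1 * (α ![b, b'] * β ![a', a]) +
    (-1) ^ 2 * (α ![a, a'] * β ![b, b']) +
    (-1) ^ 3 * (α ![a, a'] * β ![b', b])) = _
  rw [twoForm_swap β a a', twoForm_swap β b b']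
  ring

theorem wedge_two_apply_three_pairs (α : V [⋀^Fin 4]→L[ℝ] ℂ) (β : V [⋀^Fin 2]→L[ℝ] ℂ)
    (a a' b b' c c' : V) (hv : ∀ i j : Fin 6, (i : ℕ) / 2 ≠ (j : ℕ) / 2 →
      β ![![a, a', b, b', c, c'] i, ![a, a', b, b', c, c'] j] = 0) :
    wedge α β ![a, a', b, b', c, c'] =
      β ![a, a'] * α ![b, b', c, c'] +
      β ![b, b'] * α ![a, a', c, c'] +
      β ![c, c'] * α ![a, a', b, b'] := by
  refine (wedge_two_apply_of_pairs (k := 4) (by decide) α β ![a, a', b, b', c, c'] hv).trans ?_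
  have e : ∀ (p : Fin 6) (q : Fin 5) (w : Fin 4 → V),
      (∀ i, ![a, a', b, b', c, c'] (p.succAbove (q.succAbove i)) = w i) →
      (fun i => ![a, a', b, b', c, c'] (p.succAbove (q.succAbove i))) = w := fun p q w h => funext h
  refine (congrArg _ (Fin.sum_univ_six _)).trans ?_
  rw [e _ _ ![b, b', c, c'] (by intro i; fin_cases i <;> rfl),
    e _ _ ![b, b', c, c'] (by intro i; fin_cases i <;> rfl),
    e _ _ ![a, a', c, c'] (by intro i; fin_cases i <;> rfl),
    e _ _ ![a, a', c, c'] (by intro i; fin_cases i <;> rfl),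
    e _ _ ![a, a', b, b'] (by intro i; fin_cases i <;> rfl),
    e _ _ ![a, a', b, b'] (by intro i; fin_cases i <;> rfl)]
  change (1 / 2) * ((-1) ^ 0 * (α ![b, b', c, c'] * β ![a, a']) +
    (-1) ^ 1 * (α ![b, b', c, c'] * β ![a', a]) +
    (-1) ^ 2 * (α ![a, a', c, c'] * β ![b, b']) +
    (-1) ^ 3 * (α ![a, a', c, c'] * β ![b', b]) +
    (-1) ^ 4 * (α ![a, a', b, b'] * β ![c, c']) +
    (-1) ^ 5 * (α ![a, a', b, b'] * β ![c', c])) = _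
  rw [twoForm_swap β a a', twoForm_swap β b b', twoForm_swap β c c']
  ring

theorem wedge_two_apply_four_pairs (α : V [⋀^Fin 6]→L[ℝ] ℂ) (β : V [⋀^Fin 2]→L[ℝ] ℂ)
    (a a' b b' c c' d d' : V) (hv : ∀ i j : Fin 8, (i : ℕ) / 2 ≠ (j : ℕ) / 2 →
      β ![![a, a', b, b', c, c', d, d'] i, ![a, a', b, b', c, c', d, d'] j] = 0) :
    wedge α β ![a, a', b, b', c, c', d, d'] =
      β ![a, a'] * α ![b, b', c, c', d, d'] +
      β ![b, b'] * α ![a, a', c, c', d, d'] +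
      β ![c, c'] * α ![a, a', b, b', d, d'] +
      β ![d, d'] * α ![a, a', b, b', c, c'] := by
  refine (wedge_two_apply_of_pairs (k := 6) (by decide) α β
    ![a, a', b, b', c, c', d, d'] hv).trans ?_
  have e : ∀ (p : Fin 8) (q : Fin 7) (w : Fin 6 → V),
      (∀ i, ![a, a', b, b', c, c', d, d'] (p.succAbove (q.succAbove i)) = w i) →
      (fun i => ![a, a', b, b', c, c', d, d'] (p.succAbove (q.succAbove i))) = w :=
    fun p q w h => funext h
  refine (congrArg _ (Fin.sum_univ_eight _)).trans ?_
  rw [e _ _ ![b, b', c, c', d, d'] (by intro i; fin_cases i <;> rfl),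
    e _ _ ![b, b', c, c', d, d'] (by intro i; fin_cases i <;> rfl),
    e _ _ ![a, a', c, c', d, d'] (by intro i; fin_cases i <;> rfl),
    e _ _ ![a, a', c, c', d, d'] (by intro i; fin_cases i <;> rfl),
    e _ _ ![a, a', b, b', d, d'] (by intro i; fin_cases i <;> rfl),
    e _ _ ![a, a', b, b', d, d'] (by intro i; fin_cases i <;> rfl),
    e _ _ ![a, a', b, b', c, c'] (by intro i; fin_cases i <;> rfl),
    e _ _ ![a, a', b, b', c, c'] (by intro i; fin_cases i <;> rfl)]
  change (1 / 2) * ((-1) ^ 0 * (α ![b, b', c, c', d, d'] * β ![a, a']) +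
    (-1) ^ 1 * (α ![b, b', c, c', d, d'] * β ![a', a]) +
    (-1) ^ 2 * (α ![a, a', c, c', d, d'] * β ![b, b']) +
    (-1) ^ 3 * (α ![a, a', c, c', d, d'] * β ![b', b]) +
    (-1) ^ 4 * (α ![a, a', b, b', d, d'] * β ![c, c']) +
    (-1) ^ 5 * (α ![a, a', b, b', d, d'] * β ![c', c]) +
    (-1) ^ 6 * (α ![a, a', b, b', c, c'] * β ![d, d']) +
    (-1) ^ 7 * (α ![a, a', b, b', c, c'] * β ![d', d])) = _
  rw [twoForm_swap β a a', twoForm_swap β b b', twoForm_swap β c c', twoForm_swap β d d']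
  ring

theorem wedgePow_one_apply (β : V [⋀^Fin 2]→L[ℝ] ℂ) (v : Fin 2 → V) : wedgePow β 1 v = β v := by
  obtain ⟨a, b, rfl⟩ : ∃ a b, v = ![a, b] := ⟨v 0, v 1, by funext i; fin_cases i <;> rfl⟩
  change wedge (ContinuousAlternatingMap.constOfIsEmpty ℝ V (Fin 0) (1 : ℂ)) β ![a, b] = _
  refine (wedge_two_apply_of_pairs (k := 0) (by decide) _ β ![a, b]
    fun i j h => absurd ?_ h).trans ?_
  · omega
  · refine (congrArg _ (Fin.sum_univ_two _)).trans ?_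
    change (1 / 2) * ((-1) ^ 0 * (1 * β ![a, b]) + (-1) ^ 1 * (1 * β ![b, a])) = _
    rw [twoForm_swap β a b]
    ring

theorem wedgePow_two_apply_pairs (β : V [⋀^Fin 2]→L[ℝ] ℂ) (a a' b b' : V)
    (hv : ∀ i j : Fin 4, (i : ℕ) / 2 ≠ (j : ℕ) / 2 →
      β ![![a, a', b, b'] i, ![a, a', b, b'] j] = 0) :
    wedgePow β 2 ![a, a', b, b'] = 2 * (β ![a, a'] * β ![b, b']) := by
  refine (wedge_two_apply_two_pairs (wedgePow β 1) β a a' b b' hv).trans ?_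
  rw [wedgePow_one_apply, wedgePow_one_apply]
  ring

set_option maxRecDepth 4000 in
theorem wedgePow_three_apply_pairs (β : V [⋀^Fin 2]→L[ℝ] ℂ) (a a' b b' c c' : V)
    (hv : ∀ i j : Fin 6, (i : ℕ) / 2 ≠ (j : ℕ) / 2 →
      β ![![a, a', b, b', c, c'] i, ![a, a', b, b', c, c'] j] = 0) :
    wedgePow β 3 ![a, a', b, b', c, c'] = 6 * (β ![a, a'] * β ![b, b'] * β ![c, c']) := by
  refine (wedge_two_apply_three_pairs (wedgePow β 2) β a a' b b' c c' hv).trans ?_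
  -- The hypothesis for two of the three pairs is that of all three, read along an injection.
  have sub : ∀ w : Fin 4 → Fin 6, (∀ i j : Fin 4, (i : ℕ) / 2 ≠ (j : ℕ) / 2 →
      (w i : ℕ) / 2 ≠ (w j : ℕ) / 2) → ∀ i j : Fin 4, (i : ℕ) / 2 ≠ (j : ℕ) / 2 →
      β ![![a, a', b, b', c, c'] (w i), ![a, a', b, b', c, c'] (w j)] = 0 :=
    fun w hw i j h => hv _ _ (hw i j h)
  have e : ∀ (w : Fin 4 → Fin 6) (u : Fin 4 → V),
      (∀ i, ![a, a', b, b', c, c'] (w i) = u i) → (∀ i j : Fin 4, (i : ℕ) / 2 ≠ (j : ℕ) / 2 →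
      (w i : ℕ) / 2 ≠ (w j : ℕ) / 2) → ∀ i j : Fin 4, (i : ℕ) / 2 ≠ (j : ℕ) / 2 →
      β ![u i, u j] = 0 := fun w u hu hw i j h => by
    rw [← hu, ← hu]
    exact sub w hw i j h
  rw [wedgePow_two_apply_pairs β b b' c c'
      (e ![2, 3, 4, 5] _ (by intro i; fin_cases i <;> rfl) (by decide)),
    wedgePow_two_apply_pairs β a a' c c'
      (e ![0, 1, 4, 5] _ (by intro i; fin_cases i <;> rfl) (by decide)),
    wedgePow_two_apply_pairs β a a' b b'
      (e ![0, 1, 2, 3] _ (by intro i; fin_cases i <;> rfl) (by decide))]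
  ring

theorem wedge_wedgePow_two_apply {k : ℕ} (α : V [⋀^Fin k]→L[ℝ] ℂ) (β : V [⋀^Fin 2]→L[ℝ] ℂ)
    (v : Fin (k + 4) → V) : wedge α (wedgePow β 2) v = wedge (wedge α β) β v := by
  have hb : wedgePow β 2 = wedge β β := by
    have : wedgePow β 1 = β := ContinuousAlternatingMap.ext (wedgePow_one_apply β)
    change wedge (wedgePow β 1) β = _
    rw [this]
  rw [hb]
  exact (wedge_assoc_apply α β β v).symm

set_option maxRecDepth 4000 in
/-- The wedge product of a `4`-form with `β ∧ β`, on four pairs. -/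
theorem wedge_wedgePow_two_apply_pairs (α : V [⋀^Fin 4]→L[ℝ] ℂ) (β : V [⋀^Fin 2]→L[ℝ] ℂ)
    (a a' b b' c c' d d' : V) (hv : ∀ i j : Fin 8, (i : ℕ) / 2 ≠ (j : ℕ) / 2 →
      β ![![a, a', b, b', c, c', d, d'] i, ![a, a', b, b', c, c', d, d'] j] = 0) :
    wedge α (wedgePow β 2) ![a, a', b, b', c, c', d, d'] = 2 * (
      β ![a, a'] * β ![b, b'] * α ![c, c', d, d'] + β ![a, a'] * β ![c, c'] * α ![b, b', d, d'] +
      β ![a, a'] * β ![d, d'] * α ![b, b', c, c'] + β ![b, b'] * β ![c, c'] * α ![a, a', d, d'] +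
      β ![b, b'] * β ![d, d'] * α ![a, a', c, c'] +
      β ![c, c'] * β ![d, d'] * α ![a, a', b, b']) := by
  have h1 : ∀ w : Fin 8 → V, wedge α (wedgePow β 2) w = wedge (wedge α β) β w :=
    fun w => wedge_wedgePow_two_apply α β w
  obtain ⟨δ, hδ⟩ : ∃ δ : V [⋀^Fin 6]→L[ℝ] ℂ, δ = wedge α β := ⟨_, rfl⟩
  have h3 : ∀ w : Fin 8 → V, wedge α (wedgePow β 2) w = wedge δ β w := by
    intro w
    rw [h1, hδ]
  have h2 := wedge_two_apply_four_pairs δ β a a' b b' c c' d d' hv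
  have e : ∀ (w : Fin 6 → Fin 8) (u : Fin 6 → V),
      (∀ i, ![a, a', b, b', c, c', d, d'] (w i) = u i) →
      (∀ i j : Fin 6, (i : ℕ) / 2 ≠ (j : ℕ) / 2 → (w i : ℕ) / 2 ≠ (w j : ℕ) / 2) →
      ∀ i j : Fin 6, (i : ℕ) / 2 ≠ (j : ℕ) / 2 → β ![u i, u j] = 0 := fun w u hu hw i j h => by
    rw [← hu, ← hu]
    exact hv _ _ (hw i j h)
  rw [h3, h2, hδ]
  rw [wedge_two_apply_three_pairs α β b b' c c' d d'
      (e ![2, 3, 4, 5, 6, 7] _ (by intro i; fin_cases i <;> rfl) (by decide)),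
    wedge_two_apply_three_pairs α β a a' c c' d d'
      (e ![0, 1, 4, 5, 6, 7] _ (by intro i; fin_cases i <;> rfl) (by decide)),
    wedge_two_apply_three_pairs α β a a' b b' d d'
      (e ![0, 1, 2, 3, 6, 7] _ (by intro i; fin_cases i <;> rfl) (by decide)),
    wedge_two_apply_three_pairs α β a a' b b' c c'
      (e ![0, 1, 2, 3, 4, 5] _ (by intro i; fin_cases i <;> rfl) (by decide))]
  ring

end WedgePairs

/-! ### The group law in coordinates -/

namespace Heisenberg

variable {n : ℕ}

@[simp] theorem x_add (a b : Heisenberg n) : (a + b).x = a.x + b.x := rfl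
@[simp] theorem y_add (a b : Heisenberg n) : (a + b).y = a.y + b.y := rfl
@[simp] theorem z_add (a b : Heisenberg n) : (a + b).z = a.z + b.z := rfl
@[simp] theorem x_neg (a : Heisenberg n) : (-a).x = -a.x := rfl
@[simp] theorem y_neg (a : Heisenberg n) : (-a).y = -a.y := rfl
@[simp] theorem z_neg (a : Heisenberg n) : (-a).z = -a.z := rfl
@[simp] theorem x_smul (r : ℝ) (a : Heisenberg n) : (r • a).x = r • a.x := rfl
@[simp] theorem y_smul (r : ℝ) (a : Heisenberg n) : (r • a).y = r • a.y := rfl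
@[simp] theorem z_smul (r : ℝ) (a : Heisenberg n) : (r • a).z = r * a.z := rfl
@[simp] theorem x_zero : (0 : Heisenberg n).x = 0 := rfl
@[simp] theorem y_zero : (0 : Heisenberg n).y = 0 := rfl
@[simp] theorem z_zero : (0 : Heisenberg n).z = 0 := rfl
@[simp] theorem x_mul (a b : Heisenberg n) : (a * b).x = a.x + b.x := rfl
@[simp] theorem y_mul (a b : Heisenberg n) : (a * b).y = a.y + b.y := rfl
@[simp] theorem z_mul (a b : Heisenberg n) : (a * b).z = a.z + b.z + a.x ⬝ᵥ b.y := rfl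
@[simp] theorem x_inv (a : Heisenberg n) : a⁻¹.x = -a.x := rfl
@[simp] theorem y_inv (a : Heisenberg n) : a⁻¹.y = -a.y := rfl
@[simp] theorem z_inv (a : Heisenberg n) : a⁻¹.z = -a.z + a.x ⬝ᵥ a.y := rfl

end Heisenberg

/-! ### Left translations -/

/-- The bilinear part of the group law of `H₃ × H₅`: the product `p * v` is `p + v + twist p v`. -/
def twist : H3xH5 →L[ℝ] H3xH5 →L[ℝ] H3xH5 :=
  LinearMap.toContinuousBilinearMap <| LinearMap.mk₂ ℝ
    (fun p v => (Heisenberg.mk 0 0 (p.1.x ⬝ᵥ v.1.y), Heisenberg.mk 0 0 (p.2.x ⬝ᵥ v.2.y)))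
    (fun p q v => by ext <;> simp [add_dotProduct])
    (fun r p v => by ext <;> simp)
    (fun p v w => by ext <;> simp [dotProduct_add])
    (fun r p v => by ext <;> simp)

theorem twist_apply (p v : H3xH5) : twist p v =
    (Heisenberg.mk 0 0 (p.1.x ⬝ᵥ v.1.y), Heisenberg.mk 0 0 (p.2.x ⬝ᵥ v.2.y)) := rfl

theorem twist_twist_left (p q v : H3xH5) : twist (twist p q) v = 0 := by
  ext <;> simp [twist_apply]

theorem twist_twist_right (p q v : H3xH5) : twist p (twist q v) = 0 := by
  ext <;> simp [twist_apply]

/-- The differential of the left translation by `p`. Left translations being affine maps, it does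
not depend on the base point. Its value at `v` is also the value at `p` of the left invariant
vector field that is `v` at the identity. -/
def frame (p : H3xH5) : H3xH5 →L[ℝ] H3xH5 := ContinuousLinearMap.id ℝ H3xH5 + twist p

theorem frame_apply (p v : H3xH5) : frame p v = v + twist p v := rfl

theorem mul_eq_add_frame (p v : H3xH5) : p * v = p + frame p v := by
  ext <;> simp [frame_apply, twist_apply, add_assoc]

theorem frame_mul (p q v : H3xH5) : frame (p * q) v = frame p (frame q v) := by
  rw [mul_eq_add_frame]
  simp only [frame_apply, map_add, add_apply, twist_twist_left, twist_twist_right]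
  abel

theorem frame_one (v : H3xH5) : frame 1 v = v := by
  ext <;> simp [frame_apply, twist_apply, Heisenberg.one_def]

theorem frame_inv_frame (p v : H3xH5) : frame p⁻¹ (frame p v) = v := by
  rw [← frame_mul, inv_mul_cancel, frame_one]

theorem frame_frame_inv (p v : H3xH5) : frame p (frame p⁻¹ v) = v := by
  rw [← frame_mul, mul_inv_cancel, frame_one]

theorem hasFDerivAt_mul_left (p x : H3xH5) : HasFDerivAt (fun y => p * y) (frame p) x := by
  have h : (fun y => p * y) = fun y => p + frame p y := funext (mul_eq_add_frame p)
  rw [h]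
  exact (frame p).hasFDerivAt.const_add p

theorem contDiff_frame : ContDiff ℝ ∞ frame := contDiff_const.add twist.contDiff

theorem contDiff_inv : ContDiff ℝ ∞ (fun p : H3xH5 => p⁻¹) :=
  (Heisenberg.contDiff_inv.comp contDiff_fst).prodMk (Heisenberg.contDiff_inv.comp contDiff_snd)

/-! ### The charts of the quotient -/

section Charts

variable {Γ : Subgroup H3xH5}

theorem surjective_nilProj : Function.Surjective (nilProj Γ) := Quotient.mk_surjective

theorem nilProj_mul {γ : H3xH5} (hγ : γ ∈ Γ) (p : H3xH5) : nilProj Γ (γ * p) = nilProj Γ p :=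
  Quotient.sound (s := MulAction.orbitRel Γ H3xH5) ⟨⟨γ, hγ⟩, rfl⟩

theorem mul_inv_mem_of_nilProj_eq {p q : H3xH5} (h : nilProj Γ p = nilProj Γ q) : p * q⁻¹ ∈ Γ := by
  obtain ⟨γ, hγ⟩ : ∃ γ : Γ, γ • q = p := Quotient.exact h
  have : (γ : H3xH5) * q = p := hγ
  rw [← this, mul_inv_cancel_right]
  exact γ.2

variable [DiscreteTopology Γ]

theorem coe_chartAt_symm (x : Nilmanifold Γ) :
    ((chartAt H3xH5 x).symm : H3xH5 → Nilmanifold Γ) = nilProj Γ := by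
  obtain ⟨a, ha⟩ := exists_eq_localInverseAt Γ (chart_mem_atlas H3xH5 x)
  rw [ha, (isLocalHomeomorph_nilProj Γ).localInverseAt_symm]

theorem nilProj_chartAt {x y : Nilmanifold Γ} (h : y ∈ (chartAt H3xH5 x).source) :
    nilProj Γ (chartAt H3xH5 x y) = y := by
  rw [← coe_chartAt_symm x, (chartAt H3xH5 x).left_inv h]

theorem continuous_nilProj : Continuous (nilProj Γ) := (isLocalHomeomorph_nilProj Γ).continuous

/-- In a chart, the projection is a left translation by an element of `Γ`. -/
theorem chartAt_nilProj_eventuallyEq {x : Nilmanifold Γ} {p : H3xH5}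
    (hp : nilProj Γ p ∈ (chartAt H3xH5 x).source) :
    (fun y => chartAt H3xH5 x (nilProj Γ y)) =ᶠ[𝓝 p]
      fun y => (chartAt H3xH5 x (nilProj Γ p) * p⁻¹) * y := by
  set e := chartAt H3xH5 x with he
  set γ := e (nilProj Γ p) * p⁻¹ with hγ
  have hγΓ : γ ∈ Γ := mul_inv_mem_of_nilProj_eq (nilProj_chartAt hp)
  have h1 : ∀ᶠ y in 𝓝 p, γ * y ∈ e.target := by
    refine (contDiff_H3xH5_mul_left γ).continuous.continuousAt.eventually_mem
      (e.open_target.mem_nhds ?_)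
    rw [hγ, inv_mul_cancel_right]
    exact e.map_source hp
  filter_upwards [h1] with y hy
  rw [← nilProj_mul hγΓ y, ← coe_chartAt_symm x]
  exact e.right_inv hy

variable (Γ) in
/-- The preferred lift of a point of the quotient: its coordinate in the preferred chart. -/
def nilLift (x : Nilmanifold Γ) : H3xH5 := chartAt H3xH5 x x

theorem nilProj_nilLift (x : Nilmanifold Γ) : nilProj Γ (nilLift Γ x) = x :=
  nilProj_chartAt (mem_chart_source H3xH5 x)

theorem hasMFDerivAt_nilProj (p : H3xH5) :
    HasMFDerivAt 𝓘(ℝ, H3xH5) 𝓘(ℝ, H3xH5) (nilProj Γ) p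
      (frame (nilLift Γ (nilProj Γ p) * p⁻¹) : H3xH5 →L[ℝ] H3xH5) := by
  refine ⟨continuous_nilProj.continuousAt, ?_⟩
  simp only [mfld_simps, writtenInExtChartAt]
  exact ((hasFDerivAt_mul_left _ p).congr_of_eventuallyEq
    (chartAt_nilProj_eventuallyEq (mem_chart_source H3xH5 (nilProj Γ p)))).hasFDerivWithinAt

theorem mfderiv_nilProj (p : H3xH5) :
    mfderiv 𝓘(ℝ, H3xH5) 𝓘(ℝ, H3xH5) (nilProj Γ) p =
      (frame (nilLift Γ (nilProj Γ p) * p⁻¹) : H3xH5 →L[ℝ] H3xH5) :=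
  (hasMFDerivAt_nilProj p).mfderiv

theorem contMDiff_nilProj : ContMDiff 𝓘(ℝ, H3xH5) 𝓘(ℝ, H3xH5) ∞ (nilProj Γ) := by
  intro p
  rw [contMDiffAt_iff]
  refine ⟨continuous_nilProj.continuousAt, ?_⟩
  simp only [mfld_simps]
  exact ((contDiff_H3xH5_mul_left _).contDiffAt.congr_of_eventuallyEq
    (chartAt_nilProj_eventuallyEq (mem_chart_source H3xH5 (nilProj Γ p)))).contDiffWithinAt

theorem hasMFDerivAt_chartAt {x y : Nilmanifold Γ} (hy : y ∈ (chartAt H3xH5 x).source) :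
    HasMFDerivAt 𝓘(ℝ, H3xH5) 𝓘(ℝ, H3xH5) (chartAt H3xH5 x) y
      (frame (chartAt H3xH5 x y * (nilLift Γ y)⁻¹) : H3xH5 →L[ℝ] H3xH5) := by
  refine ⟨(chartAt H3xH5 x).continuousAt hy, ?_⟩
  simp only [mfld_simps, writtenInExtChartAt]
  have h : nilProj Γ (nilLift Γ y) ∈ (chartAt H3xH5 x).source := by rwa [nilProj_nilLift]
  have h2 := chartAt_nilProj_eventuallyEq h
  rw [nilProj_nilLift] at h2
  rw [coe_chartAt_symm]
  exact ((hasFDerivAt_mul_left _ _).congr_of_eventuallyEq h2).hasFDerivWithinAt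

theorem mfderiv_nilProj_frame (p v : H3xH5) :
    (mfderiv 𝓘(ℝ, H3xH5) 𝓘(ℝ, H3xH5) (nilProj Γ) p (frame p v) : H3xH5) =
      frame (nilLift Γ (nilProj Γ p)) v := by
  rw [mfderiv_nilProj]
  change frame _ (frame p v) = _
  rw [frame_mul, frame_inv_frame]

theorem mfderiv_nilProj_mul (a p v : H3xH5) :
    (mfderiv 𝓘(ℝ, H3xH5) 𝓘(ℝ, H3xH5) (fun y => nilProj Γ (a * y)) p v : H3xH5) =
      frame (nilLift Γ (nilProj Γ (a * p))) (frame p⁻¹ v) := by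
  have h1 : HasMFDerivAt 𝓘(ℝ, H3xH5) 𝓘(ℝ, H3xH5) (fun y : H3xH5 => a * y) p (frame a) :=
    (hasFDerivAt_mul_left a p).hasMFDerivAt
  have h2 := (hasMFDerivAt_nilProj (Γ := Γ) (a * p)).comp p h1
  have h3 := h2.mfderiv
  change mfderiv 𝓘(ℝ, H3xH5) 𝓘(ℝ, H3xH5) (fun y => nilProj Γ (a * y)) p = _ at h3
  rw [h3]
  change frame _ (frame a v) = _
  rw [← frame_mul, ← frame_mul, mul_assoc, mul_inv_rev, inv_mul_cancel_right]

end Charts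

/-! ### Differential forms in the left invariant frame -/

section

/-- A map into the space of alternating forms is smooth as soon as its values at all fixed
arguments are. -/
theorem contDiff_alternating_of_forall_apply {F W : Type*} [NormedAddCommGroup F] [NormedSpace ℝ F]
    [FiniteDimensional ℝ F] [NormedAddCommGroup W] [NormedSpace ℝ W] {k : ℕ}
    {θ : W → F [⋀^Fin k]→L[ℝ] ℂ} {n : WithTop ℕ∞} (h : ∀ v, ContDiff ℝ n fun p => θ p v) :
    ContDiff ℝ n θ := by
  let b := Module.finBasis ℝ F
  let l : (F [⋀^Fin k]→L[ℝ] ℂ) →ₗ[ℝ] ((Fin k → Fin (Module.finrank ℝ F)) → ℂ) :=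
    { toFun := fun f I => f fun i => b (I i)
      map_add' := fun _ _ => rfl
      map_smul' := fun _ _ => rfl }
  have hl : LinearMap.ker l = ⊥ := by
    rw [LinearMap.ker_eq_bot]
    intro f g hfg
    apply ContinuousAlternatingMap.toAlternatingMap_injective
    exact Module.Basis.ext_alternating b fun I _ => congrFun hfg I
  obtain ⟨g, hg⟩ := l.exists_leftInverse_of_injective hl
  have h1 : θ = fun p => LinearMap.toContinuousLinearMap g (l (θ p)) := by
    funext p
    exact (LinearMap.congr_fun hg (θ p)).symm
  rw [h1]
  exact (ContinuousLinearMap.contDiff _).comp (contDiff_pi.mpr fun I => h _)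

/-- The bracket of the Lie algebra of `H₃ × H₅`, identified with the tangent space at the
identity. -/
def bracket (u v : H3xH5) : H3xH5 := twist u v - twist v u

/-- The Chevalley–Eilenberg differential of a form on the Lie algebra of `H₃ × H₅`, that is, the
exterior derivative of a left invariant form, evaluated at the left invariant vector fields with
values `v₀, v₁, …` at the identity. -/
def ceDiff {k : ℕ} (θ : H3xH5 [⋀^Fin (k + 1)]→L[ℝ] ℂ) (v : Fin (k + 2) → H3xH5) : ℂ :=
  -∑ i : Fin (k + 1), ∑ j ≥ i, (-1) ^ (i + j : ℕ) •
    θ (Matrix.vecCons (bracket (v i.castSucc) (v j.succ)) (j.removeNth (i.castSucc.removeNth v)))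

variable {Γ : Subgroup H3xH5} [DiscreteTopology Γ]

/-- A differential form on the quotient, lifted to the group and expressed in the left invariant
frame. -/
def frameForm {k : ℕ} (η : DiffForm H3xH5 (Nilmanifold Γ) k) (p : H3xH5) :
    H3xH5 [⋀^Fin k]→L[ℝ] ℂ :=
  ContinuousAlternatingMap.compContinuousLinearMap (M := H3xH5) (η (nilProj Γ p))
    (frame (nilLift Γ (nilProj Γ p)))

theorem frameForm_eq_of_nilProj_eq {k : ℕ} (η : DiffForm H3xH5 (Nilmanifold Γ) k) {p q : H3xH5}
    (h : nilProj Γ p = nilProj Γ q) : frameForm η p = frameForm η q := by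
  unfold frameForm
  rw [h]

theorem eq_zero_of_frameForm_eq_zero {k : ℕ} {η : DiffForm H3xH5 (Nilmanifold Γ) k}
    (h : ∀ p, frameForm η p = 0) : η = 0 := by
  funext x
  obtain ⟨p, rfl⟩ := surjective_nilProj x
  refine ContinuousAlternatingMap.ext fun v => ?_
  have h1 := congrArg (fun f : H3xH5 [⋀^Fin k]→L[ℝ] ℂ =>
    f fun i => frame (nilLift Γ (nilProj Γ p))⁻¹ (v i)) (h p)
  refine Eq.trans (congrArg (η (nilProj Γ p)) (funext fun i => ?_)) h1
  exact (frame_frame_inv _ _).symm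

theorem formInChart_eq {k : ℕ} (η : DiffForm H3xH5 (Nilmanifold Γ) k) (x : Nilmanifold Γ) :
    formInChart η x = fun y => (frameForm η y).compContinuousLinearMap (frame y⁻¹) := by
  funext y
  unfold formInChart
  rw [coe_chartAt_symm, mfderiv_nilProj]
  refine ContinuousAlternatingMap.ext fun v => ?_
  refine congrArg (η (nilProj Γ y)) (funext fun i => ?_)
  exact frame_mul _ _ _

theorem frameForm_extD_eq_extDeriv {k : ℕ} (η : DiffForm H3xH5 (Nilmanifold Γ) k) (p : H3xH5) :
    frameForm (extD η) p =
      (extDeriv (fun y => (frameForm η y).compContinuousLinearMap (frame y⁻¹))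
        (nilLift Γ (nilProj Γ p))).compContinuousLinearMap (frame (nilLift Γ (nilProj Γ p))) := by
  unfold frameForm extD
  rw [formInChart_eq, (hasMFDerivAt_chartAt (mem_chart_source H3xH5 (nilProj Γ p))).mfderiv]
  refine ContinuousAlternatingMap.ext fun v => ?_
  refine congrArg (extDeriv _ (nilLift Γ (nilProj Γ p))) (funext fun i => ?_)
  change frame (nilLift Γ (nilProj Γ p) * (nilLift Γ (nilProj Γ p))⁻¹) (frame _ (v i)) = _
  rw [mul_inv_cancel, frame_one]
  rfl

theorem hasFDerivAt_frame_apply (u p : H3xH5) :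
    HasFDerivAt (fun q => frame q u) (twist.flip u) p := by
  have h : (fun q => frame q u) = fun q => u + twist.flip u q := rfl
  rw [h]
  exact (twist.flip u).hasFDerivAt.const_add u

theorem lieBracket_frame (u v p : H3xH5) :
    VectorField.lieBracket ℝ (fun q => frame q u) (fun q => frame q v) p =
      frame p (bracket u v) := by
  rw [VectorField.lieBracket, (hasFDerivAt_frame_apply u p).fderiv,
    (hasFDerivAt_frame_apply v p).fderiv]
  simp only [ContinuousLinearMap.flip_apply, frame_apply, map_add, bracket, map_sub,
    twist_twist_left, twist_twist_right]

theorem differentiable_comp_frame_inv {k : ℕ} {θ : H3xH5 → H3xH5 [⋀^Fin k]→L[ℝ] ℂ}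
    (hθ : Differentiable ℝ θ) :
    Differentiable ℝ fun y => (θ y).compContinuousLinearMap (frame y⁻¹) := by
  intro y
  refine (hθ y).continuousAlternatingMapCompContinuousLinearMap ?_
  exact ((contDiff_frame.comp contDiff_inv).differentiable (by simp)) y

/-- The exterior derivative in the left invariant frame: the coefficients are differentiated along
left invariant vector fields, and the brackets of these vector fields contribute the
Chevalley–Eilenberg differential. -/
theorem frameForm_extD_apply {k : ℕ} (η : DiffForm H3xH5 (Nilmanifold Γ) (k + 1))
    (hη : Differentiable ℝ (frameForm η)) (p : H3xH5) (v : Fin (k + 2) → H3xH5) :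
    frameForm (extD η) p v =
      (∑ i, (-1) ^ i.val • fderiv ℝ (fun q => frameForm η q (i.removeNth v)) p (frame p (v i))) +
        ceDiff (frameForm η p) v := by
  set c := nilLift Γ (nilProj Γ p) with hc
  have hcp : nilProj Γ c = nilProj Γ p := nilProj_nilLift _
  set γ := c * p⁻¹ with hγ
  have hγc : γ * p = c := inv_mul_cancel_right _ _
  have hγΓ : γ ∈ Γ := mul_inv_mem_of_nilProj_eq hcp
  have hL := differentiable_comp_frame_inv hη
  have hV : ∀ i, DifferentiableAt ℝ (fun q => frame q (v i)) c := fun i =>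
    (hasFDerivAt_frame_apply (v i) c).differentiableAt
  have h1 := extDeriv_apply_vectorField (hL c) hV
  rw [frameForm_extD_eq_extDeriv, ContinuousAlternatingMap.compContinuousLinearMap_apply]
  refine h1.trans ?_
  rw [sub_eq_add_neg]
  congr 1
  · refine Finset.sum_congr rfl fun i _ => ?_
    have h2 : (fun y => (frameForm η y).compContinuousLinearMap (frame y⁻¹)
        (i.removeNth fun j => frame y (v j))) = fun y => frameForm η y (i.removeNth v) := by
      funext y
      rw [ContinuousAlternatingMap.compContinuousLinearMap_apply]
      congr 1
      funext j
      exact frame_inv_frame _ _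
    have h3 : (fun y => frameForm η y (i.removeNth v)) =
        (fun y => frameForm η y (i.removeNth v)) ∘ fun y => γ * y := by
      funext y
      simp only [Function.comp_apply]
      rw [frameForm_eq_of_nilProj_eq η (nilProj_mul hγΓ y)]
    have h4 : Differentiable ℝ fun y => frameForm η y (i.removeNth v) := fun y =>
      (hη y).continuousAlternatingMap_apply fun _ => differentiableAt_const _
    have h5 : fderiv ℝ (fun y => frameForm η y (i.removeNth v)) p =
        (fderiv ℝ (fun y => frameForm η y (i.removeNth v)) c).comp (frame γ) := by
      conv_lhs => rw [h3]
      rw [← hγc]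
      exact ((h4 (γ * p)).hasFDerivAt.comp p (hasFDerivAt_mul_left γ p)).fderiv
    rw [h2, h5, ContinuousLinearMap.comp_apply, ← frame_mul, hγc]
  · rw [ceDiff]
    congr 1
    refine Finset.sum_congr rfl fun i _ => Finset.sum_congr rfl fun j _ => ?_
    rw [lieBracket_frame, ContinuousAlternatingMap.compContinuousLinearMap_apply,
      frameForm_eq_of_nilProj_eq η hcp]
    congr 2
    funext l
    refine Fin.cases ?_ (fun l => ?_) l
    · exact frame_inv_frame _ _
    · exact frame_inv_frame _ _

theorem contDiff_frameForm_extD {k : ℕ} {η : DiffForm H3xH5 (Nilmanifold Γ) (k + 1)}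
    (hη : ContDiff ℝ ∞ (frameForm η)) : ContDiff ℝ ∞ (frameForm (extD η)) := by
  have h1 : ∀ v, ContDiff ℝ ∞ fun p => frameForm η p v := fun v =>
    (ContinuousAlternatingMap.apply ℝ H3xH5 ℂ v).contDiff.comp hη
  refine contDiff_alternating_of_forall_apply fun v => ?_
  simp only [frameForm_extD_apply η (hη.differentiable (by simp)), ceDiff]
  refine ContDiff.add (ContDiff.sum fun i _ => ContDiff.const_smul _ ?_)
    (ContDiff.neg (ContDiff.sum fun i _ => ContDiff.sum fun j _ => ContDiff.const_smul _ (h1 _)))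
  exact ((h1 _).fderiv_right (m := ∞) (by simp)).clm_apply
    (contDiff_frame.clm_apply contDiff_const)

theorem contDiff_wedge {F W : Type*} [NormedAddCommGroup F] [NormedSpace ℝ F]
    [FiniteDimensional ℝ F] [NormedAddCommGroup W] [NormedSpace ℝ W] {k l : ℕ} {n : WithTop ℕ∞}
    {α : W → F [⋀^Fin k]→L[ℝ] ℂ} {β : W → F [⋀^Fin l]→L[ℝ] ℂ} (hα : ContDiff ℝ n α)
    (hβ : ContDiff ℝ n β) : ContDiff ℝ n fun p => wedge (α p) (β p) := by
  refine contDiff_alternating_of_forall_apply fun v => ?_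
  simp only [wedge_apply]
  refine contDiff_const.mul (ContDiff.sum fun σ _ => contDiff_const.mul (ContDiff.mul ?_ ?_))
  · exact (ContinuousAlternatingMap.apply ℝ F ℂ _).contDiff.comp hα
  · exact (ContinuousAlternatingMap.apply ℝ F ℂ _).contDiff.comp hβ

theorem contDiff_wedgePow {F W : Type*} [NormedAddCommGroup F] [NormedSpace ℝ F]
    [FiniteDimensional ℝ F] [NormedAddCommGroup W] [NormedSpace ℝ W] {n : WithTop ℕ∞}
    {α : W → F [⋀^Fin 2]→L[ℝ] ℂ} (hα : ContDiff ℝ n α) (k : ℕ) :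
    ContDiff ℝ n fun p => wedgePow (α p) k := by
  induction k with
  | zero => exact contDiff_const
  | succ k ih => exact contDiff_wedge ih hα

theorem contDiff_typeProj {F W : Type*} [NormedAddCommGroup F] [NormedSpace ℝ F]
    [FiniteDimensional ℝ F] [NormedAddCommGroup W] [NormedSpace ℝ W] {k : ℕ} {n : WithTop ℕ∞}
    (J : F →L[ℝ] F) (p : ℕ) {α : W → F [⋀^Fin k]→L[ℝ] ℂ} (hα : ContDiff ℝ n α) :
    ContDiff ℝ n fun q => typeProj J p (α q) := by
  refine contDiff_alternating_of_forall_apply fun v => ?_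
  simp only [typeProj_apply]
  refine ContDiff.sum fun S _ => ContDiff.sum fun T _ => contDiff_const.mul ?_
  exact (ContinuousAlternatingMap.apply ℝ F ℂ _).contDiff.comp hα

end

/-! ### Averaging over the group -/

section IntegrationByParts

variable {F : Type*} [NormedAddCommGroup F] [NormedSpace ℝ F]

theorem continuous_fderiv_apply {h : F → ℂ} (hh : ContDiff ℝ ∞ h) {w : F → F} (hw : Continuous w) :
    Continuous fun q => fderiv ℝ h q (w q) :=
  (hh.continuous_fderiv (by simp)).clm_apply hw

theorem hasCompactSupport_fderiv_apply {h : F → ℂ} (hs : HasCompactSupport h) (w : F → F) :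
    HasCompactSupport fun q => fderiv ℝ h q (w q) := by
  refine (hs.fderiv (𝕜 := ℝ)).mono fun q hq => ?_
  rw [Function.mem_support] at hq ⊢
  intro h0
  exact hq (by rw [h0]; rfl)

variable [FiniteDimensional ℝ F] [MeasurableSpace F] [BorelSpace F]
  (μ : MeasureTheory.Measure F) [μ.IsAddHaarMeasure]

theorem integral_fderiv_apply_eq_zero {h : F → ℂ} (hh : ContDiff ℝ ∞ h) (hs : HasCompactSupport h)
    (u : F) : ∫ q, fderiv ℝ h q u ∂μ = 0 := by
  have hi := (continuous_fderiv_apply hh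
    (continuous_const (y := u))).integrable_of_hasCompactSupport
    (μ := μ) (hasCompactSupport_fderiv_apply hs fun _ => u)
  have h1 := integral_mul_fderiv_eq_neg_fderiv_mul_of_integrable (μ := μ)
    (f := fun _ : F => (1 : ℂ)) (g := h) (v := u) (by simp) (by simpa using hi)
    (by simpa using hh.continuous.integrable_of_hasCompactSupport hs)
    (fun _ _ => differentiableAt_const _) (fun q _ => hh.differentiable (by simp) q)
  simpa using h1

theorem integral_fderiv_apply_smul_eq_zero {h : F → ℂ} (hh : ContDiff ℝ ∞ h)
    (hs : HasCompactSupport h) (l : F →L[ℝ] ℝ) (u : F) (hl : l u = 0) :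
    ∫ q, fderiv ℝ h q (l q • u) ∂μ = 0 := by
  let f : F → ℂ := fun q => (l q : ℂ)
  have hf : ∀ q, HasFDerivAt f (Complex.ofRealCLM.comp l) q := fun q =>
    (Complex.ofRealCLM.comp l).hasFDerivAt
  have hf0 : ∀ q, fderiv ℝ f q u = 0 := fun q => by
    rw [(hf q).fderiv]
    simp [hl]
  have hfc : Continuous f := (Complex.ofRealCLM.comp l).continuous
  have h1 := integral_mul_fderiv_eq_neg_fderiv_mul_of_integrable (μ := μ) (f := f) (g := h) (v := u)
    (by simp [hf0])
    ((hfc.mul (continuous_fderiv_apply hh continuous_const)).integrable_of_hasCompactSupport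
      (hasCompactSupport_fderiv_apply hs fun _ => u).mul_left)
    ((hfc.mul hh.continuous).integrable_of_hasCompactSupport hs.mul_left)
    (fun q _ => (hf q).differentiableAt) (fun q _ => hh.differentiable (by simp) q)
  simp only [hf0, zero_mul, MeasureTheory.integral_zero, neg_zero] at h1
  simpa [f] using h1

theorem exists_contDiff_hasCompactSupport_integral_pos :
    ∃ b : F → ℝ, ContDiff ℝ ∞ (fun q => (b q : ℂ)) ∧ HasCompactSupport (fun q => (b q : ℂ)) ∧
      (∀ q, 0 ≤ b q) ∧ MeasureTheory.Integrable b μ ∧ 0 < ∫ q, b q ∂μ := by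
  let b : ContDiffBump (0 : F) := ⟨1, 2, by norm_num, by norm_num⟩
  exact ⟨b, Complex.ofRealCLM.contDiff.comp b.contDiff,
    b.hasCompactSupport.comp_left (g := Complex.ofReal) Complex.ofReal_zero,
    fun _ => b.nonneg, b.continuous.integrable_of_hasCompactSupport b.hasCompactSupport,
    b.integral_pos⟩

end IntegrationByParts

/-- The dilations `(x, y, z) ↦ (r x, r y, r² z)`, which are automorphisms of `H₃ × H₅`
for `r ≠ 0`. -/
def dilation (r : ℝ) : H3xH5 →L[ℝ] H3xH5 :=
  LinearMap.toContinuousLinearMap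
    { toFun := fun v => (Heisenberg.mk (r • v.1.x) (r • v.1.y) (r ^ 2 * v.1.z),
        Heisenberg.mk (r • v.2.x) (r • v.2.y) (r ^ 2 * v.2.z))
      map_add' := fun v w => by
        apply Prod.ext <;> apply Heisenberg.ext <;> simp [mul_add]
      map_smul' := fun s v => by
        apply Prod.ext <;> apply Heisenberg.ext <;> simp [smul_smul, mul_comm] <;> ring }

theorem dilation_apply (r : ℝ) (v : H3xH5) : dilation r v =
    (Heisenberg.mk (r • v.1.x) (r • v.1.y) (r ^ 2 * v.1.z),
      Heisenberg.mk (r • v.2.x) (r • v.2.y) (r ^ 2 * v.2.z)) := rfl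

theorem dilation_frame (r : ℝ) (p v : H3xH5) :
    dilation r (frame p v) = frame (dilation r p) (dilation r v) := by
  apply Prod.ext <;> apply Heisenberg.ext <;>
    simp [dilation_apply, frame_apply, twist_apply] <;> ring

theorem dilation_dilation_inv {r : ℝ} (hr : r ≠ 0) (v : H3xH5) :
    dilation r (dilation r⁻¹ v) = v := by
  apply Prod.ext <;> apply Heisenberg.ext <;> simp [dilation_apply, smul_smul, hr]

theorem tendsto_dilation_zero (v : H3xH5) : Filter.Tendsto (fun r => dilation r v) (𝓝 0) (𝓝 0) := by
  have h : Continuous fun r : ℝ => dilation r v := by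
    change Continuous fun r : ℝ => ((r • v.1.x, r • v.1.y, r ^ 2 * v.1.z),
      (r • v.2.x, r • v.2.y, r ^ 2 * v.2.z))
    fun_prop
  have h0 : dilation 0 v = 0 := by
    apply Prod.ext <;> apply Heisenberg.ext <;> simp [dilation_apply]
  simpa [h0] using h.tendsto 0

/-- Left invariant vector fields are divergence free. -/
theorem integral_fderiv_apply_frame_eq_zero [MeasurableSpace H3xH5] [BorelSpace H3xH5]
    (μ : MeasureTheory.Measure H3xH5) [μ.IsAddHaarMeasure] {h : H3xH5 → ℂ} (hh : ContDiff ℝ ∞ h)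
    (hs : HasCompactSupport h) (u : H3xH5) : ∫ q, fderiv ℝ h q (frame q u) ∂μ = 0 := by
  let l₁ : H3xH5 →L[ℝ] ℝ := LinearMap.toContinuousLinearMap
    { toFun := fun q => q.1.x ⬝ᵥ u.1.y
      map_add' := fun p q => by simp [add_dotProduct]
      map_smul' := fun r q => by simp }
  let l₂ : H3xH5 →L[ℝ] ℝ := LinearMap.toContinuousLinearMap
    { toFun := fun q => q.2.x ⬝ᵥ u.2.y
      map_add' := fun p q => by simp [add_dotProduct]
      map_smul' := fun r q => by simp }
  let z₁ : H3xH5 := (Heisenberg.mk 0 0 1, 0)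
  let z₂ : H3xH5 := (0, Heisenberg.mk 0 0 1)
  have hf : ∀ q, frame q u = u + l₁ q • z₁ + l₂ q • z₂ := fun q => by
    apply Prod.ext <;> apply Heisenberg.ext <;> simp [frame_apply, twist_apply, l₁, l₂, z₁, z₂]
  have hi : ∀ w : H3xH5 → H3xH5, Continuous w →
      MeasureTheory.Integrable (fun q => fderiv ℝ h q (w q)) μ := fun w hw =>
    (continuous_fderiv_apply hh hw).integrable_of_hasCompactSupport
      (hasCompactSupport_fderiv_apply hs w)
  simp only [hf, map_add]
  rw [MeasureTheory.integral_add, MeasureTheory.integral_add, integral_fderiv_apply_eq_zero μ hh hs,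
    integral_fderiv_apply_smul_eq_zero μ hh hs l₁ z₁ (by simp [l₁, z₁]),
    integral_fderiv_apply_smul_eq_zero μ hh hs l₂ z₂ (by simp [l₂, z₂]), add_zero, add_zero]
  · exact hi _ continuous_const
  · exact hi _ (l₁.continuous.smul continuous_const)
  · exact (hi _ continuous_const).add (hi _ (l₁.continuous.smul continuous_const))
  · exact hi _ (l₂.continuous.smul continuous_const)

/-- The averages of `W f`, for a left invariant vector field `W` and a bounded function `f`, tend
to zero when the averaging density is spread out by dilations: integration by parts moves `W` to
the density, which varies more and more slowly. -/
theorem tendsto_integral_fderiv_frame [MeasurableSpace H3xH5] [BorelSpace H3xH5]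
    (μ : MeasureTheory.Measure H3xH5) [μ.IsAddHaarMeasure] {φ : H3xH5 → ℂ} (hφ : ContDiff ℝ ∞ φ)
    (hs : HasCompactSupport φ) {f : H3xH5 → ℂ} (hf : ContDiff ℝ ∞ f) {C : ℝ}
    (hC : ∀ p, ‖f p‖ ≤ C) (v : H3xH5) :
    Filter.Tendsto (fun n : ℕ => ∫ q, φ q * fderiv ℝ f (dilation (n + 1) q)
      (frame (dilation (n + 1) q) v) ∂μ) Filter.atTop (𝓝 0) := by
  have hφ' : Continuous fun q => (fderiv ℝ φ q).comp (frame q) :=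
    (hφ.continuous_fderiv (by simp)).clm_comp contDiff_frame.continuous
  have hsup : HasCompactSupport fun q => ‖(fderiv ℝ φ q).comp (frame q)‖ := by
    refine (hs.fderiv (𝕜 := ℝ)).mono fun q hq => ?_
    rw [Function.mem_support] at hq ⊢
    intro h0
    exact hq (by rw [h0]; simp)
  have hK := hφ'.norm.integrable_of_hasCompactSupport (μ := μ) hsup
  have hbound : ∀ n : ℕ, ‖∫ q, φ q * fderiv ℝ f (dilation (n + 1) q)
      (frame (dilation (n + 1) q) v) ∂μ‖ ≤
      (∫ q, ‖(fderiv ℝ φ q).comp (frame q)‖ ∂μ) * (‖dilation ((n : ℝ) + 1)⁻¹ v‖ * C) := by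
    intro n
    set r : ℝ := n + 1 with hr
    have hr0 : r ≠ 0 := by positivity
    set u := dilation r⁻¹ v with hu
    set g : H3xH5 → ℂ := fun q => f (dilation r q) with hg
    have hgs : ContDiff ℝ ∞ g := hf.comp (dilation r).contDiff
    have e1 : ∀ q, fderiv ℝ f (dilation r q) (frame (dilation r q) v) =
        fderiv ℝ g q (frame q u) := by
      intro q
      have h1 : HasFDerivAt g ((fderiv ℝ f (dilation r q)).comp (dilation r)) q :=
        (hf.differentiable (by simp) _).hasFDerivAt.comp q (dilation r).hasFDerivAt
      rw [h1.fderiv, ContinuousLinearMap.comp_apply, dilation_frame, hu,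
        dilation_dilation_inv hr0]
    have e2 : ∀ q, fderiv ℝ (fun q => φ q * g q) q (frame q u) =
        φ q * fderiv ℝ g q (frame q u) + g q * fderiv ℝ φ q (frame q u) := by
      intro q
      rw [fderiv_fun_mul (hφ.differentiable (by simp) q) (hgs.differentiable (by simp) q)]
      simp
    have hfr : Continuous fun q => frame q u := contDiff_frame.continuous.clm_apply continuous_const
    have i1 : MeasureTheory.Integrable (fun q => φ q * fderiv ℝ g q (frame q u)) μ :=
      (hφ.continuous.mul (continuous_fderiv_apply hgs hfr)).integrable_of_hasCompactSupport
        hs.mul_right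
    have i2 : MeasureTheory.Integrable (fun q => g q * fderiv ℝ φ q (frame q u)) μ :=
      (hgs.continuous.mul (continuous_fderiv_apply hφ hfr)).integrable_of_hasCompactSupport
        (hasCompactSupport_fderiv_apply hs _).mul_left
    have e3 := integral_fderiv_apply_frame_eq_zero μ (hφ.mul hgs) hs.mul_right u
    simp only [e2] at e3
    rw [MeasureTheory.integral_add i1 i2] at e3
    simp only [e1]
    rw [eq_neg_of_add_eq_zero_left e3, norm_neg, ← MeasureTheory.integral_mul_const]
    refine MeasureTheory.norm_integral_le_of_norm_le (hK.mul_const _) (Filter.Eventually.of_forall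
      fun q => ?_)
    have h1 : ‖fderiv ℝ φ q (frame q u)‖ ≤ ‖(fderiv ℝ φ q).comp (frame q)‖ * ‖u‖ :=
      ((fderiv ℝ φ q).comp (frame q)).le_opNorm u
    calc ‖g q * fderiv ℝ φ q (frame q u)‖ = ‖fderiv ℝ φ q (frame q u)‖ * ‖g q‖ := by
          rw [norm_mul, mul_comm]
      _ ≤ (‖(fderiv ℝ φ q).comp (frame q)‖ * ‖u‖) * C :=
          mul_le_mul h1 (hC _) (norm_nonneg _) (by positivity)
      _ = _ := by ring
  refine squeeze_zero_norm hbound ?_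
  have h1 : Filter.Tendsto (fun n : ℕ => ((n : ℝ) + 1)⁻¹) Filter.atTop (𝓝 0) := by
    simpa using tendsto_one_div_add_atTop_nhds_zero_nat (𝕜 := ℝ)
  have h2 := ((tendsto_dilation_zero v).comp h1).norm
  simpa using (h2.mul_const C).const_mul (∫ q, ‖(fderiv ℝ φ q).comp (frame q)‖ ∂μ)

/-- The span of the derivatives of bounded smooth functions along left invariant vector fields. -/
def frameDerivatives : Submodule ℂ (H3xH5 → ℂ) := Submodule.span ℂ
  {g | ∃ f : H3xH5 → ℂ, ContDiff ℝ ∞ f ∧ (∃ C, ∀ p, ‖f p‖ ≤ C) ∧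
    ∃ v, g = fun p => fderiv ℝ f p (frame p v)}

/-- The integrals of `f₀` against a dilated bump function stay away from zero, whereas those of the
elements of `frameDerivatives` tend to zero. -/
theorem notMem_frameDerivatives [MeasurableSpace H3xH5] [BorelSpace H3xH5]
    (μ : MeasureTheory.Measure H3xH5) [μ.IsAddHaarMeasure] {f₀ : H3xH5 → ℂ} (hf₀ : Continuous f₀)
    {c : ℝ} (hc : 0 < c) (hcf : ∀ p, c ≤ (f₀ p).re) : f₀ ∉ frameDerivatives := by
  obtain ⟨b, hφ, hs, hb0, hbi, hpos⟩ := exists_contDiff_hasCompactSupport_integral_pos μ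
  set φ : H3xH5 → ℂ := fun q => (b q : ℂ) with hφb
  have hint : ∀ g : H3xH5 → ℂ, Continuous g → ∀ r : ℝ,
      MeasureTheory.Integrable (fun q => φ q * g (dilation r q)) μ := fun g hg r =>
    (hφ.continuous.mul (hg.comp (dilation r).continuous)).integrable_of_hasCompactSupport
      hs.mul_right
  have hS : ∀ g ∈ frameDerivatives, Continuous g ∧ Filter.Tendsto (fun n : ℕ => ∫ q, φ q *
      g (dilation (n + 1) q) ∂μ) Filter.atTop (𝓝 0) := by
    intro g hg
    induction hg using Submodule.span_induction with
    | mem g hg =>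
      obtain ⟨f, hf, ⟨C, hC⟩, v, rfl⟩ := hg
      exact ⟨continuous_fderiv_apply hf (contDiff_frame.continuous.clm_apply continuous_const),
        tendsto_integral_fderiv_frame μ hφ hs hf hC v⟩
    | zero => exact ⟨continuous_zero, by simp⟩
    | add g h _ _ ihg ihh =>
      refine ⟨ihg.1.add ihh.1, ?_⟩
      simp only [Pi.add_apply, mul_add]
      have := ihg.2.add ihh.2
      rw [add_zero] at this
      refine this.congr fun n => ?_
      rw [MeasureTheory.integral_add (hint g ihg.1 _) (hint h ihh.1 _)]
    | smul a g _ ih =>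
      refine ⟨ih.1.const_smul a, ?_⟩
      have := ih.2.const_mul a
      rw [mul_zero] at this
      refine this.congr fun n => ?_
      rw [← MeasureTheory.integral_const_mul]
      congr 1
      funext q
      simp only [Pi.smul_apply, smul_eq_mul]
      ring
  intro hmem
  have h1 := (Complex.continuous_re.tendsto 0).comp (hS f₀ hmem).2
  have h2 : ∀ n : ℕ, c * ∫ q, b q ∂μ ≤ (∫ q, φ q * f₀ (dilation (n + 1) q) ∂μ).re := by
    intro n
    have h3 := hint f₀ hf₀ (n + 1)
    rw [← RCLike.re_eq_complex_re, ← integral_re h3, ← MeasureTheory.integral_const_mul]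
    refine MeasureTheory.integral_mono ?_ h3.re fun q => ?_
    · exact hbi.const_mul c
    · simp only [φ, RCLike.re_eq_complex_re, Complex.re_ofReal_mul]
      rw [mul_comm]
      exact mul_le_mul_of_nonneg_left (hcf _) (hb0 _)
  have h3 := ge_of_tendsto' h1 h2
  simp only [Complex.zero_re] at h3
  nlinarith [mul_pos hc hpos]

/-- A function with positive real part is not a sum of derivatives `W f` of bounded functions
along left invariant vector fields. So there is a linear functional that annihilates all these
derivatives, but not the given function: a substitute for the integral over a compact quotient. -/
theorem exists_linearMap_fderiv_frame_eq_zero {f₀ : H3xH5 → ℂ} (hf₀ : Continuous f₀) {c : ℝ}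
    (hc : 0 < c) (hcf : ∀ p, c ≤ (f₀ p).re) :
    ∃ m : (H3xH5 → ℂ) →ₗ[ℂ] ℂ, m f₀ ≠ 0 ∧ ∀ f : H3xH5 → ℂ, ContDiff ℝ ∞ f →
      (∃ C, ∀ p, ‖f p‖ ≤ C) → ∀ v, m (fun p => fderiv ℝ f p (frame p v)) = 0 := by
  have hnot : f₀ ∉ frameDerivatives := by
    let _ : MeasurableSpace H3xH5 := borel H3xH5
    have _ : BorelSpace H3xH5 := ⟨rfl⟩
    exact notMem_frameDerivatives MeasureTheory.Measure.addHaar hf₀ hc hcf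
  obtain ⟨m, hm, hm'⟩ := Submodule.exists_le_ker_of_notMem hnot
  exact ⟨m, hm, fun f hf hb v => hm' (Submodule.subset_span ⟨f, hf, hb, v, rfl⟩)⟩

/-! ### The complex structure -/

/-- The complex structure on the Lie algebra of `H₃ × H₅`: `J X_j = Y_j` for `j = 1, 2, 3`,
`J Z₂ = Z₁ + Z₂` and `J Z₁ = -Z₁ - 2 Z₂`, where `[X₁, Y₁] = Z₁` and
`[X₂, Y₂] = [X₃, Y₃] = Z₂`. -/
def lieJ : H3xH5 →L[ℝ] H3xH5 :=
  LinearMap.toContinuousLinearMap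
    { toFun := fun v => (Heisenberg.mk (-v.1.y) v.1.x (v.2.z - v.1.z),
        Heisenberg.mk (-v.2.y) v.2.x (v.2.z - 2 * v.1.z))
      map_add' := fun v w => by
        apply Prod.ext <;> apply Heisenberg.ext <;> simp <;> ring
      map_smul' := fun s v => by
        apply Prod.ext <;> apply Heisenberg.ext <;> simp <;> ring }

theorem lieJ_apply (v : H3xH5) : lieJ v = (Heisenberg.mk (-v.1.y) v.1.x (v.2.z - v.1.z),
    Heisenberg.mk (-v.2.y) v.2.x (v.2.z - 2 * v.1.z)) := rfl

theorem lieJ_lieJ (v : H3xH5) : lieJ (lieJ v) = -v := by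
  apply Prod.ext <;> apply Heisenberg.ext <;> simp [lieJ_apply] <;> ring

/-- The correction that makes `z - heisenbergPotential x y` have a differential which is, modulo
the left invariant form `dz - x dy`, of type `(1, 0)` in the coordinate `x + i y`. -/
def heisenbergPotential (x y : ℝ) : ℂ :=
  (x : ℂ) * y / 2 + Complex.I / 4 * ((x : ℂ) ^ 2 + (y : ℂ) ^ 2)

/-- The global holomorphic coordinates on `H₃ × H₅`. -/
def holCoord (p : H3xH5) : Fin 4 → ℂ :=
  ![p.1.x 0 + p.1.y 0 * Complex.I, p.2.x 0 + p.2.y 0 * Complex.I, p.2.x 1 + p.2.y 1 * Complex.I,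
    (-1 + Complex.I) * (p.1.z - heisenbergPotential (p.1.x 0) (p.1.y 0)) +
      (p.2.z - heisenbergPotential (p.2.x 0) (p.2.y 0) - heisenbergPotential (p.2.x 1) (p.2.y 1))]

/-- The complex combination `(-1 + i) z₁ + z₂` of the central coordinates, in terms of the
holomorphic coordinates. -/
def centralCoord (w : Fin 4 → ℂ) : ℂ :=
  w 3 + (-1 + Complex.I) * heisenbergPotential (w 0).re (w 0).im +
    heisenbergPotential (w 1).re (w 1).im + heisenbergPotential (w 2).re (w 2).im

/-- The inverse of `holCoord`. -/
def holCoordInv (w : Fin 4 → ℂ) : H3xH5 :=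
  (Heisenberg.mk (fun _ => (w 0).re) (fun _ => (w 0).im) (centralCoord w).im,
    Heisenberg.mk ![(w 1).re, (w 2).re] ![(w 1).im, (w 2).im]
      ((centralCoord w).re + (centralCoord w).im))

theorem holCoordInv_holCoord (p : H3xH5) : holCoordInv (holCoord p) = p := by
  have h : centralCoord (holCoord p) = (-1 + Complex.I) * p.1.z + p.2.z := by
    simp [centralCoord, holCoord]
    ring
  apply Prod.ext <;> apply Heisenberg.ext <;> unfold holCoordInv <;> rw [h]
  · funext i; fin_cases i; simp [holCoord]
  · funext i; fin_cases i; simp [holCoord]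
  · simp
  · funext i; fin_cases i <;> simp [holCoord]
  · funext i; fin_cases i <;> simp [holCoord]
  · simp

theorem holCoord_holCoordInv (w : Fin 4 → ℂ) : holCoord (holCoordInv w) = w := by
  have h : (-1 + Complex.I) * ((centralCoord w).im : ℂ) +
      ((centralCoord w).re + (centralCoord w).im : ℝ) = centralCoord w := by
    apply Complex.ext <;> simp
  have h3 : holCoord (holCoordInv w) 3 = w 3 := by
    have : holCoord (holCoordInv w) 3 = (-1 + Complex.I) * ((centralCoord w).im : ℂ) +
        ((centralCoord w).re + (centralCoord w).im : ℝ) -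
        ((-1 + Complex.I) * heisenbergPotential (w 0).re (w 0).im +
    heisenbergPotential (w 1).re (w 1).im + heisenbergPotential (w 2).re (w 2).im) := by
      simp [holCoord, holCoordInv]
      ring
    rw [this, h, centralCoord]
    ring
  funext j
  fin_cases j
  · simp [holCoord, holCoordInv]
  · simp [holCoord, holCoordInv]
  · simp [holCoord, holCoordInv]
  · exact h3

theorem contDiff_heisenbergPotential {F : Type*} [NormedAddCommGroup F] [NormedSpace ℝ F]
    {f g : F → ℝ} (hf : ContDiff ℝ ∞ f) (hg : ContDiff ℝ ∞ g) :
    ContDiff ℝ ∞ fun p => heisenbergPotential (f p) (g p) := by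
  have hf' : ContDiff ℝ ∞ fun p => (f p : ℂ) := Complex.ofRealCLM.contDiff.comp hf
  have hg' : ContDiff ℝ ∞ fun p => (g p : ℂ) := Complex.ofRealCLM.contDiff.comp hg
  unfold heisenbergPotential
  fun_prop

theorem contDiff_heisenberg_coord {F : Type*} [NormedAddCommGroup F] [NormedSpace ℝ F] {n : ℕ}
    {f : F → Heisenberg n} (hf : ContDiff ℝ ∞ f) : (∀ i, ContDiff ℝ ∞ fun p => (f p).x i) ∧
      (∀ i, ContDiff ℝ ∞ fun p => (f p).y i) ∧ ContDiff ℝ ∞ fun p => (f p).z := by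
  have h : ContDiff ℝ ∞ (fun p => (f p : (Fin n → ℝ) × (Fin n → ℝ) × ℝ)) := hf
  exact ⟨fun i => (contDiff_apply ℝ ℝ i).comp h.fst,
    fun i => (contDiff_apply ℝ ℝ i).comp h.snd.fst, h.snd.snd⟩

theorem contDiff_heisenberg_mk {F : Type*} [NormedAddCommGroup F] [NormedSpace ℝ F] {n : ℕ}
    {x y : F → Fin n → ℝ} {z : F → ℝ} (hx : ∀ i, ContDiff ℝ ∞ fun p => x p i)
    (hy : ∀ i, ContDiff ℝ ∞ fun p => y p i) (hz : ContDiff ℝ ∞ z) :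
    ContDiff ℝ ∞ fun p => Heisenberg.mk (x p) (y p) (z p) :=
  (contDiff_pi.mpr hx).prodMk ((contDiff_pi.mpr hy).prodMk hz)

theorem contDiff_holCoord : ContDiff ℝ ∞ holCoord := by
  obtain ⟨h1, h2, h3⟩ := contDiff_heisenberg_coord
    (contDiff_fst : ContDiff ℝ ∞ (Prod.fst : H3xH5 → Heisenberg 1))
  obtain ⟨h4, h5, h6⟩ := contDiff_heisenberg_coord
    (contDiff_snd : ContDiff ℝ ∞ (Prod.snd : H3xH5 → Heisenberg 2))
  have hc : ∀ {f : H3xH5 → ℝ}, ContDiff ℝ ∞ f → ContDiff ℝ ∞ fun p => (f p : ℂ) :=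
    fun hf => Complex.ofRealCLM.contDiff.comp hf
  refine contDiff_pi.mpr fun j => ?_
  fin_cases j
  · exact (hc (h1 0)).add ((hc (h2 0)).mul contDiff_const)
  · exact (hc (h4 0)).add ((hc (h5 0)).mul contDiff_const)
  · exact (hc (h4 1)).add ((hc (h5 1)).mul contDiff_const)
  · exact (contDiff_const.mul ((hc h3).sub (contDiff_heisenbergPotential (h1 0) (h2 0)))).add
      (((hc h6).sub (contDiff_heisenbergPotential (h4 0) (h5 0))).sub
        (contDiff_heisenbergPotential (h4 1) (h5 1)))

theorem contDiff_holCoordInv : ContDiff ℝ ∞ holCoordInv := by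
  have hr : ∀ j : Fin 4, ContDiff ℝ ∞ fun w : Fin 4 → ℂ => (w j).re := fun j =>
    Complex.reCLM.contDiff.comp (contDiff_apply ℝ ℂ j)
  have hi : ∀ j : Fin 4, ContDiff ℝ ∞ fun w : Fin 4 → ℂ => (w j).im := fun j =>
    Complex.imCLM.contDiff.comp (contDiff_apply ℝ ℂ j)
  have hc : ContDiff ℝ ∞ centralCoord :=
    (((contDiff_apply ℝ ℂ 3).add (contDiff_const.mul
      (contDiff_heisenbergPotential (hr 0) (hi 0)))).add
      (contDiff_heisenbergPotential (hr 1) (hi 1))).add (contDiff_heisenbergPotential (hr 2) (hi 2))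
  have hcr := Complex.reCLM.contDiff.comp hc
  have hci := Complex.imCLM.contDiff.comp hc
  refine (contDiff_heisenberg_mk (fun _ => hr 0) (fun _ => hi 0) hci).prodMk
    (contDiff_heisenberg_mk (fun i => ?_) (fun i => ?_) (hcr.add hci))
  · fin_cases i
    exacts [hr 1, hr 2]
  · fin_cases i
    exacts [hi 1, hi 2]

/-- The coordinates `holCoord`, as a homeomorphism. -/
def holCoordHomeomorph : H3xH5 ≃ₜ (Fin 4 → ℂ) where
  toFun := holCoord
  invFun := holCoordInv
  left_inv := holCoordInv_holCoord
  right_inv := holCoord_holCoordInv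
  continuous_toFun := contDiff_holCoord.continuous
  continuous_invFun := contDiff_holCoordInv.continuous

/-- If `f` is quadratic along the line through `q` in direction `w`, its derivative is the
linear coefficient. -/
theorem fderiv_apply_eq_of_quadratic {F : Type*} [NormedAddCommGroup F] [NormedSpace ℝ F]
    {f : F → ℂ} {q w : F} (hf : DifferentiableAt ℝ f q) {A B : ℂ}
    (h : ∀ t : ℝ, f (q + t • w) = f q + t * A + (t : ℂ) ^ 2 * B) : fderiv ℝ f q w = A := by
  have h1 : HasDerivAt (fun t : ℝ => q + t • w) w 0 := by
    simpa using ((hasDerivAt_id (0 : ℝ)).smul_const w).const_add q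
  have h2 : HasDerivAt (fun t : ℝ => f (q + t • w)) (fderiv ℝ f q w) 0 := by
    have h3 : HasFDerivAt f (fderiv ℝ f q) (q + (0 : ℝ) • w) := by simpa using hf.hasFDerivAt
    exact h3.comp_hasDerivAt 0 h1
  have h4 : HasDerivAt (fun t : ℝ => (t : ℂ)) 1 0 := (hasDerivAt_id (0 : ℝ)).ofReal_comp
  have h5 := ((h4.mul_const A).const_add (f q)).add ((h4.pow 2).mul_const B)
  refine h2.unique ?_
  refine HasDerivAt.congr_deriv (HasDerivAt.congr_of_eventuallyEq h5 ?_) (by simp)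
  exact Filter.Eventually.of_forall h

theorem fderiv_holCoord_frame (q u : H3xH5) : fderiv ℝ holCoord q (frame q u) =
    ![u.1.x 0 + u.1.y 0 * Complex.I, u.2.x 0 + u.2.y 0 * Complex.I,
      u.2.x 1 + u.2.y 1 * Complex.I,
      (-1 + Complex.I) * u.1.z + u.2.z -
        ((-1 + Complex.I) * (q.1.y 0 + q.1.x 0 * Complex.I) * (u.1.x 0 + u.1.y 0 * Complex.I) +
          (q.2.y 0 + q.2.x 0 * Complex.I) * (u.2.x 0 + u.2.y 0 * Complex.I) +
          (q.2.y 1 + q.2.x 1 * Complex.I) * (u.2.x 1 + u.2.y 1 * Complex.I)) / 2] := by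
  have hd := (contDiff_holCoord.differentiable (by simp)) q
  have hj : ∀ j, fderiv ℝ holCoord q (frame q u) j =
      fderiv ℝ (fun p => holCoord p j) q (frame q u) := fun j => by
    rw [fderiv_apply hd j]
    rfl
  have hI := Complex.I_sq
  funext j
  rw [hj]
  have hdj : DifferentiableAt ℝ (fun p => holCoord p j) q := differentiableAt_pi.mp hd j
  fin_cases j
  · refine fderiv_apply_eq_of_quadratic (B := 0) hdj fun t => ?_
    simp [holCoord, frame_apply, twist_apply]
    ring
  · refine fderiv_apply_eq_of_quadratic (B := 0) hdj fun t => ?_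
    simp [holCoord, frame_apply, twist_apply]
    ring
  · refine fderiv_apply_eq_of_quadratic (B := 0) hdj fun t => ?_
    simp [holCoord, frame_apply, twist_apply]
    ring
  · refine fderiv_apply_eq_of_quadratic (B := -((-1 + Complex.I) *
      heisenbergPotential (u.1.x 0) (u.1.y 0) + heisenbergPotential (u.2.x 0) (u.2.y 0) +
        heisenbergPotential (u.2.x 1) (u.2.y 1))) hdj fun t => ?_
    simp [holCoord, frame_apply, twist_apply, heisenbergPotential, dotProduct,
      Fin.sum_univ_two]
    ring_nf
    simp only [show Complex.I ^ 3 = -Complex.I by rw [pow_succ, hI]; ring, hI]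
    ring

theorem fderiv_holCoord_frame_lieJ (q u : H3xH5) (j : Fin 4) :
    fderiv ℝ holCoord q (frame q (lieJ u)) j =
      Complex.I * fderiv ℝ holCoord q (frame q u) j := by
  have hI := Complex.I_sq
  rw [fderiv_holCoord_frame, fderiv_holCoord_frame]
  fin_cases j <;> simp [lieJ_apply] <;> ring_nf <;> simp only [hI, Complex.I_pow_four,
    show Complex.I ^ 3 = -Complex.I by rw [pow_succ, hI]; ring] <;> ring

section Quotient

variable (Γ : Subgroup H3xH5) [DiscreteTopology Γ]

/-- The invariant almost complex structure on the quotient given by `lieJ`. -/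
def nilJ (x : Nilmanifold Γ) : TangentSpace 𝓘(ℝ, H3xH5) x →L[ℝ] TangentSpace 𝓘(ℝ, H3xH5) x :=
  ((frame (nilLift Γ x)).comp (lieJ.comp (frame (nilLift Γ x)⁻¹)) : H3xH5 →L[ℝ] H3xH5)

theorem nilJ_frame (x : Nilmanifold Γ) (v : H3xH5) :
    (nilJ Γ x (frame (nilLift Γ x) v) : H3xH5) = frame (nilLift Γ x) (lieJ v) := by
  change frame _ (lieJ (frame _ (frame _ v))) = _
  rw [frame_inv_frame]

theorem exists_eq_frame (x : Nilmanifold Γ) (v : TangentSpace 𝓘(ℝ, H3xH5) x) :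
    ∃ u : H3xH5, v = frame (nilLift Γ x) u :=
  ⟨frame (nilLift Γ x)⁻¹ v, (frame_frame_inv _ _).symm⟩

/-- The charts of the quotient followed by the global coordinates `holCoord` are holomorphic
charts. -/
theorem exists_holomorphic_chart_nilJ (x : Nilmanifold Γ) :
    ∃ φ : OpenPartialHomeomorph (Nilmanifold Γ) (Fin 4 → ℂ), x ∈ φ.source ∧
      ContMDiffOn 𝓘(ℝ, H3xH5) 𝓘(ℝ, Fin 4 → ℂ) ∞ φ φ.source ∧
      ContMDiffOn 𝓘(ℝ, Fin 4 → ℂ) 𝓘(ℝ, H3xH5) ∞ φ.symm φ.target ∧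
      ∀ y ∈ φ.source, ∀ v : TangentSpace 𝓘(ℝ, H3xH5) y, ∀ j : Fin 4,
        (mfderiv 𝓘(ℝ, H3xH5) 𝓘(ℝ, Fin 4 → ℂ) φ y (nilJ Γ y v) : Fin 4 → ℂ) j =
          Complex.I * (mfderiv 𝓘(ℝ, H3xH5) 𝓘(ℝ, Fin 4 → ℂ) φ y v : Fin 4 → ℂ) j := by
  set e := chartAt H3xH5 x with he
  have hsource : (e.transHomeomorph holCoordHomeomorph).source = e.source := rfl
  refine ⟨e.transHomeomorph holCoordHomeomorph, mem_chart_source H3xH5 x, ?_, ?_, ?_⟩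
  · exact contDiff_holCoord.contMDiff.comp_contMDiffOn (contMDiffOn_chart (x := x))
  · refine (contMDiff_nilProj.comp contDiff_holCoordInv.contMDiff).contMDiffOn.congr ?_
    intro w _
    change e.symm (holCoordInv w) = _
    rw [he, coe_chartAt_symm]
    rfl
  · intro y hy v j
    have h1 : HasMFDerivAt 𝓘(ℝ, H3xH5) 𝓘(ℝ, Fin 4 → ℂ) holCoord (e y)
        (fderiv ℝ holCoord (e y)) :=
      ((contDiff_holCoord.differentiable (by simp)) (e y)).hasFDerivAt.hasMFDerivAt
    have h2 := (h1.comp y (hasMFDerivAt_chartAt hy)).mfderiv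
    change mfderiv 𝓘(ℝ, H3xH5) 𝓘(ℝ, Fin 4 → ℂ)
      (e.transHomeomorph holCoordHomeomorph) y = _ at h2
    rw [h2]
    obtain ⟨u, rfl⟩ := exists_eq_frame Γ y v
    have h3 : ∀ u : H3xH5, frame (e y * (nilLift Γ y)⁻¹) (frame (nilLift Γ y) u) =
        frame (e y) u := fun u => by
      rw [← frame_mul, inv_mul_cancel_right]
    have h4 := nilJ_frame Γ y u
    change fderiv ℝ holCoord (e y) (frame (e y * (nilLift Γ y)⁻¹)
      (nilJ Γ y (frame (nilLift Γ y) u) : H3xH5)) j = Complex.I * fderiv ℝ holCoord (e y)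
        (frame (e y * (nilLift Γ y)⁻¹) (frame (nilLift Γ y) u)) j
    rw [h4, h3, h3]
    exact fderiv_holCoord_frame_lieJ (e y) u j

/-- The invariant complex structure on the quotient given by `lieJ`. -/
def nilComplexStructure : ComplexStructure H3xH5 (Nilmanifold Γ) 4 where
  J := nilJ Γ
  J_sq x v := by
    obtain ⟨u, rfl⟩ := exists_eq_frame Γ x v
    have h : (nilJ Γ x (nilJ Γ x (frame (nilLift Γ x) u)) : H3xH5) = -frame (nilLift Γ x) u := by
      rw [nilJ_frame, nilJ_frame, lieJ_lieJ, map_neg]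
    exact h
  exists_holomorphic_chart := exists_holomorphic_chart_nilJ Γ

theorem nilComplexStructure_isInvariant : (nilComplexStructure Γ).IsInvariant := by
  intro a p v w h
  obtain ⟨v, rfl⟩ : ∃ u : H3xH5, v = frame p u := ⟨frame p⁻¹ v, (frame_frame_inv _ _).symm⟩
  obtain ⟨w, rfl⟩ : ∃ u : H3xH5, w = frame p u := ⟨frame p⁻¹ w, (frame_frame_inv _ _).symm⟩
  rw [mfderiv_nilProj_frame, mfderiv_nilProj_frame] at h
  rw [mfderiv_nilProj_mul, mfderiv_nilProj_mul, frame_inv_frame, frame_inv_frame]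
  have h1 : frame (nilLift Γ (nilProj Γ p)) (lieJ v) = frame (nilLift Γ (nilProj Γ p)) w :=
    (nilJ_frame Γ _ v).symm.trans h
  have h2 : lieJ v = w := by
    rw [← frame_inv_frame (nilLift Γ (nilProj Γ p)) (lieJ v), h1, frame_inv_frame]
  rw [← h2]
  exact nilJ_frame Γ _ v

variable {Γ}

theorem frameForm_proj {k : ℕ} (m : ℕ) (η : DiffForm H3xH5 (Nilmanifold Γ) k) (p : H3xH5) :
    frameForm ((nilComplexStructure Γ).proj m η) p = typeProj lieJ m (frameForm η p) :=
  typeProj_compContinuousLinearMap (V := H3xH5) (nilJ Γ (nilProj Γ p)) lieJ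
    (frame (nilLift Γ (nilProj Γ p))) (nilJ_frame Γ _) m (η (nilProj Γ p))

theorem frameForm_fundamentalPow (h : (nilComplexStructure Γ).HermitianMetric) (k : ℕ)
    (p : H3xH5) : frameForm (h.fundamentalPow k) p = wedgePow (frameForm h.fundamentalForm p) k :=
  wedgePow_compContinuousLinearMap (V := H3xH5) _ _ k

end Quotient

/-! ### Hermitian metrics in the left invariant frame -/

section

section Periodic

variable {Γ : Subgroup H3xH5} [DiscreteTopology Γ]

/-- A continuous function on the group that factors through the quotient. -/
theorem exists_continuous_comp_nilProj {X : Type*} [TopologicalSpace X] {f : H3xH5 → X}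
    (hf : Continuous f) (hper : ∀ p q, nilProj Γ p = nilProj Γ q → f p = f q) :
    ∃ F : Nilmanifold Γ → X, Continuous F ∧ ∀ p, f p = F (nilProj Γ p) := by
  have h1 : ∀ p, f p = f (nilLift Γ (nilProj Γ p)) := fun p => hper _ _ (nilProj_nilLift _).symm
  refine ⟨fun x => f (nilLift Γ x), ?_, h1⟩
  have hq : Topology.IsQuotientMap (nilProj Γ) :=
    (isLocalHomeomorph_nilProj Γ).isOpenMap.isQuotientMap continuous_nilProj surjective_nilProj
  rw [hq.continuous_iff]
  exact hf.congr h1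

variable [CompactSpace (Nilmanifold Γ)]

theorem exists_norm_le_of_periodic {f : H3xH5 → ℂ} (hf : Continuous f)
    (hper : ∀ p q, nilProj Γ p = nilProj Γ q → f p = f q) : ∃ C, ∀ p, ‖f p‖ ≤ C := by
  obtain ⟨F, hF, h⟩ := exists_continuous_comp_nilProj hf hper
  obtain ⟨C, hC⟩ := isCompact_univ.exists_bound_of_continuousOn hF.continuousOn
  exact ⟨C, fun p => by rw [h]; exact hC _ trivial⟩

theorem exists_pos_le_of_periodic {f : H3xH5 → ℝ} (hf : Continuous f)
    (hper : ∀ p q, nilProj Γ p = nilProj Γ q → f p = f q) (hpos : ∀ p, 0 < f p) :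
    ∃ c > 0, ∀ p, c ≤ f p := by
  obtain ⟨F, hF, h⟩ := exists_continuous_comp_nilProj hf hper
  obtain ⟨x, -, hx⟩ := isCompact_univ.exists_isMinOn ⟨nilProj Γ 1, trivial⟩ hF.continuousOn
  obtain ⟨p, rfl⟩ := surjective_nilProj x
  exact ⟨f p, hpos p, fun q => by rw [h p, h q]; exact hx trivial⟩

end Periodic

variable {Γ : Subgroup H3xH5} [DiscreteTopology Γ]

/-- A Hermitian metric, lifted to the group and expressed in the left invariant frame. -/
def frameMetric (h : (nilComplexStructure Γ).HermitianMetric) (p : H3xH5) :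
    H3xH5 →L[ℝ] H3xH5 →L[ℝ] ℝ :=
  (h.g.inner (nilProj Γ p) : H3xH5 →L[ℝ] H3xH5 →L[ℝ] ℝ).bilinearComp
    (frame (nilLift Γ (nilProj Γ p))) (frame (nilLift Γ (nilProj Γ p)))

section

variable (h : (nilComplexStructure Γ).HermitianMetric)

theorem frameMetric_symm (p u v : H3xH5) : frameMetric h p u v = frameMetric h p v u :=
  h.g.symm (nilProj Γ p) _ _

theorem frameMetric_pos (p : H3xH5) {u : H3xH5} (hu : u ≠ 0) : 0 < frameMetric h p u u := by
  refine h.g.pos (nilProj Γ p) (frame (nilLift Γ (nilProj Γ p)) u : H3xH5) fun h0 => hu ?_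
  have h1 : frame (nilLift Γ (nilProj Γ p)) u = 0 := h0
  rw [← frame_inv_frame (nilLift Γ (nilProj Γ p)) u, h1, map_zero]

theorem frameMetric_lieJ (p u v : H3xH5) :
    frameMetric h p (lieJ u) (lieJ v) = frameMetric h p u v := by
  have h1 := h.compat (nilProj Γ p) (frame (nilLift Γ (nilProj Γ p)) u)
    (frame (nilLift Γ (nilProj Γ p)) v)
  have h2 : ∀ u : H3xH5, (frame (nilLift Γ (nilProj Γ p)) (lieJ u) : H3xH5) =
    (nilComplexStructure Γ).J (nilProj Γ p) (frame (nilLift Γ (nilProj Γ p)) u) :=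
      fun u => (nilJ_frame Γ _ u).symm
  let B : H3xH5 →L[ℝ] H3xH5 →L[ℝ] ℝ := h.g.inner (nilProj Γ p)
  exact (congrArg₂ (fun a b : H3xH5 => B a b) (h2 u) (h2 v)).trans h1

theorem frameMetric_eq_of_nilProj_eq {p q : H3xH5} (hpq : nilProj Γ p = nilProj Γ q) :
    frameMetric h p = frameMetric h q := by
  unfold frameMetric
  rw [hpq]

theorem frameForm_fundamentalForm (p u v : H3xH5) :
    frameForm h.fundamentalForm p ![u, v] = frameMetric h p (lieJ u) v := by
  have h2 : (frame (nilLift Γ (nilProj Γ p)) (lieJ u) : H3xH5) =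
    (nilComplexStructure Γ).J (nilProj Γ p) (frame (nilLift Γ (nilProj Γ p)) u) :=
      (nilJ_frame Γ _ u).symm
  let B : H3xH5 →L[ℝ] H3xH5 →L[ℝ] ℝ := h.g.inner (nilProj Γ p)
  exact congrArg (fun a : H3xH5 => (B a (frame (nilLift Γ (nilProj Γ p)) v) : ℂ)) h2.symm

theorem contMDiff_frame_section (u : H3xH5) :
    ContMDiff 𝓘(ℝ, H3xH5) 𝓘(ℝ, H3xH5).tangent ∞ fun p =>
      (Bundle.TotalSpace.mk' H3xH5 (nilProj Γ p) (frame (nilLift Γ (nilProj Γ p)) u : H3xH5) :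
        TangentBundle 𝓘(ℝ, H3xH5) (Nilmanifold Γ)) := by
  have h1 : ContMDiff 𝓘(ℝ, H3xH5) 𝓘(ℝ, H3xH5).tangent ∞ fun p : H3xH5 =>
      (Bundle.TotalSpace.mk' H3xH5 p (frame p u) : TangentBundle 𝓘(ℝ, H3xH5) H3xH5) :=
    contMDiff_vectorSpace_iff_contDiff.mpr (contDiff_frame.clm_apply contDiff_const)
  have h2 := (contMDiff_nilProj (Γ := Γ)).contMDiff_tangentMap (m := ∞) (by simp)
  refine (h2.comp h1).congr fun p => ?_
  simp only [Function.comp_apply, tangentMap, mfderiv_nilProj_frame]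

theorem contDiff_frameMetric (u v : H3xH5) : ContDiff ℝ ∞ fun p => frameMetric h p u v := by
  have h1 := ContMDiff.clm_bundle_apply₂ (F₁ := H3xH5) (F₂ := H3xH5) (F₃ := ℝ)
    (E₃ := Bundle.Trivial (Nilmanifold Γ) ℝ)
    (h.g.contMDiff.comp (contMDiff_nilProj (Γ := Γ))) (contMDiff_frame_section u)
    (contMDiff_frame_section v)
  have h2 : ContMDiff 𝓘(ℝ, H3xH5) 𝓘(ℝ, ℝ) ∞ fun p => frameMetric h p u v := fun p =>
    ((Bundle.contMDiffAt_totalSpace).mp (h1 p)).2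
  exact h2.contDiff

theorem contDiff_frameForm_fundamentalForm : ContDiff ℝ ∞ (frameForm h.fundamentalForm) := by
  refine contDiff_alternating_of_forall_apply fun v => ?_
  have h1 : v = ![v 0, v 1] := by funext i; fin_cases i <;> rfl
  rw [h1]
  simp only [frameForm_fundamentalForm]
  exact Complex.ofRealCLM.contDiff.comp (contDiff_frameMetric h _ _)

theorem contDiff_frameForm_fundamentalPow (k : ℕ) :
    ContDiff ℝ ∞ (frameForm (h.fundamentalPow k)) := by
  have h1 : frameForm (h.fundamentalPow k) = fun p => wedgePow (frameForm h.fundamentalForm p) k :=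
    funext fun p => frameForm_fundamentalPow h k p
  rw [h1]
  exact contDiff_wedgePow (contDiff_frameForm_fundamentalForm h) k

theorem contDiff_frameForm_proj {k : ℕ} (m : ℕ) {η : DiffForm H3xH5 (Nilmanifold Γ) k}
    (hη : ContDiff ℝ ∞ (frameForm η)) :
    ContDiff ℝ ∞ (frameForm ((nilComplexStructure Γ).proj m η)) := by
  have h1 : frameForm ((nilComplexStructure Γ).proj m η) =
    fun p => typeProj lieJ m (frameForm η p) := funext fun p => frameForm_proj m η p
  rw [h1]
  exact contDiff_typeProj lieJ m hη

end

/-- A functional that annihilates the derivatives of bounded functions along left invariant vector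
fields only sees the Chevalley–Eilenberg part of an exterior derivative. -/
theorem map_frameForm_extD [CompactSpace (Nilmanifold Γ)] {m : (H3xH5 → ℂ) →ₗ[ℂ] ℂ}
    (hm : ∀ f : H3xH5 → ℂ, ContDiff ℝ ∞ f → (∃ C, ∀ p, ‖f p‖ ≤ C) → ∀ v,
      m (fun p => fderiv ℝ f p (frame p v)) = 0)
    {k : ℕ} {η : DiffForm H3xH5 (Nilmanifold Γ) (k + 1)} (hη : ContDiff ℝ ∞ (frameForm η))
    (v : Fin (k + 2) → H3xH5) :
    m (fun p => frameForm (extD η) p v) = m (fun p => ceDiff (frameForm η p) v) := by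
  have h1 : (fun p => frameForm (extD η) p v) = (∑ i, (-1 : ℂ) ^ i.val • fun p =>
      fderiv ℝ (fun q => frameForm η q (i.removeNth v)) p (frame p (v i))) +
        fun p => ceDiff (frameForm η p) v := by
    funext p
    rw [frameForm_extD_apply η (hη.differentiable (by simp))]
    simp [Finset.sum_apply, zsmul_eq_mul]
  rw [h1, map_add, map_sum, Finset.sum_eq_zero, zero_add]
  intro i _
  rw [map_smul, hm _ _ _ (v i), smul_zero]
  · exact (ContinuousAlternatingMap.apply ℝ H3xH5 ℂ _).contDiff.comp hη
  · refine exists_norm_le_of_periodic (Γ := Γ) ?_ fun p q hpq => ?_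
    · exact ((ContinuousAlternatingMap.apply ℝ H3xH5 ℂ _).contDiff.comp hη).continuous
    · rw [frameForm_eq_of_nilProj_eq η hpq]

end

/-! ### The structure of the Lie algebra -/

@[simp] theorem Heisenberg.x_sub {n : ℕ} (a b : Heisenberg n) : (a - b).x = a.x - b.x := rfl
@[simp] theorem Heisenberg.y_sub {n : ℕ} (a b : Heisenberg n) : (a - b).y = a.y - b.y := rfl
@[simp] theorem Heisenberg.z_sub {n : ℕ} (a b : Heisenberg n) : (a - b).z = a.z - b.z := rfl

/-- The vectors `X₁, X₂, X₃, Z₂`, which form, together with their images under `lieJ`, a basis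
of the Lie algebra. -/
def lieBasis : Fin 4 → H3xH5 :=
  ![(Heisenberg.mk ![1] 0 0, 0), (0, Heisenberg.mk ![1, 0] 0 0), (0, Heisenberg.mk ![0, 1] 0 0),
    (0, Heisenberg.mk 0 0 1)]

/-- The brackets `[v, J v]` for the vectors `v` of `lieBasis`: they are `Z₁, Z₂, Z₂, 0`. -/
def lieCenter (a : Fin 4) : H3xH5 := bracket (lieBasis a) (lieJ (lieBasis a))

/-- An element that brackets trivially with everything. -/
def IsCentral (z : H3xH5) : Prop := ∀ v, bracket z v = 0

theorem isCentral_of_coord {z : H3xH5} (h1 : z.1.x = 0) (h2 : z.1.y = 0) (h3 : z.2.x = 0)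
    (h4 : z.2.y = 0) : IsCentral z := by
  intro v
  apply Prod.ext <;> apply Heisenberg.ext <;> simp [bracket, twist_apply, h1, h2, h3, h4]

theorem isCentral_bracket (u v : H3xH5) : IsCentral (bracket u v) :=
  isCentral_of_coord (by simp [bracket, twist_apply]) (by simp [bracket, twist_apply])
    (by simp [bracket, twist_apply]) (by simp [bracket, twist_apply])

theorem isCentral_lieJ_bracket (u v : H3xH5) : IsCentral (lieJ (bracket u v)) :=
  isCentral_of_coord (by simp [bracket, twist_apply, lieJ_apply])
    (by simp [bracket, twist_apply, lieJ_apply]) (by simp [bracket, twist_apply, lieJ_apply])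
    (by simp [bracket, twist_apply, lieJ_apply])

theorem lieCenter_zero : lieCenter 0 = lieJ (lieBasis 3) - lieBasis 3 := by
  apply Prod.ext <;> apply Heisenberg.ext <;>
    simp [lieCenter, lieBasis, bracket, twist_apply, lieJ_apply, sub_eq_add_neg]

theorem lieCenter_one : lieCenter 1 = lieBasis 3 := by
  apply Prod.ext <;> apply Heisenberg.ext <;>
    simp [lieCenter, lieBasis, bracket, twist_apply, lieJ_apply, sub_eq_add_neg]

theorem lieCenter_two : lieCenter 2 = lieBasis 3 := by
  apply Prod.ext <;> apply Heisenberg.ext <;>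
    simp [lieCenter, lieBasis, bracket, twist_apply, lieJ_apply, sub_eq_add_neg]

theorem lieCenter_three : lieCenter 3 = 0 := by
  apply Prod.ext <;> apply Heisenberg.ext <;>
    simp [lieCenter, lieBasis, bracket, twist_apply, lieJ_apply, sub_eq_add_neg]

theorem isCentral_lieBasis_three : IsCentral (lieBasis 3) := by
  rw [← lieCenter_one]
  exact isCentral_bracket _ _

/-- The complex lines spanned by different vectors of `lieBasis` commute. -/
theorem bracket_lieBasis {a b : Fin 4} (hab : a ≠ b) :
    bracket (lieBasis a) (lieBasis b) = 0 ∧ bracket (lieBasis a) (lieJ (lieBasis b)) = 0 ∧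
      bracket (lieJ (lieBasis a)) (lieBasis b) = 0 ∧
      bracket (lieJ (lieBasis a)) (lieJ (lieBasis b)) = 0 := by
  refine ⟨?_, ?_, ?_, ?_⟩ <;> apply Prod.ext <;> apply Heisenberg.ext <;>
    simp [bracket, twist_apply] <;>
    fin_cases a <;> fin_cases b <;> simp [lieBasis, lieJ_apply] at hab ⊢

/-! ### The Chevalley–Eilenberg differential on complex lines -/

/-- If only consecutive arguments have a nonzero bracket, the Chevalley–Eilenberg differential is
a single sum without signs. -/
theorem ceDiff_eq_neg_sum {k : ℕ} (θ : H3xH5 [⋀^Fin (k + 1)]→L[ℝ] ℂ) (v : Fin (k + 2) → H3xH5)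
    (h : ∀ i j : Fin (k + 1), i < j → bracket (v i.castSucc) (v j.succ) = 0) :
    ceDiff θ v = -∑ i : Fin (k + 1), θ (Matrix.vecCons (bracket (v i.castSucc) (v i.succ))
      (i.removeNth (i.castSucc.removeNth v))) := by
  rw [ceDiff]
  congr 1
  refine Finset.sum_congr rfl fun i _ => ?_
  rw [Finset.sum_eq_single i]
  · rw [← two_mul, pow_mul]
    simp
  · intro j hj hji
    rw [h i j (lt_of_le_of_ne (by simpa using hj) hji.symm)]
    rw [θ.map_coord_zero 0 rfl, smul_zero]
  · simp

section

variable {k : ℕ} {z : H3xH5} {a b c : Fin 4}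

theorem ceDiff_cons_pair (θ : H3xH5 [⋀^Fin 2]→L[ℝ] ℂ) (hz : IsCentral z) :
    ceDiff θ ![z, lieBasis a, lieJ (lieBasis a)] = -θ ![lieCenter a, z] := by
  rw [ceDiff_eq_neg_sum θ ![z, lieBasis a, lieJ (lieBasis a)]]
  · rw [Fin.sum_univ_two]
    refine congrArg Neg.neg ?_
    refine (congrArg₂ (· + ·) (θ.map_coord_zero 0 (hz _)) (congrArg θ ?_)).trans (zero_add _)
    · funext i
      fin_cases i <;> rfl
  · have hz' : ∀ v, bracket z v = 0 := hz
    intro i j hij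
    generalize bracket = B at *
    fin_cases i <;> fin_cases j <;> first | exact absurd hij (by decide) | exact hz' _

theorem ceDiff_two_pairs (θ : H3xH5 [⋀^Fin 3]→L[ℝ] ℂ) (hab : a ≠ b) :
    ceDiff θ ![lieBasis a, lieJ (lieBasis a), lieBasis b, lieJ (lieBasis b)] =
      -(θ ![lieCenter a, lieBasis b, lieJ (lieBasis b)] +
        θ ![lieCenter b, lieBasis a, lieJ (lieBasis a)]) := by
  obtain ⟨h1, h2, h3, h4⟩ := bracket_lieBasis hab
  rw [ceDiff_eq_neg_sum θ ![lieBasis a, lieJ (lieBasis a), lieBasis b, lieJ (lieBasis b)]]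
  · rw [Fin.sum_univ_three]
    refine congrArg Neg.neg (congrArg₂ (· + ·) ?_ ?_)
    · refine (congrArg₂ (· + ·) (congrArg θ ?_) (θ.map_coord_zero 0 h3)).trans (add_zero _)
      funext i
      fin_cases i <;> rfl
    · refine congrArg θ ?_
      funext i
      fin_cases i <;> rfl
  · intro i j hij
    generalize bracket = B at *
    fin_cases i <;> fin_cases j <;> first | exact absurd hij (by decide) | assumption

theorem ceDiff_cons_two_pairs (θ : H3xH5 [⋀^Fin 4]→L[ℝ] ℂ) (hz : IsCentral z) (hab : a ≠ b) :
    ceDiff θ ![z, lieBasis a, lieJ (lieBasis a), lieBasis b, lieJ (lieBasis b)] =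
      -(θ ![lieCenter a, z, lieBasis b, lieJ (lieBasis b)] +
        θ ![lieCenter b, z, lieBasis a, lieJ (lieBasis a)]) := by
  obtain ⟨h1, h2, h3, h4⟩ := bracket_lieBasis hab
  rw [ceDiff_eq_neg_sum θ ![z, lieBasis a, lieJ (lieBasis a), lieBasis b, lieJ (lieBasis b)]]
  · rw [Fin.sum_univ_four]
    refine congrArg Neg.neg (congrArg₂ (· + ·) ?_ ?_)
    · refine (congrArg₂ (· + ·) ((congrArg₂ (· + ·) (θ.map_coord_zero 0 (hz _))
        (congrArg θ ?_)).trans (zero_add _)) (θ.map_coord_zero 0 h3)).trans (add_zero _)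
      funext i
      fin_cases i <;> rfl
    · refine congrArg θ ?_
      funext i
      fin_cases i <;> rfl
  · have hz' : ∀ v, bracket z v = 0 := hz
    intro i j hij
    generalize bracket = B at *
    fin_cases i <;> fin_cases j <;> first | exact absurd hij (by decide) | exact hz' _ | assumption

theorem ceDiff_three_pairs (θ : H3xH5 [⋀^Fin 5]→L[ℝ] ℂ) (hab : a ≠ b) (hac : a ≠ c) (hbc : b ≠ c) :
    ceDiff θ ![lieBasis a, lieJ (lieBasis a), lieBasis b, lieJ (lieBasis b), lieBasis c,
      lieJ (lieBasis c)] =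
      -(θ ![lieCenter a, lieBasis b, lieJ (lieBasis b), lieBasis c, lieJ (lieBasis c)] +
        θ ![lieCenter b, lieBasis a, lieJ (lieBasis a), lieBasis c, lieJ (lieBasis c)] +
        θ ![lieCenter c, lieBasis a, lieJ (lieBasis a), lieBasis b, lieJ (lieBasis b)]) := by
  obtain ⟨h1, h2, h3, h4⟩ := bracket_lieBasis hab
  obtain ⟨k1, k2, k3, k4⟩ := bracket_lieBasis hac
  obtain ⟨l1, l2, l3, l4⟩ := bracket_lieBasis hbc
  rw [ceDiff_eq_neg_sum θ ![lieBasis a, lieJ (lieBasis a), lieBasis b, lieJ (lieBasis b),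
    lieBasis c, lieJ (lieBasis c)]]
  · rw [Fin.sum_univ_five]
    refine congrArg Neg.neg (congrArg₂ (· + ·) ?_ ?_)
    · refine (congrArg₂ (· + ·) (congrArg₂ (· + ·) ((congrArg₂ (· + ·) (congrArg θ ?_)
        (θ.map_coord_zero 0 h3)).trans (add_zero _)) (congrArg θ ?_))
        (θ.map_coord_zero 0 l3)).trans (add_zero _)
      · funext i
        fin_cases i <;> rfl
      · funext i
        fin_cases i <;> rfl
    · refine congrArg θ ?_
      funext i
      fin_cases i <;> rfl
  · intro i j hij
    generalize bracket = B at *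
    fin_cases i <;> fin_cases j <;> first | exact absurd hij (by decide) | assumption

theorem ceDiff_cons_three_pairs (θ : H3xH5 [⋀^Fin 6]→L[ℝ] ℂ) (hz : IsCentral z) (hab : a ≠ b)
    (hac : a ≠ c) (hbc : b ≠ c) :
    ceDiff θ ![z, lieBasis a, lieJ (lieBasis a), lieBasis b, lieJ (lieBasis b), lieBasis c,
      lieJ (lieBasis c)] =
      -(θ ![lieCenter a, z, lieBasis b, lieJ (lieBasis b), lieBasis c, lieJ (lieBasis c)] +
        θ ![lieCenter b, z, lieBasis a, lieJ (lieBasis a), lieBasis c, lieJ (lieBasis c)] +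
        θ ![lieCenter c, z, lieBasis a, lieJ (lieBasis a), lieBasis b, lieJ (lieBasis b)]) := by
  obtain ⟨h1, h2, h3, h4⟩ := bracket_lieBasis hab
  obtain ⟨k1, k2, k3, k4⟩ := bracket_lieBasis hac
  obtain ⟨l1, l2, l3, l4⟩ := bracket_lieBasis hbc
  rw [ceDiff_eq_neg_sum θ ![z, lieBasis a, lieJ (lieBasis a), lieBasis b, lieJ (lieBasis b),
    lieBasis c, lieJ (lieBasis c)]]
  · rw [Fin.sum_univ_six]
    refine congrArg Neg.neg (congrArg₂ (· + ·) ?_ ?_)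
    · refine (congrArg₂ (· + ·) (congrArg₂ (· + ·) ((congrArg₂ (· + ·) ((congrArg₂ (· + ·)
        (θ.map_coord_zero 0 (hz _)) (congrArg θ ?_)).trans (zero_add _))
        (θ.map_coord_zero 0 h3)).trans (add_zero _)) (congrArg θ ?_))
        (θ.map_coord_zero 0 l3)).trans (add_zero _)
      · funext i
        fin_cases i <;> rfl
      · funext i
        fin_cases i <;> rfl
    · refine congrArg θ ?_
      funext i
      fin_cases i <;> rfl
  · have hz' : ∀ v, bracket z v = 0 := hz
    intro i j hij
    generalize bracket = B at *
    fin_cases i <;> fin_cases j <;> first | exact absurd hij (by decide) | exact hz' _ | assumption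

end

/-! ### No Hermitian metric is pluriclosed -/

section

variable {Γ : Subgroup H3xH5} [DiscreteTopology Γ]

theorem lieBasis_three_ne_zero : lieBasis 3 ≠ 0 := by
  intro h
  have h1 := congrArg (fun v : H3xH5 => v.2.z) h
  simp [lieBasis] at h1

/-- A positive continuous periodic function is not annihilated by some functional that annihilates
the derivatives along left invariant vector fields. -/
theorem exists_linearMap_of_periodic_pos [CompactSpace (Nilmanifold Γ)] {f : H3xH5 → ℝ}
    (hf : Continuous f) (hper : ∀ p q, nilProj Γ p = nilProj Γ q → f p = f q)
    (hpos : ∀ p, 0 < f p) :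
    ∃ m : (H3xH5 → ℂ) →ₗ[ℂ] ℂ, m (fun p => (f p : ℂ)) ≠ 0 ∧ ∀ f : H3xH5 → ℂ, ContDiff ℝ ∞ f →
      (∃ C, ∀ p, ‖f p‖ ≤ C) → ∀ v, m (fun p => fderiv ℝ f p (frame p v)) = 0 := by
  obtain ⟨c, hc, hcf⟩ := exists_pos_le_of_periodic hf hper hpos
  exact exists_linearMap_fderiv_frame_eq_zero (Complex.continuous_ofReal.comp hf) hc
    fun p => by simpa using hcf p

/-- The mean of the `(1, 2)`-part of `dΩ` at `Z₂, v, J v`, for `[v, J v] = Z₂`, is a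
multiple of the mean of `‖Z₂‖²`. -/
theorem map_frameForm_delbar_fundamentalForm [CompactSpace (Nilmanifold Γ)]
    (h : (nilComplexStructure Γ).HermitianMetric) {m : (H3xH5 → ℂ) →ₗ[ℂ] ℂ}
    (hm : ∀ f : H3xH5 → ℂ, ContDiff ℝ ∞ f → (∃ C, ∀ p, ‖f p‖ ≤ C) → ∀ v,
      m (fun p => fderiv ℝ f p (frame p v)) = 0) {a : Fin 4} (ha : lieCenter a = lieBasis 3) :
    m (fun p => frameForm ((nilComplexStructure Γ).delbar 1 h.fundamentalForm) p
      ![lieBasis 3, lieBasis a, lieJ (lieBasis a)]) =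
      -(Complex.I / 2) * m (fun p => (frameMetric h p (lieBasis 3) (lieBasis 3) : ℂ)) := by
  have hΩ := contDiff_frameForm_fundamentalForm h
  have hz := isCentral_lieBasis_three
  have hJz : IsCentral (lieJ (lieBasis 3)) := by
    rw [← lieCenter_one]
    exact isCentral_lieJ_bracket _ _
  have h1 : (fun p => frameForm ((nilComplexStructure Γ).delbar 1 h.fundamentalForm) p
      ![lieBasis 3, lieBasis a, lieJ (lieBasis a)]) = (1 / 2 : ℂ) •
        ((fun p => frameForm (extD h.fundamentalForm) p
          ![lieBasis 3, lieBasis a, lieJ (lieBasis a)]) + Complex.I • fun p =>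
        frameForm (extD h.fundamentalForm) p
          ![lieJ (lieBasis 3), lieBasis a, lieJ (lieBasis a)]) := by
    funext p
    rw [ComplexStructure.delbar, frameForm_proj, typeProj_one_apply_cons_pair _ lieJ_lieJ]
    simp only [Pi.add_apply, Pi.smul_apply, smul_eq_mul]
    ring
  have h2 : (fun p => ceDiff (frameForm h.fundamentalForm p)
      ![lieBasis 3, lieBasis a, lieJ (lieBasis a)]) = 0 := by
    funext p
    rw [ceDiff_cons_pair _ hz, ha, (frameForm h.fundamentalForm p).map_eq_zero_of_eq
      ![lieBasis 3, lieBasis 3] (i := 0) (j := 1) rfl (by decide), neg_zero]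
    rfl
  have h3 : (fun p => ceDiff (frameForm h.fundamentalForm p)
      ![lieJ (lieBasis 3), lieBasis a, lieJ (lieBasis a)]) =
        (-1 : ℂ) • fun p => (frameMetric h p (lieBasis 3) (lieBasis 3) : ℂ) := by
    funext p
    rw [ceDiff_cons_pair _ hJz, ha, frameForm_fundamentalForm, frameMetric_lieJ]
    simp
  rw [h1, map_smul, map_add, map_smul, map_frameForm_extD hm hΩ, map_frameForm_extD hm hΩ, h2, h3,
    map_zero, map_smul]
  simp only [smul_eq_mul]
  ring

/-- The mean of `∂∂̄Ω(X₂, Y₂, X₃, Y₃)` is a nonzero multiple of the mean of `‖Z₂‖²`. -/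
theorem not_isSKT [CompactSpace (Nilmanifold Γ)] (h : (nilComplexStructure Γ).HermitianMetric) :
    ¬ h.IsSKT := by
  intro hskt
  obtain ⟨m, hm0, hm⟩ := exists_linearMap_of_periodic_pos (Γ := Γ)
    (contDiff_frameMetric h (lieBasis 3) (lieBasis 3)).continuous
    (fun p q hpq => by rw [frameMetric_eq_of_nilProj_eq h hpq])
    (fun p => frameMetric_pos h p lieBasis_three_ne_zero)
  set η := (nilComplexStructure Γ).delbar 1 h.fundamentalForm with hη
  have hηs : ContDiff ℝ ∞ (frameForm η) :=
    contDiff_frameForm_proj 1 (contDiff_frameForm_extD (contDiff_frameForm_fundamentalForm h))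
  have h12 : (1 : Fin 4) ≠ 2 := by decide
  have h1 : (fun p => frameForm (extD η) p
      ![lieBasis 1, lieJ (lieBasis 1), lieBasis 2, lieJ (lieBasis 2)]) = 0 := by
    funext p
    rw [← typeProj_two_apply_pairs lieJ lieJ_lieJ, ← frameForm_proj]
    have : (nilComplexStructure Γ).proj 2 (extD η) = 0 := hskt
    rw [this]
    rfl
  have h2 := map_frameForm_extD hm hηs
    ![lieBasis 1, lieJ (lieBasis 1), lieBasis 2, lieJ (lieBasis 2)]
  rw [h1, map_zero] at h2
  have h3 : (fun p => ceDiff (frameForm η p)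
      ![lieBasis 1, lieJ (lieBasis 1), lieBasis 2, lieJ (lieBasis 2)]) = (-1 : ℂ) •
        ((fun p => frameForm η p ![lieBasis 3, lieBasis 2, lieJ (lieBasis 2)]) +
          fun p => frameForm η p ![lieBasis 3, lieBasis 1, lieJ (lieBasis 1)]) := by
    funext p
    rw [ceDiff_two_pairs _ h12, lieCenter_one, lieCenter_two]
    simp
  rw [h3, map_smul, map_add, map_frameForm_delbar_fundamentalForm h hm lieCenter_one,
    map_frameForm_delbar_fundamentalForm h hm lieCenter_two] at h2
  apply hm0
  have h4 : Complex.I * m (fun p => (frameMetric h p (lieBasis 3) (lieBasis 3) : ℂ)) = 0 := by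
    rw [h2]
    simp only [smul_eq_mul]
    ring
  exact (mul_eq_zero.mp h4).resolve_left Complex.I_ne_zero

/-! ### Powers of a positive form on linearly independent complex lines -/

section Positivity

variable {V : Type*} [AddCommGroup V] [Module ℝ V] [TopologicalSpace V]

/-- The value of an alternating form does not change when a combination of the other arguments is
added to one argument. -/
theorem map_update_add_of_mem_span {ι : Type*} [DecidableEq ι] (f : V [⋀^ι]→L[ℝ] ℂ) (v : ι → V)
    (i : ι) {x : V} (hx : x ∈ Submodule.span ℝ (v '' {j | j ≠ i})) :
    f (Function.update v i (v i + x)) = f v := by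
  rw [f.map_update_add, Function.update_eq_self]
  suffices h : f (Function.update v i x) = 0 by rw [h, add_zero]
  induction hx using Submodule.span_induction with
  | mem x hx =>
    obtain ⟨j, hj, rfl⟩ := hx
    exact f.map_eq_zero_of_eq (i := i) (j := j) _ (by simp [Function.update_of_ne hj]) hj.symm
  | zero => exact f.map_coord_zero i (by simp)
  | add x y _ _ hx hy => rw [f.map_update_add, hx, hy, add_zero]
  | smul r x _ hx => rw [f.map_update_smul, hx, smul_zero]

end Positivity

section Hermitian

variable {V : Type*} [NormedAddCommGroup V] [NormedSpace ℝ V] {J : V →L[ℝ] V}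
  {g : V →L[ℝ] V →L[ℝ] ℝ} {β : V [⋀^Fin 2]→L[ℝ] ℂ}

/-- For a Hermitian inner product `g`, complex lines spanned by orthogonal vectors are orthogonal
for `β(u, v) = g(J u, v)`. -/
theorem twoForm_eq_zero_of_orthogonal (hJ : ∀ v, J (J v) = -v) (hgJ : ∀ u v, g (J u) (J v) = g u v)
    (hβ : ∀ u v, β ![u, v] = g (J u) v) {x y : V}
    (h1 : g x y = 0) (h2 : g x (J y) = 0) :
    (β ![x, y] = 0 ∧ β ![x, J y] = 0 ∧ β ![J x, y] = 0 ∧ β ![J x, J y] = 0) ∧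
      (β ![y, x] = 0 ∧ β ![J y, x] = 0 ∧ β ![y, J x] = 0 ∧ β ![J y, J x] = 0) := by
  have h3 : g (J x) y = 0 := by
    have := hgJ x (J y)
    rw [hJ, map_neg, h2] at this
    linarith
  have k1 : β ![x, y] = 0 := by rw [hβ, h3, Complex.ofReal_zero]
  have k2 : β ![x, J y] = 0 := by rw [hβ, hgJ, h1, Complex.ofReal_zero]
  have k3 : β ![J x, y] = 0 := by rw [hβ, hJ, map_neg]; simp [h1]
  have k4 : β ![J x, J y] = 0 := by rw [hβ, hgJ, h3, Complex.ofReal_zero]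
  refine ⟨⟨k1, k2, k3, k4⟩, ?_, ?_, ?_, ?_⟩ <;> rw [twoForm_swap] <;> simp [k1, k2, k3, k4]

set_option maxRecDepth 4000 in
/-- `Ω³` is positive on three complex lines that are linearly independent over the complex
numbers, because the Gram–Schmidt process does not change its value. -/
theorem wedgePow_three_pos (hJ : ∀ v, J (J v) = -v) (hsymm : ∀ u v, g u v = g v u)
    (hpos : ∀ v, v ≠ 0 → 0 < g v v) (hgJ : ∀ u v, g (J u) (J v) = g u v)
    (hβ : ∀ u v, β ![u, v] = g (J u) v) {a b c : V} (ha : a ≠ 0)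
    (hb : ∀ s t : ℝ, b + (s • a + t • J a) ≠ 0)
    (hc : ∀ s t u w : ℝ, c + (s • a + t • J a + u • b + w • J b) ≠ 0) :
    ∃ r : ℝ, 0 < r ∧ wedgePow β 3 ![a, J a, b, J b, c, J c] = r := by
  have hskew : ∀ v, g v (J v) = 0 := fun v => by
    have h1 := hgJ v (J v)
    rw [hJ, map_neg, hsymm] at h1
    linarith
  have hskew' : ∀ v, g (J v) v = 0 := fun v => by rw [hsymm, hskew]
  have hJ2 : ∀ u v, g (J u) v = -g u (J v) := fun u v => by
    have h1 := hgJ u (J v)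
    rw [hJ, map_neg] at h1
    linarith
  have haa := hpos a ha
  set s : ℝ := -(g b a / g a a) with hs
  set t : ℝ := -(g b (J a) / g a a) with ht
  set b' := b + (s • a + t • J a) with hb'
  have hJb' : J b' = J b + (s • J a + (-t) • a) := by simp [hb', hJ]
  have hbb := hpos b' (hb s t)
  have hba : g a b' = 0 := by
    rw [hsymm, hb', hs, ht]
    simp [hskew']
    field_simp
    ring
  have hbJa : g a (J b') = 0 := by
    rw [← neg_eq_zero, ← hJ2, hsymm, hb', hs, ht]
    simp [hskew, hgJ]
    field_simp
    ring
  set s₂ : ℝ := -(g c a / g a a) with hs₂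
  set t₂ : ℝ := -(g c (J a) / g a a) with ht₂
  set u₂ : ℝ := -(g c b' / g b' b') with hu₂
  set w₂ : ℝ := -(g c (J b') / g b' b') with hw₂
  set c' := c + (s₂ • a + t₂ • J a + u₂ • b' + w₂ • J b') with hc'
  have hJc' : J c' = J c + (s₂ • J a + (-t₂) • a + u₂ • J b' + (-w₂) • b') := by
    simp [hc', hJ]
  have hc0 : c' ≠ 0 := by
    have h1 := hc (s₂ + u₂ * s - w₂ * t) (t₂ + u₂ * t + w₂ * s) u₂ w₂
    intro h0
    apply h1
    rw [← h0, hc', hJb', hb']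
    module
  have hcc := hpos c' hc0
  have hba' : g b' a = 0 := by rw [hsymm, hba]
  have hbJa' : g b' (J a) = 0 := by
    have := hJ2 b' a
    rw [hsymm, hbJa] at this
    linarith
  have hac : g a c' = 0 := by
    rw [hsymm, hc', hs₂]
    simp [hskew', hba', hJ2, hbJa']
    field_simp
    ring
  have haJc : g a (J c') = 0 := by
    rw [← neg_eq_zero, ← hJ2, hsymm, hc', ht₂]
    simp [hskew, hgJ, hba', hbJa']
    field_simp
    ring
  have hbc : g b' c' = 0 := by
    rw [hsymm, hc', hu₂]
    simp [hskew', hba, hJ2, hbJa]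
    field_simp
    ring
  have hbJc : g b' (J c') = 0 := by
    rw [← neg_eq_zero, ← hJ2, hsymm, hc', hw₂]
    simp [hskew, hgJ, hba, hbJa]
    field_simp
    ring
  set γ := wedgePow β 3 with hγ
  have e1 : γ ![a, J a, b', J b, c, J c] = γ ![a, J a, b, J b, c, J c] := by
    rw [← map_update_add_of_mem_span γ ![a, J a, b, J b, c, J c] 2 (x := s • a + t • J a)]
    · refine congrArg γ ?_
      funext i
      fin_cases i <;> rfl
    · exact Submodule.add_mem _
        (Submodule.smul_mem _ _ (Submodule.subset_span ⟨0, by decide, rfl⟩))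
        (Submodule.smul_mem _ _ (Submodule.subset_span ⟨1, by decide, rfl⟩))
  have e2 : γ ![a, J a, b', J b', c, J c] = γ ![a, J a, b', J b, c, J c] := by
    rw [← map_update_add_of_mem_span γ ![a, J a, b', J b, c, J c] 3 (x := s • J a + (-t) • a), hJb']
    · refine congrArg γ ?_
      funext i
      fin_cases i <;> rfl
    · exact Submodule.add_mem _
        (Submodule.smul_mem _ _ (Submodule.subset_span ⟨1, by decide, rfl⟩))
        (Submodule.smul_mem _ _ (Submodule.subset_span ⟨0, by decide, rfl⟩))
  have e3 : γ ![a, J a, b', J b', c', J c] = γ ![a, J a, b', J b', c, J c] := by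
    rw [← map_update_add_of_mem_span γ ![a, J a, b', J b', c, J c] 4
      (x := s₂ • a + t₂ • J a + u₂ • b' + w₂ • J b')]
    · refine congrArg γ ?_
      funext i
      fin_cases i <;> rfl
    · exact Submodule.add_mem _ (Submodule.add_mem _ (Submodule.add_mem _
        (Submodule.smul_mem _ _ (Submodule.subset_span ⟨0, by decide, rfl⟩))
        (Submodule.smul_mem _ _ (Submodule.subset_span ⟨1, by decide, rfl⟩)))
        (Submodule.smul_mem _ _ (Submodule.subset_span ⟨2, by decide, rfl⟩)))
        (Submodule.smul_mem _ _ (Submodule.subset_span ⟨3, by decide, rfl⟩))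
  have e4 : γ ![a, J a, b', J b', c', J c'] = γ ![a, J a, b', J b', c', J c] := by
    rw [← map_update_add_of_mem_span γ ![a, J a, b', J b', c', J c] 5
      (x := s₂ • J a + (-t₂) • a + u₂ • J b' + (-w₂) • b'), hJc']
    · refine congrArg γ ?_
      funext i
      fin_cases i <;> rfl
    · exact Submodule.add_mem _ (Submodule.add_mem _ (Submodule.add_mem _
        (Submodule.smul_mem _ _ (Submodule.subset_span ⟨1, by decide, rfl⟩))
        (Submodule.smul_mem _ _ (Submodule.subset_span ⟨0, by decide, rfl⟩)))
        (Submodule.smul_mem _ _ (Submodule.subset_span ⟨3, by decide, rfl⟩)))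
        (Submodule.smul_mem _ _ (Submodule.subset_span ⟨2, by decide, rfl⟩))
  refine ⟨6 * (g a a * g b' b' * g c' c'), by positivity, ?_⟩
  rw [← e1, ← e2, ← e3, ← e4, hγ, wedgePow_three_apply_pairs]
  · rw [hβ, hβ, hβ, hgJ, hgJ, hgJ]
    push_cast
    ring
  · obtain ⟨⟨p1, p2, p3, p4⟩, p5, p6, p7, p8⟩ :=
      twoForm_eq_zero_of_orthogonal hJ hgJ hβ hba hbJa
    obtain ⟨⟨q1, q2, q3, q4⟩, q5, q6, q7, q8⟩ :=
      twoForm_eq_zero_of_orthogonal hJ hgJ hβ hac haJc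
    obtain ⟨⟨r1, r2, r3, r4⟩, r5, r6, r7, r8⟩ :=
      twoForm_eq_zero_of_orthogonal hJ hgJ hβ hbc hbJc
    intro i j hij
    fin_cases i <;> fin_cases j <;> first | exact absurd rfl hij | assumption

end Hermitian

/-! ### No Hermitian metric is balanced -/

set_option maxRecDepth 4000 in
/-- The mean of `dΩ³(Z₂, X₁, Y₁, X₂, Y₂, X₃, Y₃)` is the mean of the positive function
`Ω³(Z₂, J Z₂, X₂, Y₂, X₃, Y₃)`. -/
theorem not_isBalanced [CompactSpace (Nilmanifold Γ)]
    (h : (nilComplexStructure Γ).HermitianMetric) : ¬ h.IsBalanced := by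
  intro hbal
  set w : Fin 6 → H3xH5 := ![lieBasis 3, lieJ (lieBasis 3), lieBasis 1, lieJ (lieBasis 1),
    lieBasis 2, lieJ (lieBasis 2)] with hw
  have hΩ := contDiff_frameForm_fundamentalPow h 3
  have hcont : ContDiff ℝ ∞ fun p => frameForm (h.fundamentalPow 3) p w :=
    (ContinuousAlternatingMap.apply ℝ H3xH5 ℂ w).contDiff.comp hΩ
  have hpos : ∀ p, ∃ r : ℝ, 0 < r ∧ frameForm (h.fundamentalPow 3) p w = r := by
    intro p
    rw [frameForm_fundamentalPow]
    refine wedgePow_three_pos (J := lieJ) (g := frameMetric h p) lieJ_lieJ (frameMetric_symm h p)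
      (fun v hv => frameMetric_pos h p hv) (frameMetric_lieJ h p)
      (frameForm_fundamentalForm h p) lieBasis_three_ne_zero (fun s t h0 => ?_)
      fun s t u w h0 => ?_
    · have h1 := congrArg (fun v : H3xH5 => v.2.x 0) h0
      simp [lieBasis, lieJ_apply] at h1
    · have h1 := congrArg (fun v : H3xH5 => v.2.x 1) h0
      simp [lieBasis, lieJ_apply] at h1
  obtain ⟨m, hm0, hm⟩ := exists_linearMap_of_periodic_pos (Γ := Γ)
    (f := fun p => (frameForm (h.fundamentalPow 3) p w).re)
    (Complex.continuous_re.comp hcont.continuous)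
    (fun p q hpq => by rw [frameForm_eq_of_nilProj_eq _ hpq])
    (fun p => by obtain ⟨r, hr, h1⟩ := hpos p; rwa [h1, Complex.ofReal_re])
  have hre : ∀ p, ((frameForm (h.fundamentalPow 3) p w).re : ℂ) =
      frameForm (h.fundamentalPow 3) p w := fun p => by
    obtain ⟨r, -, h1⟩ := hpos p
    rw [h1, Complex.ofReal_re]
  simp only [hre] at hm0
  have h1 := map_frameForm_extD (k := 5) hm hΩ ![lieBasis 3, lieBasis 0, lieJ (lieBasis 0),
    lieBasis 1, lieJ (lieBasis 1), lieBasis 2, lieJ (lieBasis 2)]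
  have h2 : extD (h.fundamentalPow 3) = 0 := hbal
  have h3 : (fun p => ceDiff (frameForm (h.fundamentalPow 3) p) ![lieBasis 3, lieBasis 0,
      lieJ (lieBasis 0), lieBasis 1, lieJ (lieBasis 1), lieBasis 2, lieJ (lieBasis 2)]) =
      fun p => frameForm (h.fundamentalPow 3) p w := by
    funext p
    set γ : H3xH5 [⋀^Fin 6]→L[ℝ] ℂ := frameForm (h.fundamentalPow 3) p with hγ
    refine (ceDiff_cons_three_pairs γ isCentral_lieBasis_three (a := 0) (b := 1) (c := 2)
      (by decide) (by decide) (by decide)).trans ?_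
    rw [lieCenter_one, lieCenter_two, lieCenter_zero,
      γ.map_eq_zero_of_eq (![lieBasis 3, lieBasis 3, lieBasis 0, lieJ (lieBasis 0), lieBasis 2,
        lieJ (lieBasis 2)]) (i := 0) (j := 1) rfl (by decide),
      γ.map_eq_zero_of_eq (![lieBasis 3, lieBasis 3, lieBasis 0, lieJ (lieBasis 0), lieBasis 1,
        lieJ (lieBasis 1)]) (i := 0) (j := 1) rfl (by decide), add_zero, add_zero]
    -- `Z₁ = J Z₂ - Z₂`, and the summand `-Z₂` is repeated in the next argument.
    have h4 := map_update_add_of_mem_span γ ![lieJ (lieBasis 3), lieBasis 3, lieBasis 1,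
      lieJ (lieBasis 1), lieBasis 2, lieJ (lieBasis 2)] 0 (x := -lieBasis 3)
      (Submodule.neg_mem _ (Submodule.subset_span ⟨1, by decide, rfl⟩))
    have h5 := γ.toAlternatingMap.map_swap w (i := 0) (j := 1) (by decide)
    have h6 : Function.update ![lieJ (lieBasis 3), lieBasis 3, lieBasis 1, lieJ (lieBasis 1),
        lieBasis 2, lieJ (lieBasis 2)] 0 (lieJ (lieBasis 3) + -lieBasis 3) =
        ![lieJ (lieBasis 3) - lieBasis 3, lieBasis 3, lieBasis 1, lieJ (lieBasis 1), lieBasis 2,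
          lieJ (lieBasis 2)] := by
      rw [← sub_eq_add_neg]
      funext i
      fin_cases i <;> rfl
    have h7 : w ∘ Equiv.swap 0 1 = ![lieJ (lieBasis 3), lieBasis 3, lieBasis 1,
        lieJ (lieBasis 1), lieBasis 2, lieJ (lieBasis 2)] := by
      funext i
      fin_cases i <;> rfl
    rw [h7] at h5
    rw [← h6]
    refine (congrArg Neg.neg (h4.trans h5)).trans (neg_neg _)
  rw [h2] at h1
  apply hm0
  rw [← h3]
  refine h1.symm.trans ?_
  exact map_zero m

end

/-! ### The invariant metric -/

/-- The inner product on the Lie algebra that is the sum of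
`2 (x₁² + y₁²) + x₂² + y₂² + x₃² + y₃²` and `(z₂ - z₁)² + z₁²`. -/
def lieMetric : H3xH5 →L[ℝ] H3xH5 →L[ℝ] ℝ :=
  LinearMap.toContinuousBilinearMap <| LinearMap.mk₂ ℝ
    (fun u v => 2 * (u.1.x ⬝ᵥ v.1.x + u.1.y ⬝ᵥ v.1.y) + u.2.x ⬝ᵥ v.2.x + u.2.y ⬝ᵥ v.2.y +
      (u.2.z - u.1.z) * (v.2.z - v.1.z) + u.1.z * v.1.z)
    (fun u v w => by simp [add_dotProduct]; ring)
    (fun r u v => by simp; ring)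
    (fun u v w => by simp [dotProduct_add]; ring)
    (fun r u v => by simp; ring)

theorem lieMetric_apply (u v : H3xH5) : lieMetric u v =
    2 * (u.1.x ⬝ᵥ v.1.x + u.1.y ⬝ᵥ v.1.y) + u.2.x ⬝ᵥ v.2.x + u.2.y ⬝ᵥ v.2.y +
      (u.2.z - u.1.z) * (v.2.z - v.1.z) + u.1.z * v.1.z := rfl

theorem lieMetric_symm (u v : H3xH5) : lieMetric u v = lieMetric v u := by
  simp only [lieMetric_apply, dotProduct_comm]
  ring

theorem lieMetric_lieJ (u v : H3xH5) : lieMetric (lieJ u) (lieJ v) = lieMetric u v := by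
  simp only [lieMetric_apply, lieJ_apply, Heisenberg.x_mk, Heisenberg.y_mk, Heisenberg.z_mk,
    neg_dotProduct, dotProduct_neg, neg_neg]
  ring

theorem lieMetric_pos {u : H3xH5} (hu : u ≠ 0) : 0 < lieMetric u u := by
  have h1 : 0 ≤ u.1.x ⬝ᵥ u.1.x := dotProduct_star_self_nonneg u.1.x
  have h2 : 0 ≤ u.1.y ⬝ᵥ u.1.y := dotProduct_star_self_nonneg u.1.y
  have h3 : 0 ≤ u.2.x ⬝ᵥ u.2.x := dotProduct_star_self_nonneg u.2.x
  have h4 : 0 ≤ u.2.y ⬝ᵥ u.2.y := dotProduct_star_self_nonneg u.2.y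
  have h5 := mul_self_nonneg (u.2.z - u.1.z)
  have h6 := mul_self_nonneg u.1.z
  rw [lieMetric_apply]
  refine lt_of_le_of_ne (by linarith) fun h0 => hu ?_
  have k5 := mul_self_eq_zero.mp (show (u.2.z - u.1.z) * (u.2.z - u.1.z) = 0 by linarith)
  have k6 := mul_self_eq_zero.mp (show u.1.z * u.1.z = 0 by linarith)
  rw [k6, sub_zero] at k5
  apply Prod.ext <;> apply Heisenberg.ext
  · exact dotProduct_self_eq_zero.mp (show u.1.x ⬝ᵥ u.1.x = 0 by linarith)
  · exact dotProduct_self_eq_zero.mp (show u.1.y ⬝ᵥ u.1.y = 0 by linarith)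
  · exact k6
  · exact dotProduct_self_eq_zero.mp (show u.2.x ⬝ᵥ u.2.x = 0 by linarith)
  · exact dotProduct_self_eq_zero.mp (show u.2.y ⬝ᵥ u.2.y = 0 by linarith)
  · exact k5

/-- The unit ball of a positive definite form on a finite-dimensional space is bounded. -/
theorem isVonNBounded_of_pos {V : Type*} [NormedAddCommGroup V] [NormedSpace ℝ V]
    [FiniteDimensional ℝ V] (g : V →L[ℝ] V →L[ℝ] ℝ) (hg : ∀ v, v ≠ 0 → 0 < g v v) :
    Bornology.IsVonNBounded ℝ {v : V | g v v < 1} := by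
  rcases subsingleton_or_nontrivial V with hV | hV
  · exact (Set.toFinite _).isVonNBounded
  have : ProperSpace V := FiniteDimensional.proper ℝ V
  obtain ⟨w, hw, hmin⟩ := (isCompact_sphere (0 : V) 1).exists_isMinOn
    (NormedSpace.sphere_nonempty.mpr zero_le_one)
    (f := fun v => g v v) (g.continuous.clm_apply continuous_id).continuousOn
  have hw0 : w ≠ 0 := by
    rintro rfl
    simp at hw
  have hc := hg w hw0
  rw [NormedSpace.isVonNBounded_iff, isBounded_iff_forall_norm_le]
  refine ⟨1 + (g w w)⁻¹, fun v hv => ?_⟩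
  rcases eq_or_ne v 0 with rfl | hv0
  · simp only [norm_zero]
    positivity
  have hn : 0 < ‖v‖ := norm_pos_iff.mpr hv0
  have h1 : g w w ≤ g (‖v‖⁻¹ • v) (‖v‖⁻¹ • v) := hmin (by simp [norm_smul, hn.ne'])
  have h2 : g w w * (‖v‖ * ‖v‖) ≤ g v v := by
    have h3 : g (‖v‖⁻¹ • v) (‖v‖⁻¹ • v) * (‖v‖ * ‖v‖) = g v v := by
      simp
      field_simp
    rw [← h3]
    exact mul_le_mul_of_nonneg_right h1 (by positivity)
  have h4 : g v v < 1 := hv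
  have h5 : ‖v‖ * ‖v‖ ≤ (g w w)⁻¹ := by
    rw [← one_div, le_div_iff₀ hc]
    linarith
  nlinarith [mul_self_nonneg (‖v‖ - 1)]

/-- A field of bilinear forms on the tangent spaces, in the trivialization given by a chart. -/
theorem trivializationAt_bilin_apply {F M : Type*} [NormedAddCommGroup F] [NormedSpace ℝ F]
    [TopologicalSpace M] [ChartedSpace F M] [IsManifold 𝓘(ℝ, F) ∞ M] {x₀ x : M}
    (hx : x ∈ (chartAt F x₀).source)
    (g : TangentSpace 𝓘(ℝ, F) x →L[ℝ] TangentSpace 𝓘(ℝ, F) x →L[ℝ] ℝ) (v w : F) :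
    (trivializationAt (F →L[ℝ] F →L[ℝ] ℝ) (fun x : M =>
        TangentSpace 𝓘(ℝ, F) x →L[ℝ] TangentSpace 𝓘(ℝ, F) x →L[ℝ] ℝ) x₀ ⟨x, g⟩).2 v w =
      g ((trivializationAt F (TangentSpace 𝓘(ℝ, F)) x₀).symmL ℝ x v)
        ((trivializationAt F (TangentSpace 𝓘(ℝ, F)) x₀).symmL ℝ x w) := by
  have hb : x ∈ (trivializationAt F (TangentSpace 𝓘(ℝ, F)) x₀).baseSet := hx
  have hb' : x ∈ (trivializationAt (F →L[ℝ] ℝ)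
      (fun x : M => TangentSpace 𝓘(ℝ, F) x →L[ℝ] ℝ) x₀).baseSet := by
    simpa [hom_trivializationAt_baseSet] using hx
  rw [hom_trivializationAt_apply, ContinuousLinearMap.inCoordinates,
    ContinuousLinearMap.comp_apply, ContinuousLinearMap.comp_apply,
    Bundle.Trivialization.continuousLinearMapAt_apply, Bundle.Trivialization.linearMapAt_apply,
    if_pos hb']
  rw [hom_trivializationAt_apply, ContinuousLinearMap.inCoordinates,
    ContinuousLinearMap.comp_apply, ContinuousLinearMap.comp_apply]
  simp

section Quotient

variable (Γ : Subgroup H3xH5) [DiscreteTopology Γ]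

/-- The metric on the quotient given by `lieMetric` in the left invariant frame. -/
def nilInner (x : Nilmanifold Γ) :
    TangentSpace 𝓘(ℝ, H3xH5) x →L[ℝ] TangentSpace 𝓘(ℝ, H3xH5) x →L[ℝ] ℝ :=
  (lieMetric.bilinearComp (frame (nilLift Γ x)⁻¹) (frame (nilLift Γ x)⁻¹) :
    H3xH5 →L[ℝ] H3xH5 →L[ℝ] ℝ)

theorem nilInner_apply (x : Nilmanifold Γ) (u v : H3xH5) :
    (nilInner Γ x : H3xH5 →L[ℝ] H3xH5 →L[ℝ] ℝ) u v =
      lieMetric (frame (nilLift Γ x)⁻¹ u) (frame (nilLift Γ x)⁻¹ v) := rfl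

theorem nilInner_frame (x : Nilmanifold Γ) (u v : H3xH5) :
    (nilInner Γ x : H3xH5 →L[ℝ] H3xH5 →L[ℝ] ℝ) (frame (nilLift Γ x) u)
      (frame (nilLift Γ x) v) = lieMetric u v := by
  rw [nilInner_apply, frame_inv_frame, frame_inv_frame]

theorem symmL_trivializationAt {x₀ x : Nilmanifold Γ} (hx : x ∈ (chartAt H3xH5 x₀).source)
    (v : H3xH5) :
    ((trivializationAt H3xH5 (TangentSpace 𝓘(ℝ, H3xH5)) x₀).symmL ℝ x v : H3xH5) =
      frame (nilLift Γ x * (chartAt H3xH5 x₀ x)⁻¹) v := by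
  rw [TangentBundle.symmL_trivializationAt_eq_core hx, tangentBundleCore_coordChange_achart]
  have h1 : nilProj Γ (chartAt H3xH5 x₀ x) = x := nilProj_chartAt hx
  have h2 := chartAt_nilProj_eventuallyEq (x := x) (p := chartAt H3xH5 x₀ x)
    (by rw [h1]; exact mem_chart_source H3xH5 x)
  rw [h1] at h2
  have h3 := (hasFDerivAt_mul_left (nilLift Γ x * (chartAt H3xH5 x₀ x)⁻¹)
    (chartAt H3xH5 x₀ x)).congr_of_eventuallyEq h2
  rw [← coe_chartAt_symm x₀] at h3
  simp only [mfld_simps, fderivWithin_univ]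
  exact congrArg (fun f : H3xH5 →L[ℝ] H3xH5 => f v) h3.fderiv

theorem contMDiff_nilInner : ContMDiff 𝓘(ℝ, H3xH5)
    (𝓘(ℝ, H3xH5).prod 𝓘(ℝ, H3xH5 →L[ℝ] H3xH5 →L[ℝ] ℝ)) ∞
    fun x : Nilmanifold Γ => Bundle.TotalSpace.mk' (H3xH5 →L[ℝ] H3xH5 →L[ℝ] ℝ)
      (E := fun x : Nilmanifold Γ =>
        TangentSpace 𝓘(ℝ, H3xH5) x →L[ℝ] TangentSpace 𝓘(ℝ, H3xH5) x →L[ℝ] ℝ) x (nilInner Γ x) := by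
  intro x₀
  rw [Bundle.contMDiffAt_section]
  have h1 : ∀ᶠ x in 𝓝 x₀, x ∈ (chartAt H3xH5 x₀).source :=
    (chartAt H3xH5 x₀).open_source.mem_nhds (mem_chart_source H3xH5 x₀)
  have h2 : ContDiff ℝ ∞ fun q : H3xH5 => lieMetric.bilinearComp (frame q⁻¹) (frame q⁻¹) := by
    rw [contDiff_clm_apply_iff]
    intro u
    rw [contDiff_clm_apply_iff]
    intro v
    have h3 : ∀ u, ContDiff ℝ ∞ fun q : H3xH5 => frame q⁻¹ u := fun u =>
      (contDiff_frame.comp contDiff_inv).clm_apply contDiff_const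
    exact (lieMetric.contDiff.comp (h3 u)).clm_apply (h3 v)
  refine ((h2.contMDiff.contMDiffAt).comp x₀ (contMDiffOn_chart.contMDiffAt
    h1)).congr_of_eventuallyEq ?_
  filter_upwards [h1] with x hx
  refine ContinuousLinearMap.ext fun v => ContinuousLinearMap.ext fun w => ?_
  refine (trivializationAt_bilin_apply hx (nilInner Γ x) v w).trans ?_
  refine (congrArg₂ (fun a b : H3xH5 => (nilInner Γ x : H3xH5 →L[ℝ] H3xH5 →L[ℝ] ℝ) a b)
    (symmL_trivializationAt Γ hx v) (symmL_trivializationAt Γ hx w)).trans ?_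
  have h3 : ∀ u, frame (nilLift Γ x)⁻¹ (frame (nilLift Γ x * (chartAt H3xH5 x₀ x)⁻¹) u) =
      frame (chartAt H3xH5 x₀ x)⁻¹ u := fun u => by
    rw [← frame_mul, inv_mul_cancel_left]
  simp only [nilInner_apply, h3]
  rfl

theorem nilInner_symm (x : Nilmanifold Γ) (u v : H3xH5) :
    (nilInner Γ x : H3xH5 →L[ℝ] H3xH5 →L[ℝ] ℝ) u v =
      (nilInner Γ x : H3xH5 →L[ℝ] H3xH5 →L[ℝ] ℝ) v u := by
  rw [nilInner_apply, nilInner_apply, lieMetric_symm]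

theorem nilInner_pos (x : Nilmanifold Γ) (u : H3xH5) (hu : u ≠ 0) :
    0 < (nilInner Γ x : H3xH5 →L[ℝ] H3xH5 →L[ℝ] ℝ) u u := by
  rw [nilInner_apply]
  refine lieMetric_pos fun h => hu ?_
  rw [← frame_frame_inv (nilLift Γ x) u, h, map_zero]

theorem nilInner_nilJ (x : Nilmanifold Γ) (u v : H3xH5) :
    (nilInner Γ x : H3xH5 →L[ℝ] H3xH5 →L[ℝ] ℝ) (nilJ Γ x u : H3xH5) (nilJ Γ x v : H3xH5) =
      (nilInner Γ x : H3xH5 →L[ℝ] H3xH5 →L[ℝ] ℝ) u v := by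
  have h : ∀ u : H3xH5, frame (nilLift Γ x)⁻¹ (nilJ Γ x u : H3xH5) =
      lieJ (frame (nilLift Γ x)⁻¹ u) := fun u => frame_inv_frame (nilLift Γ x) _
  exact (congrArg₂ (fun a b : H3xH5 => lieMetric a b) (h u) (h v)).trans (lieMetric_lieJ _ _)

/-- The invariant Riemannian metric on the quotient given by `lieMetric`. -/
def nilRiemannianMetric : Bundle.ContMDiffRiemannianMetric 𝓘(ℝ, H3xH5) ∞ H3xH5
    (fun x : Nilmanifold Γ => TangentSpace 𝓘(ℝ, H3xH5) x) where
  inner := nilInner Γ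
  symm := nilInner_symm Γ
  pos := nilInner_pos Γ
  isVonNBounded x := isVonNBounded_of_pos (V := H3xH5) (nilInner Γ x) (nilInner_pos Γ x)
  contMDiff := contMDiff_nilInner Γ

/-- The invariant Hermitian metric on the quotient given by `lieMetric`. -/
def nilMetric : (nilComplexStructure Γ).HermitianMetric where
  g := nilRiemannianMetric Γ
  compat := nilInner_nilJ Γ

theorem frameMetric_nilMetric (p u v : H3xH5) :
    frameMetric (nilMetric Γ) p u v = lieMetric u v :=
  nilInner_frame Γ (nilProj Γ p) u v

theorem nilMetric_isInvariant : (nilMetric Γ).IsInvariant := by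
  intro a p v w
  obtain ⟨v, rfl⟩ : ∃ u : H3xH5, v = frame p u := ⟨frame p⁻¹ v, (frame_frame_inv _ _).symm⟩
  obtain ⟨w, rfl⟩ : ∃ u : H3xH5, w = frame p u := ⟨frame p⁻¹ w, (frame_frame_inv _ _).symm⟩
  rw [mfderiv_nilProj_frame, mfderiv_nilProj_frame, mfderiv_nilProj_mul, mfderiv_nilProj_mul,
    frame_inv_frame, frame_inv_frame]
  exact (nilInner_frame Γ _ v w).trans (nilInner_frame Γ _ v w).symm

end Quotient

/-! ### Invariant forms -/

section Invariant

variable {Γ : Subgroup H3xH5} [DiscreteTopology Γ]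

theorem frameForm_extD_of_const {k : ℕ} {η : DiffForm H3xH5 (Nilmanifold Γ) (k + 1)}
    {θ : H3xH5 [⋀^Fin (k + 1)]→L[ℝ] ℂ} (hη : ∀ p, frameForm η p = θ) (p : H3xH5)
    (v : Fin (k + 2) → H3xH5) : frameForm (extD η) p v = ceDiff θ v := by
  have h : frameForm η = fun _ => θ := funext hη
  rw [frameForm_extD_apply η (by rw [h]; exact differentiable_const _), h]
  simp

theorem frameForm_extD_const {k : ℕ} {η : DiffForm H3xH5 (Nilmanifold Γ) (k + 1)}
    {θ : H3xH5 [⋀^Fin (k + 1)]→L[ℝ] ℂ} (hη : ∀ p, frameForm η p = θ) (p : H3xH5) :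
    frameForm (extD η) p = frameForm (extD η) 1 :=
  ContinuousAlternatingMap.ext fun v => by
    rw [frameForm_extD_of_const hη, frameForm_extD_of_const hη]

end Invariant

/-- A basis of the Lie algebra adapted to the complex structure and to the brackets. -/
def adaptedVectors : Fin 8 → H3xH5 :=
  ![lieBasis 0, lieJ (lieBasis 0), lieBasis 1, lieJ (lieBasis 1), lieBasis 2, lieJ (lieBasis 2),
    lieBasis 3, lieJ (lieBasis 3)]

/-- The coordinates with respect to `adaptedVectors`. -/
def adaptedCoord : H3xH5 ≃ₗ[ℝ] (Fin 8 → ℝ) where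
  toFun v := ![v.1.x 0, v.1.y 0, v.2.x 0, v.2.y 0, v.2.x 1, v.2.y 1, v.2.z - v.1.z, v.1.z]
  invFun c := (Heisenberg.mk ![c 0] ![c 1] (c 7),
    Heisenberg.mk ![c 2, c 4] ![c 3, c 5] (c 6 + c 7))
  map_add' u v := by
    funext i
    fin_cases i <;> simp
    ring
  map_smul' r v := by
    funext i
    fin_cases i <;> simp
    ring
  left_inv v := by
    apply Prod.ext <;> apply Heisenberg.ext
    · funext i; fin_cases i; rfl
    · funext i; fin_cases i; rfl
    · rfl
    · funext i; fin_cases i <;> rfl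
    · funext i; fin_cases i <;> rfl
    · simp
  right_inv c := by
    funext i
    fin_cases i <;> simp

theorem adaptedCoord_symm_single (i : Fin 8) :
    adaptedCoord.symm (Pi.single i 1) = adaptedVectors i := by
  change ((Heisenberg.mk _ _ _, Heisenberg.mk _ _ _) : H3xH5) = _
  apply Prod.ext <;> apply Heisenberg.ext
  · funext l; fin_cases i <;> fin_cases l <;> simp [adaptedVectors, lieBasis, lieJ_apply]
  · funext l; fin_cases i <;> fin_cases l <;> simp [adaptedVectors, lieBasis, lieJ_apply]
  · fin_cases i <;> simp [adaptedVectors, lieBasis, lieJ_apply]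
  · funext l; fin_cases i <;> fin_cases l <;> simp [adaptedVectors, lieBasis, lieJ_apply]
  · funext l; fin_cases i <;> fin_cases l <;> simp [adaptedVectors, lieBasis, lieJ_apply]
  · fin_cases i <;> simp [adaptedVectors, lieBasis, lieJ_apply]

/-- A form of top degree vanishes if it vanishes on the adapted basis. -/
theorem eq_zero_of_apply_adaptedVectors {ζ : H3xH5 [⋀^Fin 8]→L[ℝ] ℂ}
    (h : ζ adaptedVectors = 0) : ζ = 0 := by
  let b : Module.Basis (Fin 8) ℝ H3xH5 := Module.Basis.ofEquivFun adaptedCoord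
  have hb : ∀ i, b i = adaptedVectors i := fun i => by
    rw [← adaptedCoord_symm_single]
    simp [b]
  apply ContinuousAlternatingMap.toAlternatingMap_injective
  refine Module.Basis.ext_alternating b fun I hI => ?_
  let σ : Equiv.Perm (Fin 8) := Equiv.ofBijective I (Finite.injective_iff_bijective.mp hI)
  have h1 := ζ.toAlternatingMap.map_perm adaptedVectors σ
  have h2 : (fun i => b (I i)) = adaptedVectors ∘ σ := funext fun i => hb _
  rw [h2, h1]
  have h3 : ζ.toAlternatingMap adaptedVectors = 0 := h
  rw [h3, smul_zero]
  rfl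

/-! ### `∂∂̄` of powers of the fundamental form -/

theorem lieMetric_lieBasis {a b : Fin 4} (hab : a ≠ b) :
    lieMetric (lieBasis a) (lieBasis b) = 0 ∧ lieMetric (lieBasis a) (lieJ (lieBasis b)) = 0 := by
  fin_cases a <;> fin_cases b <;> simp [lieMetric_apply, lieBasis, lieJ_apply] at hab ⊢

theorem isCentral_lieCenter (a : Fin 4) : IsCentral (lieCenter a) := isCentral_bracket _ _

theorem isCentral_lieJ_lieCenter (a : Fin 4) : IsCentral (lieJ (lieCenter a)) :=
  isCentral_lieJ_bracket _ _

theorem lieCenter_mem_span (a : Fin 4) :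
    lieCenter a ∈ Submodule.span ℝ {lieBasis 3, lieJ (lieBasis 3)} ∧
      lieJ (lieCenter a) ∈ Submodule.span ℝ {lieBasis 3, lieJ (lieBasis 3)} := by
  have h1 : lieBasis 3 ∈ Submodule.span ℝ {lieBasis 3, lieJ (lieBasis 3)} :=
    Submodule.subset_span (by simp)
  have h2 : lieJ (lieBasis 3) ∈ Submodule.span ℝ {lieBasis 3, lieJ (lieBasis 3)} :=
    Submodule.subset_span (by simp)
  fin_cases a
  · change lieCenter 0 ∈ _ ∧ lieJ (lieCenter 0) ∈ _
    rw [lieCenter_zero, map_sub, lieJ_lieJ]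
    exact ⟨Submodule.sub_mem _ h2 h1, Submodule.sub_mem _ (Submodule.neg_mem _ h1) h2⟩
  · change lieCenter 1 ∈ _ ∧ lieJ (lieCenter 1) ∈ _
    rw [lieCenter_one]
    exact ⟨h1, h2⟩
  · change lieCenter 2 ∈ _ ∧ lieJ (lieCenter 2) ∈ _
    rw [lieCenter_two]
    exact ⟨h1, h2⟩
  · change lieCenter 3 ∈ _ ∧ lieJ (lieCenter 3) ∈ _
    rw [lieCenter_three, map_zero]
    exact ⟨Submodule.zero_mem _, Submodule.zero_mem _⟩

section Gauduchon

variable {β : H3xH5 [⋀^Fin 2]→L[ℝ] ℂ}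

theorem form_lieCenter_lieJ (hβ : ∀ u v, β ![u, v] = lieMetric (lieJ u) v)
    (a b : Fin 4) :
    β ![lieCenter a, lieJ (lieCenter b)] = lieMetric (lieCenter a) (lieCenter b) := by
  rw [hβ, lieMetric_lieJ]

/-- The value of `∂∂̄Ω` on two complex lines, for `γ₃ = dΩ` and `γ₄ = d∂̄Ω`. -/
theorem delDelbar_apply_pairs (hβ : ∀ u v, β ![u, v] = lieMetric (lieJ u) v)
    {γ₃ : H3xH5 [⋀^Fin 3]→L[ℝ] ℂ} {γ₄ : H3xH5 [⋀^Fin 4]→L[ℝ] ℂ}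
    (h₃ : ∀ v, γ₃ v = ceDiff β v) (h₄ : ∀ v, γ₄ v = ceDiff (typeProj lieJ 1 γ₃) v) {a b : Fin 4}
    (hab : a ≠ b) :
    typeProj lieJ 2 γ₄ ![lieBasis a, lieJ (lieBasis a), lieBasis b, lieJ (lieBasis b)] =
      Complex.I * lieMetric (lieCenter a) (lieCenter b) := by
  have hθ : ∀ a b, typeProj lieJ 1 γ₃ ![lieCenter a, lieBasis b, lieJ (lieBasis b)] =
      -(β ![lieCenter b, lieCenter a] +
        Complex.I * lieMetric (lieCenter b) (lieCenter a)) / 2 := by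
    intro a b
    rw [typeProj_one_apply_cons_pair lieJ lieJ_lieJ, h₃, h₃,
      ceDiff_cons_pair β (isCentral_lieCenter _), ceDiff_cons_pair β (isCentral_lieJ_lieCenter _),
      form_lieCenter_lieJ hβ]
    ring
  rw [typeProj_two_apply_pairs lieJ lieJ_lieJ, h₄, ceDiff_two_pairs _ hab, hθ, hθ,
    twoForm_swap β (lieCenter a), lieMetric_symm (lieCenter b)]
  ring

/-- The norms that remain in `Ω²` on two complex lines, the first of which is central: the value
is zero if the second line is central too. -/
theorem wedgePow_two_apply_central (hβ : ∀ u v, β ![u, v] = lieMetric (lieJ u) v)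
    {z z' : H3xH5}
    (hz : z ∈ Submodule.span ℝ {lieBasis 3, lieJ (lieBasis 3)})
    (hz' : z' ∈ Submodule.span ℝ {lieBasis 3, lieJ (lieBasis 3)}) (a : Fin 4) :
    wedgePow β 2 ![z, z', lieBasis a, lieJ (lieBasis a)] = 2 * (β ![z, z'] *
      (if a = 3 then 0 else lieMetric (lieBasis a) (lieBasis a) : ℝ)) := by
  rcases eq_or_ne a 3 with rfl | ha
  · have h1 := map_update_add_of_mem_span (wedgePow β 2)
      ![0, z', lieBasis 3, lieJ (lieBasis 3)] 0 (x := z)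
      (Submodule.span_mono (by
        rintro x (rfl | rfl)
        exacts [⟨2, by decide, rfl⟩, ⟨3, by decide, rfl⟩]) hz)
    rw [(wedgePow β 2).map_coord_zero (m := ![0, z', lieBasis 3, lieJ (lieBasis 3)]) 0 rfl] at h1
    have h2 : Function.update ![0, z', lieBasis 3, lieJ (lieBasis 3)] 0
        (![0, z', lieBasis 3, lieJ (lieBasis 3)] 0 + z) =
        ![z, z', lieBasis 3, lieJ (lieBasis 3)] := by
      funext i
      fin_cases i
      · exact zero_add z
      all_goals rfl
    rw [← h2]
    simpa using h1
  · have horth : ∀ z ∈ Submodule.span ℝ {lieBasis 3, lieJ (lieBasis 3)},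
        lieMetric z (lieBasis a) = 0 ∧ lieMetric z (lieJ (lieBasis a)) = 0 := by
      intro z hz
      obtain ⟨s, t, rfl⟩ := Submodule.mem_span_pair.mp hz
      obtain ⟨h1, h2⟩ := lieMetric_lieBasis ha.symm
      have h3 := (lieMetric_lieBasis ha).2
      rw [lieMetric_symm] at h3
      simp [h1, h2, h3, lieMetric_lieJ]
    obtain ⟨⟨p1, p2, -, -⟩, p5, p6, -, -⟩ := twoForm_eq_zero_of_orthogonal lieJ_lieJ lieMetric_lieJ
      hβ (horth z hz).1 (horth z hz).2
    obtain ⟨⟨q1, q2, -, -⟩, q5, q6, -, -⟩ := twoForm_eq_zero_of_orthogonal lieJ_lieJ lieMetric_lieJ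
      hβ (horth z' hz').1 (horth z' hz').2
    refine (wedgePow_two_apply_pairs β z z' (lieBasis a) (lieJ (lieBasis a)) ?_).trans ?_
    · intro i j hij
      fin_cases i <;> fin_cases j <;> first | exact absurd rfl hij | assumption
    · rw [hβ (lieBasis a), lieMetric_lieJ, if_neg ha]

/-- The value of `∂∂̄Ω²` on three complex lines, for `γ₅ = dΩ²` and `γ₆ = d∂̄Ω²`. -/
theorem delDelbar_two_apply_pairs (hβ : ∀ u v, β ![u, v] = lieMetric (lieJ u) v)
    {γ₅ : H3xH5 [⋀^Fin 5]→L[ℝ] ℂ} {γ₆ : H3xH5 [⋀^Fin 6]→L[ℝ] ℂ}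
    (h₅ : ∀ v, γ₅ v = ceDiff (wedgePow β 2) v)
    (h₆ : ∀ v, γ₆ v = ceDiff (typeProj lieJ 2 γ₅) v) {a b c : Fin 4}
    (hab : a ≠ b) (hac : a ≠ c) (hbc : b ≠ c) {N : Fin 4 → ℝ}
    (hN : ∀ a, N a = if a = 3 then 0 else lieMetric (lieBasis a) (lieBasis a)) :
    typeProj lieJ 3 γ₆ ![lieBasis a, lieJ (lieBasis a), lieBasis b, lieJ (lieBasis b), lieBasis c,
      lieJ (lieBasis c)] = 2 * Complex.I * (lieMetric (lieCenter a) (lieCenter b) * N c +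
        lieMetric (lieCenter a) (lieCenter c) * N b +
          lieMetric (lieCenter b) (lieCenter c) * N a : ℝ) := by
  have hγ : ∀ {z : H3xH5} {b c : Fin 4}, IsCentral z →
      z ∈ Submodule.span ℝ {lieBasis 3, lieJ (lieBasis 3)} → b ≠ c →
      γ₅ ![z, lieBasis b, lieJ (lieBasis b), lieBasis c, lieJ (lieBasis c)] =
        -(2 * (β ![lieCenter b, z] * N c) + 2 * (β ![lieCenter c, z] * N b)) := by
    intro z b c hz hz' hbc
    rw [h₅]
    refine (ceDiff_cons_two_pairs (wedgePow β 2) hz hbc).trans ?_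
    rw [wedgePow_two_apply_central hβ (lieCenter_mem_span b).1 hz',
      wedgePow_two_apply_central hβ (lieCenter_mem_span c).1 hz', hN, hN]
  have hθ : ∀ a {b c : Fin 4}, b ≠ c → typeProj lieJ 2 γ₅ ![lieCenter a, lieBasis b,
      lieJ (lieBasis b), lieBasis c, lieJ (lieBasis c)] =
        -(β ![lieCenter b, lieCenter a] * N c + β ![lieCenter c, lieCenter a] * N b +
          Complex.I * (lieMetric (lieCenter b) (lieCenter a) * N c +
            lieMetric (lieCenter c) (lieCenter a) * N b)) := by
    intro a b c hbc
    rw [typeProj_two_apply_cons_pairs lieJ lieJ_lieJ,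
      hγ (isCentral_lieCenter _) (lieCenter_mem_span a).1 hbc,
      hγ (isCentral_lieJ_lieCenter _) (lieCenter_mem_span a).2 hbc, form_lieCenter_lieJ hβ,
      form_lieCenter_lieJ hβ]
    ring
  rw [typeProj_three_apply_pairs lieJ lieJ_lieJ, h₆, ceDiff_three_pairs _ hab hac hbc, hθ a hbc,
    hθ b hac, hθ c hab, twoForm_swap β (lieCenter a) (lieCenter b),
    twoForm_swap β (lieCenter a) (lieCenter c), twoForm_swap β (lieCenter b) (lieCenter c),
    lieMetric_symm (lieCenter b) (lieCenter a), lieMetric_symm (lieCenter c) (lieCenter a),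
    lieMetric_symm (lieCenter c) (lieCenter b)]
  push_cast
  ring

end Gauduchon

/-! ### The Gauduchon conditions -/

theorem wedge_wedgePow_two_adaptedVectors (α : H3xH5 [⋀^Fin 4]→L[ℝ] ℂ)
    (β : H3xH5 [⋀^Fin 2]→L[ℝ] ℂ) (hv : ∀ i j : Fin 8, (i : ℕ) / 2 ≠ (j : ℕ) / 2 →
      β ![adaptedVectors i, adaptedVectors j] = 0) {b : Fin 4 → ℂ}
    (hb : ∀ i, β ![lieBasis i, lieJ (lieBasis i)] = b i) {a : Fin 4 → Fin 4 → ℂ}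
    (ha : ∀ i j, i ≠ j → α ![lieBasis i, lieJ (lieBasis i), lieBasis j, lieJ (lieBasis j)] =
      a i j) :
    wedge α (wedgePow β 2) adaptedVectors = 2 * (b 0 * b 1 * a 2 3 + b 0 * b 2 * a 1 3 +
      b 0 * b 3 * a 1 2 + b 1 * b 2 * a 0 3 + b 1 * b 3 * a 0 2 + b 2 * b 3 * a 0 1) := by
  rw [adaptedVectors, wedge_wedgePow_two_apply_pairs α β _ _ _ _ _ _ _ _ hv, hb, hb, hb, hb,
    ha 2 3 (by decide), ha 1 3 (by decide), ha 1 2 (by decide), ha 0 3 (by decide),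
    ha 0 2 (by decide), ha 0 1 (by decide)]

theorem wedge_adaptedVectors (α : H3xH5 [⋀^Fin 6]→L[ℝ] ℂ)
    (β : H3xH5 [⋀^Fin 2]→L[ℝ] ℂ) (hv : ∀ i j : Fin 8, (i : ℕ) / 2 ≠ (j : ℕ) / 2 →
      β ![adaptedVectors i, adaptedVectors j] = 0)
    (ha : ∀ i j k, i ≠ j → i ≠ k → j ≠ k → α ![lieBasis i, lieJ (lieBasis i), lieBasis j,
      lieJ (lieBasis j), lieBasis k, lieJ (lieBasis k)] = 0) :
    wedge α β adaptedVectors = 0 := by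
  rw [adaptedVectors, wedge_two_apply_four_pairs α β _ _ _ _ _ _ _ _ hv,
    ha 1 2 3 (by decide) (by decide) (by decide), ha 0 2 3 (by decide) (by decide) (by decide),
    ha 0 1 3 (by decide) (by decide) (by decide), ha 0 1 2 (by decide) (by decide) (by decide)]
  ring

section Quotient

variable (Γ : Subgroup H3xH5) [DiscreteTopology Γ]

theorem frameForm_nilMetric (p u v : H3xH5) :
    frameForm (nilMetric Γ).fundamentalForm p ![u, v] = lieMetric (lieJ u) v := by
  rw [frameForm_fundamentalForm, frameMetric_nilMetric]

theorem frameForm_nilMetric_const (p : H3xH5) :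
    frameForm (nilMetric Γ).fundamentalForm p = frameForm (nilMetric Γ).fundamentalForm 1 := by
  refine ContinuousAlternatingMap.ext fun v => ?_
  have h1 : v = ![v 0, v 1] := by funext i; fin_cases i <;> rfl
  rw [h1, frameForm_nilMetric, frameForm_nilMetric]

theorem frameForm_nilMetric_pow (k : ℕ) (p : H3xH5) :
    frameForm ((nilMetric Γ).fundamentalPow k) p =
      wedgePow (frameForm (nilMetric Γ).fundamentalForm 1) k := by
  rw [frameForm_fundamentalPow, frameForm_nilMetric_const]

set_option maxRecDepth 4000 in
theorem fundamentalForm_adaptedVectors (i j : Fin 8) (hij : (i : ℕ) / 2 ≠ (j : ℕ) / 2) :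
    frameForm (nilMetric Γ).fundamentalForm 1 ![adaptedVectors i, adaptedVectors j] = 0 := by
  have hβ := frameForm_nilMetric Γ 1
  have h : ∀ {a b : Fin 4} (hab : a ≠ b), _ := fun hab => twoForm_eq_zero_of_orthogonal lieJ_lieJ
    lieMetric_lieJ hβ (lieMetric_lieBasis hab).1 (lieMetric_lieBasis hab).2
  obtain ⟨⟨a1, a2, a3, a4⟩, a5, a6, a7, a8⟩ := h (show (0 : Fin 4) ≠ 1 by decide)
  obtain ⟨⟨b1, b2, b3, b4⟩, b5, b6, b7, b8⟩ := h (show (0 : Fin 4) ≠ 2 by decide)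
  obtain ⟨⟨c1, c2, c3, c4⟩, c5, c6, c7, c8⟩ := h (show (0 : Fin 4) ≠ 3 by decide)
  obtain ⟨⟨d1, d2, d3, d4⟩, d5, d6, d7, d8⟩ := h (show (1 : Fin 4) ≠ 2 by decide)
  obtain ⟨⟨e1, e2, e3, e4⟩, e5, e6, e7, e8⟩ := h (show (1 : Fin 4) ≠ 3 by decide)
  obtain ⟨⟨f1, f2, f3, f4⟩, f5, f6, f7, f8⟩ := h (show (2 : Fin 4) ≠ 3 by decide)
  clear h
  unfold adaptedVectors
  generalize frameForm (nilMetric Γ).fundamentalForm 1 = β at *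
  generalize lieJ = J at *
  generalize lieBasis = e at *
  fin_cases i <;> fin_cases j <;> first | exact absurd rfl hij | assumption

theorem lieMetric_lieBasis_self : lieMetric (lieBasis 0) (lieBasis 0) = 2 ∧
    lieMetric (lieBasis 1) (lieBasis 1) = 1 ∧ lieMetric (lieBasis 2) (lieBasis 2) = 1 ∧
    lieMetric (lieBasis 3) (lieBasis 3) = 1 := by
  refine ⟨?_, ?_, ?_, ?_⟩ <;> simp [lieMetric_apply, lieBasis]

theorem lieMetric_lieCenter : lieMetric (lieCenter 0) (lieCenter 1) = -1 ∧
    lieMetric (lieCenter 0) (lieCenter 2) = -1 ∧ lieMetric (lieCenter 1) (lieCenter 2) = 1 ∧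
    ∀ a, lieMetric (lieCenter a) (lieCenter 3) = 0 := by
  rw [lieCenter_zero, lieCenter_one, lieCenter_two, lieCenter_three]
  refine ⟨?_, ?_, ?_, fun a => map_zero _⟩ <;> simp [lieMetric_apply, lieBasis, lieJ_apply]

/-- The inner products of the brackets balance, with weights given by the norms, on all triples of
complex lines of the adapted basis. -/
theorem balance_lieCenter {a b c : Fin 4} (hab : a ≠ b) (hac : a ≠ c) (hbc : b ≠ c) :
    lieMetric (lieCenter a) (lieCenter b) *
        (if c = 3 then 0 else lieMetric (lieBasis c) (lieBasis c)) +
      lieMetric (lieCenter a) (lieCenter c) *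
        (if b = 3 then 0 else lieMetric (lieBasis b) (lieBasis b)) +
      lieMetric (lieCenter b) (lieCenter c) *
        (if a = 3 then 0 else lieMetric (lieBasis a) (lieBasis a)) = 0 := by
  obtain ⟨h0, h1, h2, h3⟩ := lieMetric_lieBasis_self
  obtain ⟨k1, k2, k3, k4⟩ := lieMetric_lieCenter
  have k4' : ∀ a, lieMetric (lieCenter 3) (lieCenter a) = 0 := fun a => by
    rw [lieMetric_symm, k4]
  have k1' := (lieMetric_symm (lieCenter 1) (lieCenter 0)).trans k1
  have k2' := (lieMetric_symm (lieCenter 2) (lieCenter 0)).trans k2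
  have k3' := (lieMetric_symm (lieCenter 2) (lieCenter 1)).trans k3
  fin_cases a <;> fin_cases b <;> first | exact absurd rfl hab | skip
  all_goals fin_cases c <;> first | exact absurd rfl hac | exact absurd rfl hbc | skip
  all_goals
    simp only [Fin.zero_eta, Fin.mk_one, Fin.reduceFinMk, Fin.reduceEq, if_false, k1, k2, k3, k4,
      k1',
      k2', k3', k4', h0, h1, h2, h3]
    norm_num

theorem fundamentalForm_lieBasis (a : Fin 4) :
    frameForm (nilMetric Γ).fundamentalForm 1 ![lieBasis a, lieJ (lieBasis a)] =
      lieMetric (lieBasis a) (lieBasis a) := by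
  rw [frameForm_nilMetric, lieMetric_lieJ]

variable {Γ} in
/-- The operators `∂` and `∂̄` on invariant forms are algebraic. -/
theorem exists_frameForm_del_delbar {k : ℕ} (m : ℕ) {η : DiffForm H3xH5 (Nilmanifold Γ) (k + 1)}
    {θ : H3xH5 [⋀^Fin (k + 1)]→L[ℝ] ℂ} (hη : ∀ p, frameForm η p = θ) :
    ∃ (γ : H3xH5 [⋀^Fin (k + 2)]→L[ℝ] ℂ) (γ' : H3xH5 [⋀^Fin (k + 3)]→L[ℝ] ℂ),
      (∀ v, γ v = ceDiff θ v) ∧ (∀ v, γ' v = ceDiff (typeProj lieJ m γ) v) ∧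
      ∀ p, frameForm ((nilComplexStructure Γ).del m ((nilComplexStructure Γ).delbar m η)) p =
        typeProj lieJ (m + 1) γ' := by
  have h2 : ∀ p, frameForm ((nilComplexStructure Γ).delbar m η) p =
      typeProj lieJ m (frameForm (extD η) 1) := fun p => by
    rw [ComplexStructure.delbar, frameForm_proj, frameForm_extD_const hη]
  refine ⟨frameForm (extD η) 1, frameForm (extD ((nilComplexStructure Γ).delbar m η)) 1,
    frameForm_extD_of_const hη 1, frameForm_extD_of_const h2 1, fun p => ?_⟩
  rw [ComplexStructure.del, frameForm_proj, frameForm_extD_const h2]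

theorem exists_frameForm_delDelbarPow_one :
    ∃ α : H3xH5 [⋀^Fin 4]→L[ℝ] ℂ, (∀ p, frameForm ((nilMetric Γ).delDelbarPow 1) p = α) ∧
      ∀ a b, a ≠ b → α ![lieBasis a, lieJ (lieBasis a), lieBasis b, lieJ (lieBasis b)] =
        Complex.I * lieMetric (lieCenter a) (lieCenter b) := by
  have h1 : ∀ p, frameForm ((nilMetric Γ).fundamentalPow 1) p =
      frameForm (nilMetric Γ).fundamentalForm 1 := fun p =>
    (frameForm_nilMetric_pow Γ 1 p).trans (ContinuousAlternatingMap.ext (wedgePow_one_apply _))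
  obtain ⟨γ₃, γ₄, h₃, h₄, h⟩ := exists_frameForm_del_delbar (k := 1) 1 h1
  exact ⟨typeProj lieJ 2 γ₄, h, fun a b hab =>
    delDelbar_apply_pairs (frameForm_nilMetric Γ 1) h₃ h₄ hab⟩

theorem exists_frameForm_delDelbarPow_two :
    ∃ α : H3xH5 [⋀^Fin 6]→L[ℝ] ℂ, (∀ p, frameForm ((nilMetric Γ).delDelbarPow 2) p = α) ∧
      ∀ a b c, a ≠ b → a ≠ c → b ≠ c → α ![lieBasis a, lieJ (lieBasis a), lieBasis b,
        lieJ (lieBasis b), lieBasis c, lieJ (lieBasis c)] = 0 := by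
  obtain ⟨γ₅, γ₆, h₅, h₆, h⟩ :=
    exists_frameForm_del_delbar (k := 3) 2 (frameForm_nilMetric_pow Γ 2)
  exact ⟨typeProj lieJ 3 γ₆, h, fun a b c hab hac hbc =>
    (delDelbar_two_apply_pairs (frameForm_nilMetric Γ 1) h₅ h₆ hab hac hbc fun _ => rfl).trans
      (by rw [balance_lieCenter hab hac hbc, Complex.ofReal_zero, mul_zero])⟩

variable {Γ} in
/-- A top degree condition can be checked on the adapted basis. -/
theorem wedge_eq_zero_of_adaptedVectors {k l : ℕ} (hkl : k + l = 8)
    (α : DiffForm H3xH5 (Nilmanifold Γ) k) (θ : DiffForm H3xH5 (Nilmanifold Γ) l)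
    {α₀ : H3xH5 [⋀^Fin k]→L[ℝ] ℂ} {θ₀ : H3xH5 [⋀^Fin l]→L[ℝ] ℂ} (hα : ∀ p, frameForm α p = α₀)
    (hθ : ∀ p, frameForm θ p = θ₀) {w : Fin (k + l) → H3xH5}
    (hw : ∀ i, w i = adaptedVectors (Fin.cast hkl i)) (h : wedge α₀ θ₀ w = 0)
    (x : Nilmanifold Γ) : wedge (α x) (θ x) = 0 := by
  have h1 : (fun x => wedge (α x) (θ x) : DiffForm H3xH5 (Nilmanifold Γ) (k + l)) = 0 := by
    refine eq_zero_of_frameForm_eq_zero fun p => ?_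
    have h2 : frameForm (fun x => wedge (α x) (θ x) : DiffForm H3xH5 (Nilmanifold Γ) (k + l)) p =
        wedge (frameForm α p) (frameForm θ p) :=
      wedge_compContinuousLinearMap (V := H3xH5) _ _ _
    rw [h2, hα, hθ]
    rw [funext hw] at h
    have h3 : ∀ (m : ℕ) (hm : m = 8) (ζ : H3xH5 [⋀^Fin m]→L[ℝ] ℂ),
        ζ (fun i => adaptedVectors (Fin.cast hm i)) = 0 → ζ = 0 := by
      rintro _ rfl ζ hζ
      exact eq_zero_of_apply_adaptedVectors hζ
    exact h3 _ hkl _ h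
  exact congrFun h1 x

theorem isKthGauduchon_one : (nilMetric Γ).IsKthGauduchon 1 := by
  obtain ⟨α, hα, ha⟩ := exists_frameForm_delDelbarPow_one Γ
  obtain ⟨h0, h1, h2, h3⟩ := lieMetric_lieBasis_self
  obtain ⟨k1, k2, k3, k4⟩ := lieMetric_lieCenter
  have h := wedge_wedgePow_two_adaptedVectors α _ (fundamentalForm_adaptedVectors Γ)
    (fundamentalForm_lieBasis Γ) ha
  simp only [h0, h1, h2, h3, k1, k2, k3, k4] at h
  have h' := h.trans (b := _) (c := 0) (by push_cast; ring)
  clear h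
  generalize hw : adaptedVectors = w at h'
  have hw' : ∀ i : Fin (4 + 2 * 2), w i = adaptedVectors (Fin.cast rfl i) := fun i => by
    rw [hw]; exact congrArg w (Fin.ext rfl)
  exact ⟨le_rfl, by norm_num, wedge_eq_zero_of_adaptedVectors (k := 4) (l := 2 * 2) rfl
    ((nilMetric Γ).delDelbarPow 1) ((nilMetric Γ).fundamentalPow 2) hα
    (frameForm_nilMetric_pow Γ 2) hw' h'⟩

theorem isKthGauduchon_two : (nilMetric Γ).IsKthGauduchon 2 := by
  obtain ⟨α, hα, ha⟩ := exists_frameForm_delDelbarPow_two Γ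
  have hp : ∀ p, frameForm ((nilMetric Γ).fundamentalPow 1) p =
      frameForm (nilMetric Γ).fundamentalForm 1 := fun p =>
    (frameForm_nilMetric_pow Γ 1 p).trans (ContinuousAlternatingMap.ext (wedgePow_one_apply _))
  have h' := wedge_adaptedVectors α _ (fundamentalForm_adaptedVectors Γ) ha
  generalize hw : adaptedVectors = w at h'
  have hw' : ∀ i : Fin (6 + 2), w i = adaptedVectors (Fin.cast rfl i) := fun i => by
    rw [hw]; exact congrArg w (Fin.ext rfl)
  exact ⟨by norm_num, by norm_num, wedge_eq_zero_of_adaptedVectors (k := 6) (l := 2) rfl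
    ((nilMetric Γ).delDelbarPow 2) ((nilMetric Γ).fundamentalPow 1) hα hp hw' h'⟩

end Quotient

end

theorem mainTheorem8 (Γ : Subgroup H3xH5) [DiscreteTopology Γ] [CompactSpace (Nilmanifold Γ)] :
    ∃ 𝒥 : ComplexStructure H3xH5 (Nilmanifold Γ) 4,
      𝒥.IsInvariant ∧
      (∀ h : 𝒥.HermitianMetric, ¬ h.IsSKT) ∧
      (∀ h : 𝒥.HermitianMetric, ¬ h.IsBalanced) ∧
      ∃ h : 𝒥.HermitianMetric, h.IsInvariant ∧ h.IsKthGauduchon 1 ∧ h.IsKthGauduchon 2 :=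
  ⟨nilComplexStructure Γ, nilComplexStructure_isInvariant Γ, not_isSKT, not_isBalanced,
    nilMetric Γ, nilMetric_isInvariant Γ, isKthGauduchon_one Γ, isKthGauduchon_two Γ⟩
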